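/- Let $p$ be a prime and let $L$ and $K$ be finite extensions of $\mathbb{Q}_p$ such that $[L:\mathbb{Q}_p]=|\mathrm{Hom}_{\mathbb{Q}_p}(L,K)|$ (the set of $\mathbb{Q}_p$-embeddings $\sigma:L\hookrightarrow K$). Let $p^f$ be the cardinality of the residue field of $L$, let $L_0$ be the maximal unramified subfield of $L$ (so $f=[L_0:\mathbb{Q}_p]$), $\varphi_0$ the absolute Frobenius of $L_0$, $e=[L:\mathbb{Q}_p]/f$, and $\mathrm{val}_L=e\,\mathrm{val}_{\mathbb{Q}_p}$, where $\mathrm{val}_{\mathbb{Q}_p}(p)=1$. Let $d\ge 1$, let $(\zeta_1,\dots,\zeta_{d+1})\in(K^\times)^{d+1}$, let $\tau$ be a permutation of $\{1,\dots,d+1\}$ with $\mathrm{val}_L(\zeta_{\tau(1)})\le\dots\le\mathrm{val}_L(\zeta_{\tau(d+1)})$, and for each $\sigma:L\hookrightarrow K$ let $i_{1,\sigma}<\dots<i_{d+1,\sigma}$ be integers. Let $D=\bigoplus_{j=1}^{d+1}(L_0\otimes_{\mathbb{Q}_p}K)e_j$ and let $F_\zeta$ be the $L_0\otimes_{\mathbb{Q}_p}K$-linear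 automorphism of $D$ with $F_\zeta(e_j)=\zeta_j^{-1}e_j$. A Frobenius on $D$ is an additive bijection $\varphi:D\to D$ with $\varphi((\ell\otimes k)x)=(\varphi_0(\ell)\otimes k)\varphi(x)$; then $\varphi^f$ is $L_0\otimes_{\mathbb{Q}_p}K$-linear, and $(\varphi^f)^{\mathrm{ss}}$ denotes its semisimple part (Jordan decomposition). Put $D_L=L\otimes_{L_0}D\simeq\prod_\sigma D_{L,\sigma}$, where $D_{L,\sigma}$ is the part of $D_L$ on which $L$ acts through $\sigma$ and the action of $K$. Consider decreasing, exhaustive, separated filtrations $(\mathrm{Fil}^iD_L)_{i\in\mathbb{Z}}$ of $D_L$ by $L\otimes_{\mathbb{Q}_p}K$-submodules, and put $\mathrm{Fil}^iD_{L,\sigma}=\mathrm{Fil}^iD_L\cap D_{L,\sigma}$. For an $L_0$-subspace $D'\subseteq D$ with $\varphi(D')\subseteq D'$, put $D'_L=L\otimes_{L_0}D'$ with the induced filtration and $$t_N(D')=\tfrac1{[L:\mathbb{Q}_p]}\mathrm{val}_L\big(\det{}_{L_0}(\varphi^f|_{D'})\big),\qquad t_H(D'_L)=\sum_{i\in\mathbb{Z}}i\,\dim_L\big(\mathrm{Fil}^iD'_L/\mathrm{Fil}^{i+1}D'_L\big).$$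 The filtration is called admissible if $t_H(D_L)=t_N(D)$ and $t_H(D'_L)\le t_N(D')$ for every such $D'$. Then the following three conditions are equivalent: (i) there are a Frobenius $\varphi$ on $D$ with $(\varphi^f)^{\mathrm{ss}}=F_\zeta$ and an admissible filtration on $(D,\varphi)$ such that, for all $\sigma$ and all $i\in\mathbb{Z}$, $\mathrm{Fil}^iD_{L,\sigma}/\mathrm{Fil}^{i+1}D_{L,\sigma}\neq0$ if and only if $i\in\{i_{1,\sigma},\dots,i_{d+1,\sigma}\}$; (ii) $\displaystyle\sum_{j=1}^{i}\sum_\sigma i_{j,\sigma}\le-\sum_{j=d+2-i}^{d+1}\mathrm{val}_L(\zeta_{\tau(j)})$ for $1\le i\le d$, and $\displaystyle\sum_{j=1}^{d+1}\sum_\sigma i_{j,\sigma}=-\sum_{j=1}^{d+1}\mathrm{val}_L(\zeta_{\tau(j)})$; (iii) the (Hodge) polygon associated to $\big(\sum_{j=1}^{i}\sum_\sigma i_{j,\sigma}\big)_{1\le i\le d+1}$ lies under the (Newton) polygon associated to $\big(-\sum_{j=d+2-i}^{d+1}\mathrm{val}_L(\zeta_{\tau(j)})\big)_{1\le i\le d+1}$,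 and both have the same endpoints. Here the polygon associated to $(y_1,\dots,y_{d+1})$ is the graph on $[0,d+1]$ of the piecewise linear function joining $(0,0),(1,y_1),\dots,(d+1,y_{d+1})$. -/

import Mathlib

open scoped TensorProduct

namespace FilteredPhi

noncomputable section

/-! ## The field `L₀`, the numbers `f`, `e`, the valuations and the absolute Frobenius -/

/-- The maximal unramified subfield `L₀` of a finite extension `L` of `ℚ_p`: it is generated over
`ℚ_p` by the roots of unity of `L` of order prime to `p` (the nonzero Teichmüller representatives,
so that `L₀ = Frac W(𝔽_q)` with `𝔽_q` the residue field of `L`). -/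
def maxUnram (p : ℕ) [Fact p.Prime] (L : Type*) [Field L] [Algebra ℚ_[p] L] :
    IntermediateField ℚ_[p] L :=
  IntermediateField.adjoin ℚ_[p] {x : L | ∃ n : ℕ, p.Coprime n ∧ x ^ n = 1}

/-- `L₀` as a field in its own right. -/
def L₀ (p : ℕ) [Fact p.Prime] (L : Type*) [Field L] [Algebra ℚ_[p] L] : Type _ :=
  maxUnram p L

section Instances

variable (p : ℕ) [Fact p.Prime] (L : Type*) [Field L] [Algebra ℚ_[p] L]

instance : Field (L₀ p L) := inferInstanceAs (Field (maxUnram p L))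

instance : Algebra ℚ_[p] (L₀ p L) := inferInstanceAs (Algebra ℚ_[p] (maxUnram p L))

instance : Algebra (L₀ p L) L := inferInstanceAs (Algebra (maxUnram p L) L)

instance : IsScalarTower ℚ_[p] (L₀ p L) L :=
  inferInstanceAs (IsScalarTower ℚ_[p] (maxUnram p L) L)

instance [FiniteDimensional ℚ_[p] L] : FiniteDimensional ℚ_[p] (L₀ p L) :=
  inferInstanceAs (FiniteDimensional ℚ_[p] (maxUnram p L))

end Instances

/-- The residue degree `f = [L₀ : ℚ_p]` (the residue field of `L` has `p ^ f` elements). -/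
def resDeg (p : ℕ) [Fact p.Prime] (L : Type*) [Field L] [Algebra ℚ_[p] L] : ℕ :=
  Module.finrank ℚ_[p] (L₀ p L)

/-- The valuation `val_{ℚ_p}` on a finite extension `F` of `ℚ_p`, normalized by
`val_{ℚ_p}(p) = 1`. It is given by the usual formula `v_p(N_{F/ℚ_p}(x)) / [F : ℚ_p]` for the
unique extension of the `p`-adic valuation. (The value at `0` is never used.) -/
def valP (p : ℕ) [Fact p.Prime] (F : Type*) [Field F] [Algebra ℚ_[p] F] (x : F) : ℚ :=
  (Padic.valuation (Algebra.norm ℚ_[p] x) : ℚ) / Module.finrank ℚ_[p] F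

/-- `val_L = e · val_{ℚ_p}` with `e = [L : ℚ_p] / f`, on any finite extension `F` of `ℚ_p`. -/
def valL (p : ℕ) [Fact p.Prime] (L : Type*) [Field L] [Algebra ℚ_[p] L]
    (F : Type*) [Field F] [Algebra ℚ_[p] F] (x : F) : ℚ :=
  ((Module.finrank ℚ_[p] L : ℚ) / resDeg p L) * valP p F x

section Frob

variable (p : ℕ) [Fact p.Prime] (L : Type*) [Field L] [Algebra ℚ_[p] L]

theorem isGalois_L₀ : IsGalois ℚ_[p] (L₀ p L) := by
  let S : Set ℕ := {n | p.Coprime n ∧ ∃ r : L, IsPrimitiveRoot r n}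
  have hset : {x : L | ∃ n : ℕ, p.Coprime n ∧ x ^ n = 1} =
      {x : L | ∃ n ∈ S, n ≠ 0 ∧ x ^ n = 1} := by
    ext x
    constructor
    · rintro ⟨n, hn, hx⟩
      have hn0 : n ≠ 0 := by
        rintro rfl
        exact (Fact.out : p.Prime).one_lt.ne' (by simpa using hn)
      refine ⟨orderOf x, ⟨hn.coprime_dvd_right (orderOf_dvd_of_pow_eq_one hx), x,
        IsPrimitiveRoot.orderOf x⟩, ?_, pow_orderOf_eq_one x⟩
      exact ((orderOf_pos_iff).2 (isOfFinOrder_iff_pow_eq_one.2 ⟨n, Nat.pos_of_ne_zero hn0, hx⟩)).ne'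
    · rintro ⟨n, ⟨hn, -⟩, -, hx⟩
      exact ⟨n, hn, hx⟩
  have h : IsCyclotomicExtension S ℚ_[p] (maxUnram p L) := by
    rw [maxUnram, hset]
    exact IntermediateField.isCyclotomicExtension_adjoin_of_exists_isPrimitiveRoot S ℚ_[p] L
      (fun n hn _ => hn.2)
  exact IsCyclotomicExtension.isGalois S ℚ_[p] (maxUnram p L)

variable [FiniteDimensional ℚ_[p] L]

theorem exists_absFrob : ∃ φ : L₀ p L ≃ₐ[ℚ_[p]] L₀ p L,
    ∀ (x : L₀ p L) (n : ℕ), p.Coprime n → x ^ n = 1 → φ x = x ^ p := by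
  have hgal := isGalois_L₀ p L
  let : Algebra ℤ_[p] (L₀ p L) :=
    ((algebraMap ℚ_[p] (L₀ p L)).comp (algebraMap ℤ_[p] ℚ_[p])).toAlgebra
  have : IsScalarTower ℤ_[p] ℚ_[p] (L₀ p L) := IsScalarTower.of_algebraMap_eq fun _ => rfl
  let O := integralClosure ℤ_[p] (L₀ p L)
  have : IsFractionRing O (L₀ p L) :=
    integralClosure.isFractionRing_of_finite_extension ℚ_[p] (L₀ p L)
  let := IsIntegralClosure.MulSemiringAction ℤ_[p] ℚ_[p] (L₀ p L) O
  have := Algebra.isInvariant_of_isGalois ℤ_[p] ℚ_[p] (L₀ p L) O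
  have hcomm : SMulCommClass Gal(L₀ p L/ℚ_[p]) ℤ_[p] O :=
    ⟨fun g r x => map_smul (galRestrict ℤ_[p] ℚ_[p] (L₀ p L) O g) r x⟩
  obtain ⟨Q, hQ⟩ := Ideal.exists_maximal O
  have hfin : Module.Finite ℤ_[p] O := IsIntegralClosure.finite ℤ_[p] ℚ_[p] (L₀ p L) O
  have hmax : (Q.under ℤ_[p]).IsMaximal := Ideal.isMaximal_comap_of_isIntegral_of_isMaximal Q
  have hu : Q.under ℤ_[p] = IsLocalRing.maximalIdeal ℤ_[p] := IsLocalRing.eq_maximalIdeal hmax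
  have hcard : Nat.card (ℤ_[p] ⧸ Q.under ℤ_[p]) = p := by
    rw [hu]
    exact (Nat.card_congr (PadicInt.residueField (p := p)).toEquiv).trans (Nat.card_zmod p)
  have : Finite (ℤ_[p] ⧸ Q.under ℤ_[p]) :=
    Nat.finite_of_card_ne_zero (by rw [hcard]; exact (Fact.out : p.Prime).ne_zero)
  have : Module.Finite (ℤ_[p] ⧸ Q.under ℤ_[p]) (O ⧸ Q) := inferInstance
  have : Finite (O ⧸ Q) := Module.finite_of_finite (ℤ_[p] ⧸ Q.under ℤ_[p])
  obtain ⟨g, hg⟩ := IsArithFrobAt.exists_of_isInvariant ℤ_[p] Gal(L₀ p L/ℚ_[p]) Q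
  refine ⟨g, fun x n hn hx => ?_⟩
  have hn0 : 0 < n := by
    rcases Nat.eq_zero_or_pos n with rfl | h
    · exact absurd (by simpa using hn) (Fact.out : p.Prime).one_lt.ne'
    · exact h
  have hxi : IsIntegral ℤ_[p] x := .of_pow hn0 (by rw [hx]; exact isIntegral_one)
  let z : O := ⟨x, hxi⟩
  have hz : z ^ n = 1 := Subtype.ext hx
  have hnQ : ((n : ℕ) : O) ∉ Q := by
    intro h
    have h1 : ((n : ℕ) : ℤ_[p]) ∈ Q.under ℤ_[p] := by
      rw [Ideal.under_def, Ideal.mem_comap, map_natCast]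
      exact h
    have h2 : ((p : ℕ) : ℤ_[p]) ∈ Q.under ℤ_[p] := by
      rw [hu, PadicInt.maximalIdeal_eq_span_p]
      exact Ideal.mem_span_singleton_self _
    apply hmax.ne_top
    rw [Ideal.eq_top_iff_one]
    obtain ⟨a, b, hab⟩ := Nat.isCoprime_iff_coprime.2 hn
    have h3 : (1 : ℤ_[p]) = (a : ℤ_[p]) * (p : ℕ) + (b : ℤ_[p]) * (n : ℕ) := by
      exact_mod_cast hab.symm
    rw [h3]
    exact Ideal.add_mem _ (Ideal.mul_mem_left _ _ h2) (Ideal.mul_mem_left _ _ h1)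
  have hfrob := hg.apply_of_pow_eq_one hz hnQ
  rw [hcard] at hfrob
  have h4 := congrArg (algebraMap O (L₀ p L)) hfrob
  rw [map_pow] at h4
  exact (algebraMap_galRestrict_apply ℤ_[p] g z).symm.trans h4

/-- The absolute Frobenius `φ₀` of `L₀ = Frac W(𝔽_q)`: the unique automorphism that raises every
root of unity of order prime to `p` (every Teichmüller representative) to the power `p`. -/
def absFrob : L₀ p L ≃ₐ[ℚ_[p]] L₀ p L := (exists_absFrob p L).choose

theorem absFrob_spec (x : L₀ p L) (n : ℕ) (hn : p.Coprime n) (hx : x ^ n = 1) :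
    absFrob p L x = x ^ p :=
  (exists_absFrob p L).choose_spec x n hn hx

theorem absFrob_pow_resDeg : absFrob p L ^ resDeg p L = 1 := by
  have := isGalois_L₀ p L
  rw [resDeg, ← IsGalois.card_aut_eq_finrank]
  exact pow_card_eq_one'

theorem absFrob_iterate_resDeg (x : L₀ p L) : (absFrob p L)^[resDeg p L] x = x := by
  have h := congrArg (fun g : L₀ p L ≃ₐ[ℚ_[p]] L₀ p L => g x)
    (absFrob_pow_resDeg p L)
  simpa [AlgEquiv.coe_pow] using h

end Frob

/-! ## Frobenius maps on `D` -/

/-- The coefficient ring `L₀ ⊗_{ℚ_p} K`. -/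
abbrev CoeffRing (p : ℕ) [Fact p.Prime] (L K : Type*) [Field L] [Algebra ℚ_[p] L]
    [Field K] [Algebra ℚ_[p] K] : Type _ :=
  L₀ p L ⊗[ℚ_[p]] K

/-- The free `L₀ ⊗ K`-module `D` of rank `n` with basis `e_1, …, e_n`. -/
abbrev PhiSpace (p : ℕ) [Fact p.Prime] (L K : Type*) [Field L] [Algebra ℚ_[p] L]
    [Field K] [Algebra ℚ_[p] K] (n : ℕ) : Type _ :=
  Fin n → CoeffRing p L K

/-- A Frobenius on `D`: an additive bijection with
`φ((ℓ ⊗ k) · x) = (φ₀(ℓ) ⊗ k) · φ(x)`. -/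
structure Frobenius (p : ℕ) [Fact p.Prime] (L K : Type*) [Field L] [Algebra ℚ_[p] L]
    [FiniteDimensional ℚ_[p] L] [Field K] [Algebra ℚ_[p] K] (n : ℕ) where
  toFun : PhiSpace p L K n → PhiSpace p L K n
  map_add : ∀ x y, toFun (x + y) = toFun x + toFun y
  map_smul : ∀ (l : L₀ p L) (k : K) (x : PhiSpace p L K n),
    toFun ((l ⊗ₜ[ℚ_[p]] k : CoeffRing p L K) • x) =
      (absFrob p L l ⊗ₜ[ℚ_[p]] k : CoeffRing p L K) • toFun x
  bijective : Function.Bijective toFun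

section Spaces

variable {p : ℕ} [Fact p.Prime] {L K : Type*} [Field L] [Algebra ℚ_[p] L]
  [FiniteDimensional ℚ_[p] L] [Field K] [Algebra ℚ_[p] K] {n : ℕ}

theorem Frobenius.iterate_add (φ : Frobenius p L K n) (m : ℕ) (x y : PhiSpace p L K n) :
    φ.toFun^[m] (x + y) = φ.toFun^[m] x + φ.toFun^[m] y := by
  induction m generalizing x y with
  | zero => rfl
  | succ m ih => rw [Function.iterate_succ_apply, φ.map_add, ih]; rfl

theorem Frobenius.iterate_smul (φ : Frobenius p L K n) (m : ℕ) (l : L₀ p L) (k : K)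
    (x : PhiSpace p L K n) :
    φ.toFun^[m] ((l ⊗ₜ[ℚ_[p]] k : CoeffRing p L K) • x) =
      ((absFrob p L)^[m] l ⊗ₜ[ℚ_[p]] k : CoeffRing p L K) • φ.toFun^[m] x := by
  induction m generalizing l x with
  | zero => rfl
  | succ m ih => rw [Function.iterate_succ_apply, φ.map_smul, ih]; rfl

/-- The `L₀ ⊗ K`-linear endomorphism `φ ^ f` of `D`. -/
def Frobenius.linPow (φ : Frobenius p L K n) :
    PhiSpace p L K n →ₗ[CoeffRing p L K] PhiSpace p L K n where
  toFun := φ.toFun^[resDeg p L]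
  map_add' := φ.iterate_add _
  map_smul' r x := by
    induction r using TensorProduct.induction_on with
    | zero =>
      have h := φ.iterate_smul (resDeg p L) 0 0 x
      simpa [iterate_map_zero] using h
    | tmul l k => simp [φ.iterate_smul, absFrob_iterate_resDeg]
    | add a b ha hb =>
      simp only [RingHom.id_apply] at ha hb ⊢
      rw [add_smul, φ.iterate_add, ha, hb, add_smul]

/-- `φ ^ f` regarded as an endomorphism of the `L₀`-vector space `D`. -/
def Frobenius.linPowL₀ (φ : Frobenius p L K n) :
    PhiSpace p L K n →ₗ[L₀ p L] PhiSpace p L K n :=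
  φ.linPow.restrictScalars (L₀ p L)

theorem Frobenius.linPowL₀_mem (φ : Frobenius p L K n)
    {W : Submodule (L₀ p L) (PhiSpace p L K n)} (hW : ∀ x ∈ W, φ.toFun x ∈ W) :
    ∀ x ∈ W, φ.linPowL₀ x ∈ W := by
  have key : ∀ (m : ℕ), ∀ x ∈ W, φ.toFun^[m] x ∈ W := by
    intro m
    induction m with
    | zero => intro x hx; exact hx
    | succ m ih => intro x hx; exact ih _ (hW x hx)
  exact key (resDeg p L)

/-- The `L₀ ⊗ K`-linear automorphism `F_ζ` of `D` with `F_ζ(e_j) = ζ_j⁻¹ e_j`. -/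
def diagFrob (p : ℕ) [Fact p.Prime] (L : Type*) {K : Type*} [Field L] [Algebra ℚ_[p] L]
    [Field K] [Algebra ℚ_[p] K] {n : ℕ} (ζ : Fin n → Kˣ) :
    PhiSpace p L K n →ₗ[CoeffRing p L K] PhiSpace p L K n :=
  LinearMap.pi fun j =>
    ((1 : L₀ p L) ⊗ₜ[ℚ_[p]] ((ζ j)⁻¹ : K) : CoeffRing p L K) • LinearMap.proj j

/-- `s` is the semisimple part of the endomorphism `g`: `g = s + (g - s)` is the Jordan
decomposition of `g`. -/
def IsSemisimplePart {F V : Type*} [Field F] [AddCommGroup V] [Module F V]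
    (g s : Module.End F V) : Prop :=
  s.IsSemisimple ∧ IsNilpotent (g - s) ∧ Commute s g

/-- `t_N(D') = [L : ℚ_p]⁻¹ · val_L (det_{L₀} (φ ^ f | D'))` for an `L₀`-subspace `D'` of `D`
preserved by `φ`. -/
def tN (φ : Frobenius p L K n) (W : Submodule (L₀ p L) (PhiSpace p L K n))
    (hW : ∀ x ∈ W, φ.toFun x ∈ W) : ℚ :=
  (1 / (Module.finrank ℚ_[p] L : ℚ)) *
    valL p L (L₀ p L) (LinearMap.det (φ.linPowL₀.restrict (φ.linPowL₀_mem hW)))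

/-! ## Filtrations on `D_L` -/

/-- `D_L = L ⊗_{L₀} D`. -/
abbrev DL (p : ℕ) [Fact p.Prime] (L K : Type*) [Field L] [Algebra ℚ_[p] L]
    [Field K] [Algebra ℚ_[p] K] (n : ℕ) : Type _ :=
  L ⊗[L₀ p L] PhiSpace p L K n

variable (p L n) in
/-- The action of `k ∈ K` on `D_L`, that is, `id_L ⊗ (multiplication by 1 ⊗ k on D)`. -/
def actK (k : K) : DL p L K n →ₗ[L] DL p L K n :=
  LinearMap.baseChange L
    (Algebra.lsmul (L₀ p L) (L₀ p L) (PhiSpace p L K n)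
      ((1 : L₀ p L) ⊗ₜ[ℚ_[p]] k : CoeffRing p L K))

variable (p n) in
/-- The component `D_{L,σ} = 1_σ · D_L` of `D_L ≃ ∏_σ D_{L,σ}` attached to `σ : L → K`: the
elements on which `L` acts through `σ` and the action of `K`. -/
def component (σ : L →ₐ[ℚ_[p]] K) : Submodule L (DL p L K n) where
  carrier := {x | ∀ l : L, l • x = actK p L n (σ l) x}
  add_mem' {x y} hx hy l := by rw [smul_add, hx l, hy l, map_add]
  zero_mem' l := by rw [smul_zero, map_zero]
  smul_mem' c x hx l := by rw [smul_comm, hx l, map_smul]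

variable (p L K n) in
/-- A decreasing, exhaustive and separated filtration of `D_L` by `L ⊗ K`-submodules, indexed
by `ℤ`. (An `L ⊗ K`-submodule is an `L`-subspace stable under `K`.) -/
structure Filtration where
  Fil : ℤ → Submodule L (DL p L K n)
  actK_mem : ∀ (i : ℤ) (k : K), ∀ x ∈ Fil i, actK p L n k x ∈ Fil i
  antitone : Antitone Fil
  exhaustive : ⨆ i, Fil i = ⊤
  separated : ⨅ i, Fil i = ⊥

/-- The graded piece `A^i / A^{i+1}` of a decreasing family `A` of subspaces. -/
abbrev gr {F V : Type*} [Field F] [AddCommGroup V] [Module F V] (A : ℤ → Submodule F V) (i : ℤ) :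
    Type _ :=
  (A i) ⧸ (A (i + 1)).submoduleOf (A i)

/-- The filtration `Fil^i ∩ V` induced on an `L`-subspace `V` of `D_L`; for `V = D_{L,σ}` it is
`(Fil^i D_{L,σ})_i`. -/
def Filtration.induced (𝓕 : Filtration p L K n) (V : Submodule L (DL p L K n)) :
    ℤ → Submodule L (DL p L K n) :=
  fun i => 𝓕.Fil i ⊓ V

/-- `t_H(V) = ∑_i i · dim_L (Fil^i V / Fil^{i+1} V)` for an `L`-subspace `V` of `D_L` with the
induced filtration. -/
def Filtration.tH (𝓕 : Filtration p L K n) (V : Submodule L (DL p L K n)) : ℤ :=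
  ∑ᶠ i : ℤ, i * (Module.finrank L (gr (𝓕.induced V) i) : ℤ)

/-- (Weak) admissibility: `t_H(D_L) = t_N(D)`, and `t_H(D'_L) ≤ t_N(D')` for every
`L₀`-subspace `D'` of `D` preserved by `φ`. -/
def IsAdmissible (φ : Frobenius p L K n) (𝓕 : Filtration p L K n) : Prop :=
  (𝓕.tH ⊤ : ℚ) = tN φ ⊤ (fun _ _ => Submodule.mem_top) ∧
  ∀ (W : Submodule (L₀ p L) (PhiSpace p L K n)) (hW : ∀ x ∈ W, φ.toFun x ∈ W),
    (𝓕.tH (W.baseChange L) : ℚ) ≤ tN φ W hW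

/-- For every `σ`, the jumps of `(Fil^i D_{L,σ})_i` are exactly the integers `w σ j`. -/
def HasJumps (𝓕 : Filtration p L K n) (w : (L →ₐ[ℚ_[p]] K) → Fin n → ℤ) : Prop :=
  ∀ (σ : L →ₐ[ℚ_[p]] K) (i : ℤ),
    Nontrivial (gr (𝓕.induced (component p n σ)) i) ↔ ∃ j, i = w σ j

end Spaces

/-! ## Polygons -/

/-- The ordinate at abscissa `j` of the polygon associated to `(y_1, …, y_n)`: it is `0` at `0`
and `y_j` at `1 ≤ j ≤ n`. -/
def vertex {n : ℕ} (y : Fin n → ℚ) : ℕ → ℚ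
  | 0 => 0
  | j + 1 => if h : j < n then y ⟨j, h⟩ else 0

/-- The polygon on `[0, n]` associated to `(y_1, …, y_n)`: the piecewise linear function joining
the points `(0, 0), (1, y_1), …, (n, y_n)`. -/
def polygon {n : ℕ} (y : Fin n → ℚ) (x : ℝ) : ℝ :=
  vertex y ⌊x⌋₊ + (x - ⌊x⌋₊) * (vertex y (⌊x⌋₊ + 1) - vertex y ⌊x⌋₊)

end

end FilteredPhi

namespace FilteredPhi

noncomputable section

set_option linter.unusedSectionVars false

/-! Write `n = d + 1`. Since there are `[L : ℚ_p]` embeddings `σ : L → K`, evaluation at all of them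
identifies `D_L` with a product of copies of `K ^ n` (`surjective_ev`, `injective_ev`), and `D` is
likewise a product over the embeddings of `L₀`. A `K`-stable subspace is the product of its images,
so dimensions, and with them `t_H`, are computed one `σ` at a time. The `n` prescribed jumps are
distinct and the component has dimension `n`, so each has multiplicity one and the dimensions of all
`Fil^i` are known (`hasJumps_iff`).

In `K ^ n`, a subspace of dimension `r` meets one of dimension `c` in dimension at least `max 0 (r +
c - n)`. After summation by parts, `t_H` of a `K`-stable subspace of rank `r` is, up to the factor
`[K : ℚ_p] / [L : ℚ_p]`, at least the sum over `σ` of the `r` smallest weights, with equality in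
general position (`sum_le_tH`, `tH_eq_sum`). For `t_N`, the map `φ ^ f` may be replaced by `F_ζ`. On
a subspace stable under `φ` and `K` this gives, up to normalization, minus a combination of the
`val_L (ζ_{τ k})` with integer coefficients between `0` and `f` whose sum is `f * r`
(`exists_tN_eq_sum`).

From (i) to (ii): `F_ζ` is a polynomial in `φ ^ f` over `ℚ_p`, hence commutes with `φ`. Wherever the
slope of the Newton polygon jumps, the span of the `r` basis vectors of largest valuation is
therefore a subobject, and admissibility gives the inequality at `r`. Convexity gives the remaining
vertices (`sum_le_neg_sum_of_breaks`).

From (ii) to (i): take `φ` such that `φ ^ f` has a single Jordan block for each eigenvalue. It then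
has a cyclic vector, and the flag of its Krylov spaces is in general position to all stable
subspaces at once (`finrank_krylov_inf_le`). Every `K`-stable subobject of rank `r` thus has the
smallest possible `t_H`, while its `t_N` is at least what the `r` largest valuations give, and (ii)
compares these two bounds. Subobjects that are not `K`-stable are reduced to stable ones by a
supermodularity argument (`isAdmissible_of_forall_stable`). The construction of `φ` uses that `φ₀`
has exact order `f`, so that it permutes the embeddings of `L₀` in one cycle.

Condition (iii) is (ii) read at the vertices of the polygons. -/

/-- A ring endomorphism of a field of characteristic `p` acts on a root of unity that it maps to
one of its powers through a power of the Frobenius. -/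
theorem exists_map_eq_pow_prime_pow {κ : Type*} [Field κ] (p : ℕ) [Fact p.Prime] [CharP κ p]
    (γ : κ →+* κ) {x : κ} {N a : ℕ} (hN : 0 < N) (hx : x ^ N = 1) (hγ : γ x = x ^ a) :
    ∃ i : ℕ, γ x = x ^ p ^ i := by
  let : Algebra (ZMod p) κ := ZMod.algebra κ p
  have hint : IsIntegral (ZMod p) x := .of_pow hN (by rw [hx]; exact isIntegral_one)
  -- The finite field `𝔽_p(x)` is preserved by `γ` because `γ x` is a power of `x`, and the
  -- automorphisms of a finite field are the powers of its Frobenius.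
  let k := IntermediateField.adjoin (ZMod p) {x}
  have : FiniteDimensional (ZMod p) k := IntermediateField.adjoin.finiteDimensional hint
  have : Finite k := Module.finite_of_finite (ZMod p)
  have hcomm : γ.comp (algebraMap (ZMod p) κ) = algebraMap (ZMod p) κ := RingHom.ext_zmod _ _
  let g : κ →ₐ[ZMod p] κ := { γ with commutes' := fun r => RingHom.congr_fun hcomm r }
  have hxk : x ∈ k := IntermediateField.mem_adjoin_simple_self _ x
  have hle : k ≤ k.comap g := by
    rw [IntermediateField.adjoin_le_iff, Set.singleton_subset_iff]
    change g x ∈ k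
    have : g x = x ^ a := hγ
    rw [this]
    exact pow_mem hxk a
  let h : k →ₐ[ZMod p] k := (g.comp k.val).codRestrict k.toSubalgebra fun y => hle y.2
  have hb : Function.Bijective h := Finite.injective_iff_bijective.1 h.toRingHom.injective
  obtain ⟨i, hi⟩ := FiniteField.exists_forall_apply_eq_pow (ZMod p) p k (AlgEquiv.ofBijective h hb)
  refine ⟨i, ?_⟩
  have := congrArg Subtype.val (hi ⟨x, hxk⟩)
  rw [Nat.card_zmod] at this
  exact this

/-! ### Roots of unity and the Galois group of `L₀` -/

section

variable {p : ℕ} [Fact p.Prime] {M : Type*} [Field M] [Algebra ℚ_[p] M]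
  [FiniteDimensional ℚ_[p] M]

/-- An automorphism of a finite extension of `ℚ_p` acts on a root of unity of order prime to `p`
that it maps to one of its powers through raising to a power of `p`. -/
theorem algEquiv_apply_eq_pow_prime_pow (γ : M ≃ₐ[ℚ_[p]] M) {x : M} {N a : ℕ}
    (hN : p.Coprime N) (hx : x ^ N = 1) (hγ : γ x = x ^ a) :
    ∃ i : ℕ, γ x = x ^ p ^ i := by
  have hN0 : 0 < N := by
    rcases Nat.eq_zero_or_pos N with rfl | h
    · exact absurd (by simpa using hN) (Fact.out : p.Prime).one_lt.ne'
    · exact h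
  -- The spectral norm is invariant under automorphisms, so `γ` acts on its unit ball `A` and on the
  -- residue field of `A`, where the characteristic `p` case applies.
  let : NormedField M := spectralNorm.normedField ℚ_[p] M
  have : IsUltrametricDist M :=
    IsUltrametricDist.isUltrametricDist_of_isNonarchimedean_norm isNonarchimedean_spectralNorm
  have hnorm : ∀ y : M, ‖y‖ = spectralNorm ℚ_[p] M y := fun _ => rfl
  have hext : ∀ y : ℚ_[p], ‖algebraMap ℚ_[p] M y‖ = ‖y‖ := fun y => spectralNorm_extends y
  have hpres : ∀ (δ : M ≃ₐ[ℚ_[p]] M) (y : M), ‖δ y‖ = ‖y‖ := fun δ y =>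
    (spectralNorm_eq_of_equiv δ y).symm
  let A : ValuationSubring M := (NormedField.valuation (K := M)).valuationSubring
  have hA : ∀ y : M, y ∈ A ↔ ‖y‖ ≤ 1 := fun y => by
    rw [Valuation.mem_valuationSubring_iff, NormedField.valuation_apply]
    exact Iff.rfl
  let g : A →+* A := γ.toRingEquiv.toRingHom.restrict A A fun y hy => by
    rw [hA] at hy ⊢
    exact (hpres γ y).trans_le hy
  have hg : ∀ y : A, ((g y : A) : M) = γ y := fun _ => rfl
  have : IsLocalHom g := by
    refine ⟨fun y hy => ?_⟩
    obtain ⟨z, hz⟩ := hy.exists_right_inv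
    have hz' : γ y * z = 1 := congrArg Subtype.val hz
    have hzA : γ.symm z ∈ A := by
      have := z.2
      rw [hA] at this ⊢
      exact (hpres γ.symm z).trans_le this
    refine IsUnit.of_mul_eq_one ⟨γ.symm z, hzA⟩ (Subtype.ext ?_)
    apply γ.injective
    simpa using hz'
  have hpA : ¬ IsUnit (p : A) := by
    intro h
    obtain ⟨z, hz⟩ := h.exists_right_inv
    have hz' : (p : M) * z = 1 := by simpa using congrArg Subtype.val hz
    have h1 : ‖(p : M)‖ < 1 := by
      have := hext (p : ℚ_[p])
      rw [map_natCast] at this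
      rw [this]
      exact Padic.norm_p_lt_one
    have h2 : ‖(z : M)‖ ≤ 1 := (hA _).1 z.2
    have h3 := congrArg norm hz'
    rw [norm_mul, norm_one] at h3
    nlinarith [norm_nonneg (p : M), norm_nonneg (z : M)]
  have hres : IsLocalRing.residue A (p : A) = 0 := by
    rw [IsLocalRing.residue_eq_zero_iff]
    exact hpA
  have : CharP (IsLocalRing.ResidueField A) p := by
    rw [map_natCast] at hres
    exact (CharP.charP_iff_prime_eq_zero Fact.out).2 hres
  have hxA : x ∈ A := by
    rw [hA]
    have := congrArg norm hx
    rw [norm_pow, norm_one] at this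
    exact ((pow_eq_one_iff_of_nonneg (norm_nonneg x) hN0.ne').1 this).le
  let y : A := ⟨x, hxA⟩
  have hy : y ^ N = 1 := Subtype.ext hx
  have hgy : g y = y ^ a := Subtype.ext hγ
  obtain ⟨i, hi⟩ := exists_map_eq_pow_prime_pow p (IsLocalRing.ResidueField.map g) (a := a)
    (x := IsLocalRing.residue A y) hN0 (by rw [← map_pow, hy, map_one])
    (by rw [IsLocalRing.ResidueField.map_residue, hgy, map_pow])
  refine ⟨i, ?_⟩
  rw [IsLocalRing.ResidueField.map_residue, ← map_pow] at hi
  -- This is `g y / y ^ p ^ i`, with the inverse written as a power since `y ^ N = 1`. It is an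
  -- `N`-th root of unity with residue `1`.
  let z : A := g y * y ^ (p ^ i * (N - 1))
  have hz1 : IsLocalRing.residue A z = 1 := by
    have hexp : p ^ i + p ^ i * (N - 1) = N * p ^ i := by
      obtain ⟨m, rfl⟩ := Nat.exists_eq_add_of_lt hN0
      simp only [Nat.zero_add, Nat.add_sub_cancel]
      ring
    rw [map_mul, hi, ← map_mul, ← pow_add, hexp, pow_mul, hy, one_pow, map_one]
  have hzN : z ^ N = 1 := by
    simp only [z]
    rw [mul_pow, ← map_pow, hy, map_one, ← pow_mul, mul_comm _ N, pow_mul, hy, one_pow, one_mul]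
  have hz : z = 1 := by
    by_contra hne
    -- The residue of this sum is `N`, so it can only vanish if `p` divides `N`.
    have h0 : ∑ j ∈ Finset.range N, z ^ j = 0 := by
      have := geom_sum_mul z N
      rw [hzN, sub_self] at this
      exact (mul_eq_zero.1 this).resolve_right (sub_ne_zero.2 hne)
    have h1 := congrArg (IsLocalRing.residue A) h0
    rw [map_sum, map_zero] at h1
    simp only [map_pow, hz1, one_pow, Finset.sum_const, Finset.card_range, nsmul_one] at h1
    rw [CharP.cast_eq_zero_iff _ p] at h1
    exact absurd (Nat.Coprime.eq_one_of_dvd hN h1) (Fact.out : p.Prime).one_lt.ne'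
  have h3 : g y = y ^ p ^ i := by
    calc g y = g y * (y ^ N) ^ p ^ i := by rw [hy, one_pow, mul_one]
      _ = z * y ^ p ^ i := by
        simp only [z]
        rw [mul_assoc, ← pow_add, ← pow_mul, ← Nat.mul_add_one, Nat.sub_add_cancel hN0, mul_comm N]
      _ = y ^ p ^ i := by rw [hz, one_mul]
  exact congrArg Subtype.val h3

end

variable (p : ℕ) [Fact p.Prime] (L : Type*) [Field L] [Algebra ℚ_[p] L]
  [FiniteDimensional ℚ_[p] L]

/-- Take a root of unity `x` of order prime to `p` generating a field of the largest degree. For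
another one `y`, there is a root of unity `z` whose order is the lcm of the two orders, and both `x`
and `y` are powers of `z`. Maximality of the degree gives `ℚ_p(z) = ℚ_p(x)`, which therefore
contains `y`. -/
theorem exists_maxUnram_eq_adjoin_simple :
    ∃ (x : L) (N : ℕ), p.Coprime N ∧ x ^ N = 1 ∧ IsPrimitiveRoot x N ∧
      maxUnram p L = IntermediateField.adjoin ℚ_[p] {x} := by
  let S : Set L := {x : L | ∃ n : ℕ, p.Coprime n ∧ x ^ n = 1}
  have hcop : ∀ {x : L}, x ∈ S → p.Coprime (orderOf x) := by
    rintro x ⟨n, hn, hx⟩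
    exact hn.coprime_dvd_right (orderOf_dvd_of_pow_eq_one hx)
  have hpos : ∀ {n : ℕ}, p.Coprime n → 0 < n := by
    intro n hn
    rcases Nat.eq_zero_or_pos n with rfl | h
    · exact absurd (by simpa using hn) (Fact.out : p.Prime).one_lt.ne'
    · exact h
  let r : L → ℕ := fun x => Module.finrank ℚ_[p] (IntermediateField.adjoin ℚ_[p] {x})
  have hfin : (r '' S).Finite := by
    refine (Set.finite_Iic (Module.finrank ℚ_[p] L)).subset ?_
    rintro _ ⟨x, -, rfl⟩
    exact Submodule.finrank_le (IntermediateField.adjoin ℚ_[p] {x}).toSubmodule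
  obtain ⟨_, ⟨⟨x, hx, rfl⟩, hmax⟩⟩ := hfin.exists_maximal ⟨r 1, 1, ⟨1, by simp, by simp⟩, rfl⟩
  refine ⟨x, orderOf x, hcop hx, pow_orderOf_eq_one x, IsPrimitiveRoot.orderOf x, ?_⟩
  apply le_antisymm
  · rw [maxUnram, IntermediateField.adjoin_le_iff]
    intro y hy
    obtain ⟨z, -, hz⟩ := (Commute.all x y).exists_orderOf_eq_lcm
    have hzS : z ∈ S := ⟨orderOf z, by
      rw [hz]
      exact (Nat.Coprime.mul_right (hcop hx) (hcop hy)).coprime_dvd_right (Nat.lcm_dvd_mul _ _),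
      pow_orderOf_eq_one z⟩
    have : NeZero (orderOf z) := ⟨(hpos (hcop hzS)).ne'⟩
    have hmem : ∀ u : L, orderOf u ∣ orderOf z → u ∈ IntermediateField.adjoin ℚ_[p] {z} := by
      intro u hu
      obtain ⟨i, -, hi⟩ := (IsPrimitiveRoot.orderOf z).eq_pow_of_pow_eq_one
        (orderOf_dvd_iff_pow_eq_one.1 hu)
      rw [← hi]
      exact pow_mem (IntermediateField.mem_adjoin_simple_self _ z) i
    have hle : IntermediateField.adjoin ℚ_[p] {x} ≤ IntermediateField.adjoin ℚ_[p] {z} := by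
      rw [IntermediateField.adjoin_le_iff, Set.singleton_subset_iff]
      exact hmem x (hz ▸ Nat.dvd_lcm_left _ _)
    have heq := IntermediateField.eq_of_le_of_finrank_le hle
      (hmax ⟨z, hzS, rfl⟩ (Submodule.finrank_mono (R := ℚ_[p])
        (s := (IntermediateField.adjoin ℚ_[p] {x}).toSubmodule)
        (t := (IntermediateField.adjoin ℚ_[p] {z}).toSubmodule) hle))
    change y ∈ IntermediateField.adjoin ℚ_[p] {x}
    rw [heq]
    exact hmem y (hz ▸ Nat.dvd_lcm_right _ _)
  · rw [IntermediateField.adjoin_le_iff, Set.singleton_subset_iff]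
    exact IntermediateField.subset_adjoin _ _ hx

/-- The absolute Frobenius generates the Galois group of `L₀`. -/
theorem exists_absFrob_pow_eq (γ : L₀ p L ≃ₐ[ℚ_[p]] L₀ p L) : ∃ i : ℕ, γ = absFrob p L ^ i := by
  obtain ⟨x, N, hN, hxN, hprim, hadj⟩ := exists_maxUnram_eq_adjoin_simple p L
  have hxm : x ∈ maxUnram p L := hadj ▸ IntermediateField.mem_adjoin_simple_self _ x
  let y : L₀ p L := (⟨x, hxm⟩ : maxUnram p L)
  have hyprim : IsPrimitiveRoot y N :=
    IsPrimitiveRoot.of_map_of_injective (f := (maxUnram p L).val) hprim Subtype.val_injective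
  have hyN : y ^ N = 1 := hyprim.pow_eq_one
  have : NeZero N := ⟨by
    rintro rfl
    exact absurd (by simpa using hN) (Fact.out : p.Prime).one_lt.ne'⟩
  obtain ⟨a, -, ha⟩ := hyprim.eq_pow_of_pow_eq_one (ξ := γ y) (by rw [← map_pow, hyN, map_one])
  obtain ⟨i, hi⟩ := algEquiv_apply_eq_pow_prime_pow γ hN hyN ha.symm
  have hpow : ∀ j : ℕ, (absFrob p L ^ j) y = y ^ p ^ j := by
    intro j
    induction j with
    | zero => simp
    | succ j ih =>
      rw [pow_succ', AlgEquiv.mul_apply, ih, map_pow, absFrob_spec p L y N hN hyN, ← pow_mul,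
        pow_succ']
  refine ⟨i, ?_⟩
  have := IntermediateField.algHom_ext_of_eq_adjoin ℚ_[p] hadj
    (φ₁ := (γ : L₀ p L →ₐ[ℚ_[p]] L₀ p L)) (φ₂ := ((absFrob p L ^ i : L₀ p L ≃ₐ[ℚ_[p]] L₀ p L) :
      L₀ p L →ₐ[ℚ_[p]] L₀ p L)) (by
      rintro _ rfl
      exact hi.trans (hpow i).symm)
  exact AlgEquiv.ext fun z => DFunLike.congr_fun this z

/-- The exact order makes the embeddings `σ ∘ φ₀ ^ i`, `i < f`, pairwise distinct. -/
theorem orderOf_absFrob : orderOf (absFrob p L) = resDeg p L := by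
  have := isGalois_L₀ p L
  rw [resDeg, ← IsGalois.card_aut_eq_finrank]
  apply orderOf_eq_card_of_forall_mem_zpowers
  intro γ
  obtain ⟨i, rfl⟩ := exists_absFrob_pow_eq p L γ
  exact ⟨i, zpow_natCast _ _⟩

/-! ## Determinants -/

section Det

variable {F : Type*} [Field F]

theorem det_eq_mul_det_of_exact {V₁ V V₂ : Type*} [AddCommGroup V₁] [Module F V₁]
    [AddCommGroup V] [Module F V] [AddCommGroup V₂] [Module F V₂] [FiniteDimensional F V]
    (i : V₁ →ₗ[F] V) (q : V →ₗ[F] V₂) (hi : Function.Injective i) (hq : Function.Surjective q)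
    (hiq : Function.Exact i q)
    (e₁ : Module.End F V₁) (e : Module.End F V) (e₂ : Module.End F V₂)
    (h₁ : ∀ x, e (i x) = i (e₁ x)) (h₂ : ∀ x, q (e x) = e₂ (q x)) :
    LinearMap.det e = LinearMap.det e₁ * LinearMap.det e₂ := by
  have hk : ∀ x ∈ LinearMap.ker q, e x ∈ LinearMap.ker q := fun x hx => by
    rw [LinearMap.mem_ker] at hx ⊢
    rw [h₂, hx, map_zero]
  rw [LinearMap.det_eq_det_mul_det (LinearMap.ker q) e hk]
  have hr : LinearMap.range i = LinearMap.ker q := (LinearMap.exact_iff.1 hiq).symm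
  let a : V₁ ≃ₗ[F] LinearMap.ker q :=
    (LinearEquiv.ofInjective i hi).trans (LinearEquiv.ofEq _ _ hr)
  have ha : ∀ x, ((a x : LinearMap.ker q) : V) = i x := fun x => rfl
  congr 1
  · rw [← LinearMap.det_conj e₁ a]
    congr 1
    ext x
    obtain ⟨y, rfl⟩ := a.surjective x
    simp [ha, h₁]
  · let b := LinearMap.quotKerEquivOfSurjective q hq
    rw [← LinearMap.det_conj _ b]
    congr 1
    ext x
    obtain ⟨y, rfl⟩ := hq x
    have : b.symm (q y) = Submodule.Quotient.mk y := by
      rw [LinearEquiv.symm_apply_eq]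
      rfl
    simp only [LinearMap.comp_apply, LinearEquiv.coe_coe]
    rw [this, ← h₂]
    rfl

variable {V : Type*} [AddCommGroup V] [Module F V] [FiniteDimensional F V]

theorem det_one_add_of_isNilpotent {m : Module.End F V} (hm : IsNilpotent m) :
    LinearMap.det (1 + m) = 1 := by
  have h := ((LinearMap.charpoly_nilpotent_tfae (-m)).out 0 1).1 hm.neg
  have h2 := LinearMap.eval_charpoly (-m) 1
  rw [h, Polynomial.eval_pow, Polynomial.eval_X, one_pow, map_one, sub_neg_eq_add] at h2
  exact h2.symm

/-- Factor `g = s * (1 + s⁻¹ * (g - s))`: the second factor is unipotent because `s⁻¹` commutes with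
`g - s`. This is how `φ ^ f` gets replaced by `F_ζ` in `t_N`. -/
theorem det_eq_det_of_isNilpotent_sub {g s : Module.End F V} (hs : IsUnit s)
    (hc : Commute s g) (hn : IsNilpotent (g - s)) : LinearMap.det g = LinearMap.det s := by
  obtain ⟨u, rfl⟩ := hs
  have hc' : Commute ((u⁻¹ : (Module.End F V)ˣ) : Module.End F V) (g - u) :=
    (hc.sub_right (Commute.refl _)).units_inv_left
  have h : g = u * (1 + (u⁻¹ : (Module.End F V)ˣ) * (g - u)) := by
    rw [mul_add, mul_one, ← mul_assoc, Units.mul_inv, one_mul, add_sub_cancel]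
  rw [h, map_mul, det_one_add_of_isNilpotent (hc'.isNilpotent_mul_left hn), mul_one]

/-- Multiplicativity in the exact sequence `0 → A ⊓ B → A × B → A ⊔ B → 0`, whose first map is `x ↦
(x, -x)`. It makes `t_N` modular. -/
theorem det_restrict_sup_mul_det_restrict_inf (e : Module.End F V) {A B : Submodule F V}
    (hA : ∀ x ∈ A, e x ∈ A) (hB : ∀ x ∈ B, e x ∈ B)
    (hs : ∀ x ∈ A ⊔ B, e x ∈ A ⊔ B) (hi : ∀ x ∈ A ⊓ B, e x ∈ A ⊓ B) :
    LinearMap.det (e.restrict hs) * LinearMap.det (e.restrict hi) =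
      LinearMap.det (e.restrict hA) * LinearMap.det (e.restrict hB) := by
  rw [← LinearMap.det_prodMap (e.restrict hA), mul_comm]
  symm
  refine det_eq_mul_det_of_exact
    (V₁ := (A ⊓ B : Submodule F V)) (V := A × B) (V₂ := (A ⊔ B : Submodule F V))
    ((Submodule.inclusion inf_le_left).prod (-Submodule.inclusion inf_le_right))
    ((Submodule.inclusion le_sup_left).coprod (Submodule.inclusion le_sup_right))
    ?_ ?_ ?_ _ _ _ ?_ ?_
  · intro x y h
    have := congrArg (fun z : A × B => (z.1 : V)) h
    exact Subtype.ext this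
  · rintro ⟨x, hx⟩
    obtain ⟨a, ha, b, hb, rfl⟩ := Submodule.mem_sup.1 hx
    exact ⟨(⟨a, ha⟩, ⟨b, hb⟩), rfl⟩
  · rintro ⟨⟨a, ha⟩, ⟨b, hb⟩⟩
    constructor
    · intro h
      have h0 : a + b = 0 := congrArg Subtype.val h
      have hab : b = -a := (neg_eq_of_add_eq_zero_right h0).symm
      refine ⟨⟨a, ha, ?_⟩, ?_⟩
      · rw [← neg_neg a, ← hab]
        exact B.neg_mem hb
      · subst hab
        rfl
    · rintro ⟨x, hx⟩
      have h1 : (x : V) = a := congrArg (fun z : A × B => (z.1 : V)) hx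
      have h2 : -(x : V) = b := congrArg (fun z : A × B => (z.2 : V)) hx
      refine Subtype.ext ?_
      change a + b = 0
      rw [← h1, ← h2, add_neg_cancel]
  · intro x
    refine Prod.ext (Subtype.ext rfl) (Subtype.ext ?_)
    change e (-(x : V)) = -(e x)
    rw [map_neg]
  · rintro ⟨a, b⟩
    refine Subtype.ext ?_
    change e a + e b = e (a + b)
    rw [map_add]

/-- An endomorphism that acts as a scalar on each piece of the flag of joint kernels of a jointly
injective family of linear maps has the corresponding product of powers as determinant. -/
theorem exists_det_eq_prod_pow {n : ℕ} {V' : Fin n → Type*} [∀ k, AddCommGroup (V' k)]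
    [∀ k, Module F (V' k)] [∀ k, FiniteDimensional F (V' k)]
    (e : Module.End F V) (c : ∀ k, V →ₗ[F] V' k) (a : Fin n → F)
    (hce : ∀ k x, c k (e x) = a k • c k x) (hinj : ∀ x, (∀ k, c k x = 0) → x = 0) :
    ∃ y : Fin n → ℕ, LinearMap.det e = ∏ k, a k ^ y k ∧ ∑ k, y k = Module.finrank F V ∧
      (∀ k, y k ≤ Module.finrank F (V' k)) ∧ ∀ k, c k = 0 → y k = 0 := by
  induction n generalizing V with
  | zero =>
    have : Subsingleton V := ⟨fun x y => by
      rw [hinj x (fun k => k.elim0), hinj y (fun k => k.elim0)]⟩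
    refine ⟨0, ?_, ?_, fun k => k.elim0, fun k => k.elim0⟩
    · simp [LinearMap.det_eq_one_of_subsingleton]
    · simp [Module.finrank_zero_of_subsingleton]
  | succ n ih =>
    -- Modulo `W` the map `e` is the scalar `a 0`, on a space isomorphic to the range of `c 0`. So
    -- the first exponent is the rank of `c 0`, and the others come from the remaining maps
    -- restricted to `W`.
    let W := LinearMap.ker (c 0)
    have hW : ∀ x ∈ W, e x ∈ W := fun x hx => by
      rw [LinearMap.mem_ker] at hx ⊢
      rw [hce, hx, smul_zero]
    obtain ⟨y, hdet, hsum, hle, h0⟩ := ih (V' := fun k => V' k.succ) (e.restrict hW)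
      (fun k => (c k.succ).comp W.subtype) (fun k => a k.succ) (fun k x => hce k.succ x)
      (fun x hx => Subtype.ext (hinj x (Fin.cases x.2 hx)))
    refine ⟨Fin.cons (Module.finrank F (LinearMap.range (c 0))) y, ?_, ?_, ?_, ?_⟩
    · rw [det_eq_mul_det_of_exact W.subtype (c 0).rangeRestrict W.injective_subtype
        (c 0).surjective_rangeRestrict
        (by
          rw [LinearMap.exact_iff, Submodule.range_subtype, LinearMap.ker_rangeRestrict])
        (e.restrict hW) e
        (a 0 • LinearMap.id) (fun x => rfl) (fun x => Subtype.ext (by simpa using hce 0 x)), hdet,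
        LinearMap.det_smul, LinearMap.det_id, mul_one, Fin.prod_univ_succ, mul_comm]
      simp
    · rw [Fin.sum_univ_succ]
      simp only [Fin.cons_zero, Fin.cons_succ, hsum]
      exact LinearMap.finrank_range_add_finrank_ker (c 0)
    · refine Fin.cases ?_ (fun k => ?_)
      · exact Submodule.finrank_le _
      · simpa using hle k
    · refine Fin.cases ?_ (fun k => ?_)
      · intro h
        simp [h]
      · intro h
        simpa using h0 k (by rw [h, LinearMap.zero_comp])

end Det

/-! ## Cyclic vectors and flags in general position -/

section Cyclic

variable {F V : Type*} [Field F] [AddCommGroup V] [Module F V]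

/-- The span of `v, g v, …, g ^ (m - 1) v`. -/
def krylov (g : Module.End F V) (v : V) (m : ℕ) : Submodule F V :=
  Submodule.span F ((fun i => (g ^ i) v) '' Set.Iio m)

theorem krylov_mono (g : Module.End F V) (v : V) : Monotone (krylov g v) := fun _ _ h =>
  Submodule.span_mono (Set.image_mono (Set.Iio_subset_Iio h))

theorem krylov_zero (g : Module.End F V) (v : V) : krylov g v 0 = ⊥ := by
  rw [krylov, Submodule.span_eq_bot]
  rintro _ ⟨i, hi, rfl⟩
  exact absurd hi (Nat.not_lt_zero i)

theorem pow_mem_krylov (g : Module.End F V) (v : V) {i m : ℕ} (h : i < m) :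
    (g ^ i) v ∈ krylov g v m :=
  Submodule.subset_span ⟨i, h, rfl⟩

theorem krylov_succ (g : Module.End F V) (v : V) (m : ℕ) :
    krylov g v (m + 1) = krylov g v m ⊔ Submodule.span F {(g ^ m) v} := by
  rw [krylov, krylov, ← Submodule.span_union]
  congr 1
  ext x
  simp only [Set.mem_image, Set.mem_Iio, Set.mem_union, Set.mem_singleton_iff, Order.lt_add_one_iff]
  constructor
  · rintro ⟨i, hi, rfl⟩
    rcases hi.lt_or_eq with h | rfl
    · exact Or.inl ⟨i, h, rfl⟩
    · exact Or.inr rfl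
  · rintro (⟨i, hi, rfl⟩ | rfl)
    · exact ⟨i, hi.le, rfl⟩
    · exact ⟨m, le_rfl, rfl⟩

theorem finrank_krylov_le [FiniteDimensional F V] (g : Module.End F V) (v : V) (m : ℕ) :
    Module.finrank F (krylov g v m) ≤ m := by
  induction m with
  | zero => rw [krylov_zero, finrank_bot]
  | succ m ih =>
    rw [krylov_succ]
    refine (Submodule.finrank_add_le_finrank_add_finrank _ _).trans ?_
    exact add_le_add ih ((finrank_span_le_card ({(g ^ m) v} : Set V)).trans (by simp))

variable {g : Module.End F V} {v : V}

/-- A product of the maps `g - c` vanishes on the nonzero quotient `V / U`, so one of them is not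
surjective there. A nonzero functional that kills `U` and the range of this `g - c` is an
eigenvector of the transpose of `g`. -/
theorem exists_functional_of_stable_lt_top {l : List F}
    (hl : (l.map fun c => g - algebraMap F (Module.End F V) c).prod = 0)
    {U : Submodule F V} (hU : ∀ x ∈ U, g x ∈ U) (hne : U ≠ ⊤) :
    ∃ (c : F) (f : V →ₗ[F] F), f ≠ 0 ∧ (∀ x ∈ U, f x = 0) ∧ ∀ x, f (g x) = c * f x := by
  have key : ∃ c : F, U ⊔ LinearMap.range (g - algebraMap F (Module.End F V) c) ≠ ⊤ := by
    by_contra! hall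
    have : ∀ l : List F,
        U ⊔ LinearMap.range (l.map fun c => g - algebraMap F (Module.End F V) c).prod = ⊤ := by
      intro l
      induction l with
      | nil => simp [Module.End.one_eq_id]
      | cons c l ih =>
        rw [eq_top_iff]
        intro x _
        obtain ⟨u, hu, z, ⟨y, rfl⟩, rfl⟩ := Submodule.mem_sup.1
          ((hall c).symm ▸ Submodule.mem_top : x ∈ _)
        obtain ⟨u', hu', w, ⟨t, rfl⟩, rfl⟩ := Submodule.mem_sup.1
          (ih.symm ▸ Submodule.mem_top : y ∈ _)
        rw [map_add, ← add_assoc]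
        refine add_mem (Submodule.mem_sup_left (add_mem hu ?_)) (Submodule.mem_sup_right ⟨t, ?_⟩)
        · rw [LinearMap.sub_apply, Module.algebraMap_end_apply]
          exact sub_mem (hU _ hu') (U.smul_mem c hu')
        · rw [List.map_cons, List.prod_cons, Module.End.mul_apply]
    have h := this l
    rw [hl, LinearMap.range_zero, sup_bot_eq] at h
    exact hne h
  obtain ⟨c, hc⟩ := key
  obtain ⟨f, hf, hle⟩ := Submodule.exists_le_ker_of_lt_top _ (lt_top_iff_ne_top.2 hc)
  refine ⟨c, f, hf, fun x hx => hle (Submodule.mem_sup_left hx), fun x => ?_⟩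
  have : f ((g - algebraMap F (Module.End F V) c) x) = 0 := hle (Submodule.mem_sup_right ⟨x, rfl⟩)
  rw [LinearMap.sub_apply, Module.algebraMap_end_apply, map_sub, map_smul, smul_eq_mul] at this
  exact sub_eq_zero.1 this

variable [FiniteDimensional F V]

/-- As `m` grows, `krylov g v m ⊔ W` gains a dimension at each step until it contains the next
vector `(g ^ m) v`. From then on it is stable and contains the whole orbit of the cyclic vector `v`,
so it is the full space. -/
theorem min_le_finrank_krylov_sup (hv : Submodule.span F (Set.range fun i : ℕ => (g ^ i) v) = ⊤)
    {W : Submodule F V} (hW : ∀ x ∈ W, g x ∈ W) (m : ℕ) :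
    min (Module.finrank F W + m) (Module.finrank F V) ≤
      Module.finrank F (krylov g v m ⊔ W : Submodule F V) := by
  induction m with
  | zero => rw [krylov_zero, bot_sup_eq]; exact min_le_left _ _
  | succ m ih =>
    by_cases hmem : (g ^ m) v ∈ krylov g v m ⊔ W
    · have hst : ∀ x ∈ krylov g v m ⊔ W, g x ∈ krylov g v m ⊔ W := by
        intro x hx
        obtain ⟨y, hy, z, hz, rfl⟩ := Submodule.mem_sup.1 hx
        rw [map_add]
        refine add_mem ?_ (Submodule.mem_sup_right (hW z hz))
        have : krylov g v m ≤ (krylov g v m ⊔ W).comap g := by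
          rw [krylov, Submodule.span_le]
          rintro _ ⟨i, hi, rfl⟩
          change g ((g ^ i) v) ∈ krylov g v m ⊔ W
          rw [← Module.End.mul_apply, ← pow_succ']
          rcases (Nat.succ_le_of_lt hi).lt_or_eq with h | h
          · exact Submodule.mem_sup_left (pow_mem_krylov g v h)
          · rw [← Nat.succ_eq_add_one, h]
            exact hmem
        exact this hy
      have hall : ∀ i : ℕ, (g ^ i) v ∈ krylov g v m ⊔ W := by
        intro i
        induction i with
        | zero =>
          rcases Nat.eq_zero_or_pos m with rfl | h
          · exact hmem
          · exact Submodule.mem_sup_left (pow_mem_krylov g v h)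
        | succ i ihi =>
          rw [pow_succ', Module.End.mul_apply]
          exact hst _ ihi
      have htop : krylov g v m ⊔ W = ⊤ := by
        rw [eq_top_iff, ← hv, Submodule.span_le]
        rintro _ ⟨i, rfl⟩
        exact hall i
      have htop' : krylov g v (m + 1) ⊔ W = ⊤ :=
        eq_top_iff.2 (htop ▸ sup_le_sup_right (krylov_mono g v (Nat.le_succ m)) W)
      rw [htop', finrank_top]
      exact min_le_right _ _
    · have hlt : krylov g v m ⊔ W < krylov g v (m + 1) ⊔ W := by
        refine lt_of_le_of_ne (sup_le_sup_right (krylov_mono g v (Nat.le_succ m)) W) fun h => hmem ?_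
        rw [h]
        exact Submodule.mem_sup_left (pow_mem_krylov g v (Nat.lt_succ_self m))
      have := Submodule.finrank_lt_finrank_of_lt hlt
      omega

theorem finrank_krylov (hv : Submodule.span F (Set.range fun i : ℕ => (g ^ i) v) = ⊤) {m : ℕ}
    (hm : m ≤ Module.finrank F V) : Module.finrank F (krylov g v m) = m := by
  have h := min_le_finrank_krylov_sup hv (W := ⊥) (fun x hx => by
    rw [Submodule.mem_bot] at hx
    rw [hx, map_zero]
    exact Submodule.zero_mem _) m
  rw [sup_bot_eq, finrank_bot, zero_add, min_eq_left hm] at h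
  exact le_antisymm (finrank_krylov_le g v m) h

/-- The flag attached to a cyclic vector is in general position with respect to all stable
subspaces. -/
theorem finrank_krylov_inf_le (hv : Submodule.span F (Set.range fun i : ℕ => (g ^ i) v) = ⊤)
    {W : Submodule F V} (hW : ∀ x ∈ W, g x ∈ W) (m : ℕ) :
    Module.finrank F (krylov g v m ⊓ W : Submodule F V) ≤
      Module.finrank F W + m - Module.finrank F V := by
  have h1 := min_le_finrank_krylov_sup hv hW m
  have h2 := Submodule.finrank_sup_add_finrank_inf_eq (krylov g v m) W
  have h3 := finrank_krylov_le g v m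
  have h4 := Submodule.finrank_le W
  omega

end Cyclic

/-! ### A matrix with given semisimple part and an explicit cyclic vector -/

section CyclicMatrix

variable {F : Type*} [Field F] {n : ℕ}

open Matrix

/-- The strictly lower triangular matrix that has an entry `1` at `(i, j)`, `j < i`, whenever
`a i = a j`. -/
def nilpPart (a : Fin n → F) : Matrix (Fin n) (Fin n) F := by
  classical exact Matrix.of fun i j => if j < i ∧ a i = a j then 1 else 0

theorem nilpPart_apply [DecidableEq F] (a : Fin n → F) (i j : Fin n) :
    nilpPart a i j = if j < i ∧ a i = a j then 1 else 0 := by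
  simp only [nilpPart, Matrix.of_apply]
  congr

theorem commute_diagonal_nilpPart (a : Fin n → F) :
    Commute (Matrix.diagonal a) (nilpPart a) := by
  classical
  ext i j
  rw [Matrix.diagonal_mul, Matrix.mul_diagonal, nilpPart_apply]
  split_ifs with h
  · rw [h.2, mul_comm]
  · simp

theorem isNilpotent_nilpPart (a : Fin n → F) : IsNilpotent (nilpPart a) := by
  classical
  have hz : ∀ i j, i ≤ j → nilpPart a i j = 0 := fun i j h => by
    rw [nilpPart_apply, if_neg]
    exact fun h' => absurd h'.1 (not_lt.2 h)
  -- The transpose has the same characteristic polynomial, here `X ^ n`, and Cayley–Hamilton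
  -- concludes.
  have h : (nilpPart a)ᵀ.IsUpperTriangular := by
    intro i j hij
    exact hz j i (le_of_lt hij)
  have hc := Matrix.charpoly_of_isUpperTriangular _ h
  rw [Matrix.charpoly_transpose] at hc
  have hd : ∀ i, (nilpPart a)ᵀ i i = 0 := fun i => hz i i le_rfl
  simp only [hd, map_zero, sub_zero, Finset.prod_const, Finset.card_univ, Fintype.card_fin] at hc
  refine ⟨n, ?_⟩
  have := Matrix.aeval_self_charpoly (nilpPart a)
  rwa [hc, map_pow, Polynomial.aeval_X] at this

/-- A matrix with semisimple part `diagonal a` and a single Jordan block for each value of `a`. -/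
def cyclicMatrix (a : Fin n → F) : Matrix (Fin n) (Fin n) F := Matrix.diagonal a + nilpPart a

/-- Cayley–Hamilton: the matrix is lower triangular with diagonal `a`, so this product is its
characteristic polynomial evaluated at itself. -/
theorem prod_cyclicMatrix_sub (a : Fin n → F) :
    ((List.ofFn a).map fun c => Matrix.mulVecLin (cyclicMatrix a) -
      algebraMap F (Module.End F (Fin n → F)) c).prod = 0 := by
  classical
  have hz : ∀ i j, i ≤ j → nilpPart a i j = 0 := fun i j h => by
    rw [nilpPart_apply, if_neg]
    exact fun h' => absurd h'.1 (not_lt.2 h)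
  have h : (cyclicMatrix a)ᵀ.IsUpperTriangular := by
    intro i j hij
    have hij' : j < i := hij
    rw [Matrix.transpose_apply, cyclicMatrix, Matrix.add_apply, hz j i hij'.le,
      Matrix.diagonal_apply_ne _ hij'.ne, add_zero]
  have hc := Matrix.charpoly_of_isUpperTriangular _ h
  rw [Matrix.charpoly_transpose] at hc
  have hd : ∀ i, (cyclicMatrix a)ᵀ i i = a i := fun i => by
    rw [Matrix.transpose_apply, cyclicMatrix, Matrix.add_apply, hz i i le_rfl,
      Matrix.diagonal_apply_eq, add_zero]
  simp only [hd] at hc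
  have h0 := LinearMap.aeval_self_charpoly (Matrix.toLin' (cyclicMatrix a))
  rw [Matrix.charpoly_toLin', hc, ← Fin.prod_ofFn, map_list_prod, List.map_ofFn] at h0
  rw [List.map_ofFn, ← h0]
  congr 2
  funext i
  simp [Matrix.toLin'_apply']

/-- The all-ones vector is cyclic for `cyclicMatrix a`. -/
theorem span_pow_cyclicMatrix (a : Fin n → F) :
    Submodule.span F (Set.range fun i : ℕ =>
      ((Matrix.mulVecLin (cyclicMatrix a)) ^ i : Module.End F (Fin n → F)) 1) = ⊤ := by
  classical
  set g : Module.End F (Fin n → F) := Matrix.mulVecLin (cyclicMatrix a) with hg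
  by_contra hne
  have hst : ∀ x ∈ Submodule.span F (Set.range fun i : ℕ => (g ^ i) (1 : Fin n → F)),
      g x ∈ Submodule.span F (Set.range fun i : ℕ => (g ^ i) (1 : Fin n → F)) := by
    intro x hx
    have hle : Submodule.span F (Set.range fun i : ℕ => (g ^ i) (1 : Fin n → F)) ≤
        (Submodule.span F (Set.range fun i : ℕ => (g ^ i) (1 : Fin n → F))).comap g := by
      rw [Submodule.span_le]
      rintro _ ⟨i, rfl⟩
      exact Submodule.subset_span ⟨i + 1, by simp only [pow_succ', Module.End.mul_apply]⟩
    exact hle hx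
  -- If the span were proper, a nonzero functional `f` with `f ∘ g = c • f` would vanish on it, in
  -- particular on the all-ones vector. The values of `f` on the standard basis are now shown to be
  -- zero.
  obtain ⟨c, f, hf, hU, hfg⟩ := exists_functional_of_stable_lt_top (prod_cyclicMatrix_sub a)
    hst hne
  let e : Fin n → Fin n → F := fun j => Pi.single j 1
  have hcol : ∀ j, g (e j) = a j • e j + ∑ i with j < i ∧ a i = a j, e i := by
    intro j
    rw [hg, Matrix.mulVecLin_apply, Matrix.mulVec_single_one]
    ext i
    simp only [Matrix.col_apply, cyclicMatrix, Matrix.add_apply, nilpPart_apply, Pi.add_apply,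
      Pi.smul_apply, smul_eq_mul, e, Finset.sum_apply, Matrix.diagonal_apply, Pi.single_apply]
    congr 1
    · split_ifs with h
      · rw [h, mul_one]
      · rw [mul_zero]
    · rw [Finset.sum_ite_eq]
      simp
  have hrel : ∀ j, a j * f (e j) + ∑ i with j < i ∧ a i = a j, f (e i) = c * f (e j) := by
    intro j
    rw [← hfg, hcol, map_add, map_smul, smul_eq_mul, map_sum]
  -- Descending induction: the sum in `hrel j` runs over larger indices with the same value of `a`.
  have hne0 : ∀ j, a j ≠ c → f (e j) = 0 := by
    intro j
    induction j using WellFoundedGT.induction with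
    | ind j ih =>
      intro hj
      have h := hrel j
      rw [Finset.sum_eq_zero, add_zero] at h
      · have : (a j - c) * f (e j) = 0 := by rw [sub_mul, h, sub_self]
        exact (mul_eq_zero.1 this).resolve_left (sub_ne_zero.2 hj)
      · intro i hi
        rw [Finset.mem_filter] at hi
        exact ih i hi.2.1 (by rw [hi.2.2]; exact hj)
  have hone : ∑ j, f (e j) = 0 := by
    have : (1 : Fin n → F) = ∑ j, e j := by
      ext i
      simp [e, Finset.sum_apply, Pi.single_apply]
    rw [← map_sum, ← this]
    exact hU _ (Submodule.subset_span ⟨0, rfl⟩)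
  -- Ascending induction: when `a j = c`, `hrel j` says that the values at the larger indices of the
  -- block of `c` sum to zero, and those at the smaller ones vanish by induction. Since all values
  -- sum to zero by `hone`, only `f (e j)` is left.
  have heq0 : ∀ j, a j = c → f (e j) = 0 := by
    intro j
    induction j using WellFoundedLT.induction with
    | ind j ih =>
      intro hj
      have h := hrel j
      rw [hj, add_eq_left] at h
      rw [← hone, ← Finset.sum_subset (Finset.subset_univ
        (insert j (Finset.univ.filter fun i => j < i ∧ a i = c))), Finset.sum_insert (by simp), h,
        add_zero]
      intro i _ hi
      rw [Finset.mem_insert, Finset.mem_filter] at hi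
      push Not at hi
      by_cases hic : a i = c
      · refine ih i (lt_of_le_of_ne (not_lt.1 fun hlt => ?_) hi.1) hic
        exact hi.2 (Finset.mem_univ _) hlt hic
      · exact hne0 i hic
  apply hf
  apply LinearMap.pi_ext'
  intro j
  ext
  by_cases hj : a j = c
  · exact heq0 j hj
  · exact hne0 j hj

end CyclicMatrix

/-! ## Filtrations of a finite-dimensional space -/

section Gr

variable {F V : Type*} [Field F] [AddCommGroup V] [Module F V] [FiniteDimensional F V]

theorem finrank_gr {A : ℤ → Submodule F V} (hA : Antitone A) (i : ℤ) :
    (Module.finrank F (gr A i) : ℤ) = Module.finrank F (A i) - Module.finrank F (A (i + 1)) := by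
  have h := Submodule.finrank_quotient_add_finrank ((A (i + 1)).submoduleOf (A i))
  rw [(Submodule.submoduleOfEquivOfLe (hA (lt_add_one i).le)).finrank_eq] at h
  rw [eq_sub_iff_add_eq]
  exact_mod_cast h

/-- Summation by parts. It expresses `t_H` through the dimensions of the steps `A i`, which, unlike
graded pieces, can be bounded by intersecting subspaces. -/
theorem finsum_mul_finrank_gr {A : ℤ → Submodule F V} (hA : Antitone A) {a b : ℤ} (hab : a ≤ b)
    (ha : ∀ i ≤ a, A i = A a) (hb : ∀ i, b ≤ i → A i = ⊥) :
    ∑ᶠ i : ℤ, i * (Module.finrank F (gr A i) : ℤ) =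
      a * Module.finrank F (A a) + ∑ i ∈ Finset.Ioc a b, (Module.finrank F (A i) : ℤ) := by
  simp only [finrank_gr hA]
  rw [finsum_eq_sum_of_support_subset (s := Finset.Ico a b)]
  · obtain ⟨m, rfl⟩ := Int.le.dest hab
    have key : ∀ m : ℕ, ∑ i ∈ Finset.Ico a (a + m),
        i * ((Module.finrank F (A i) : ℤ) - Module.finrank F (A (i + 1))) =
        a * Module.finrank F (A a) + ∑ i ∈ Finset.Ioc a (a + m), (Module.finrank F (A i) : ℤ) -
          (a + m) * Module.finrank F (A (a + m)) := by
      intro m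
      induction m with
      | zero => rw [Nat.cast_zero, add_zero]; simp
      | succ m ih =>
        have h1 : Finset.Ico a (a + (m + 1 : ℕ)) = insert (a + (m : ℤ)) (Finset.Ico a (a + m)) := by
          ext x; simp only [Finset.mem_Ico, Finset.mem_insert]; omega
        have h2 : Finset.Ioc a (a + (m + 1 : ℕ)) =
            insert (a + (m : ℤ) + 1) (Finset.Ioc a (a + m)) := by
          ext x; simp only [Finset.mem_Ioc, Finset.mem_insert]; omega
        rw [h1, h2, Finset.sum_insert (by simp), Finset.sum_insert (by simp), ih]
        have h3 : a + ((m + 1 : ℕ) : ℤ) = a + m + 1 := by push_cast; ring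
        rw [h3]
        ring
    rw [key, hb _ le_rfl, finrank_bot]
    simp
  · intro i hi
    rw [Function.mem_support] at hi
    by_contra hni
    rw [Finset.mem_coe, Finset.mem_Ico, not_and_or, not_le, not_lt] at hni
    apply hi
    rcases hni with h | h
    · rw [ha i h.le, ha (i + 1) h, sub_self, mul_zero]
    · rw [hb i h, hb (i + 1) (by omega), sub_self, mul_zero]

theorem exists_eq_top_of_iSup_eq_top {A : ℤ → Submodule F V} (hA : Antitone A)
    (h : ⨆ i, A i = ⊤) : ∃ a, A a = ⊤ := by
  have hfin : (Set.range fun i => Module.finrank F (A i)).Finite :=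
    (Set.finite_Iic (Module.finrank F V)).subset (by
      rintro _ ⟨i, rfl⟩
      exact Submodule.finrank_le _)
  obtain ⟨_, ⟨⟨a, rfl⟩, hmax⟩⟩ := hfin.exists_maximal ⟨_, 0, rfl⟩
  refine ⟨a, ?_⟩
  rw [eq_top_iff, ← h, iSup_le_iff]
  intro i
  have h1 : A a ≤ A (min i a) := hA (min_le_right _ _)
  have h2 := Submodule.eq_of_le_of_finrank_le h1 (hmax ⟨_, rfl⟩ (Submodule.finrank_mono h1))
  rw [h2]
  exact hA (min_le_left _ _)

theorem exists_eq_bot_of_iInf_eq_bot {A : ℤ → Submodule F V} (hA : Antitone A)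
    (h : ⨅ i, A i = ⊥) : ∃ b, A b = ⊥ := by
  have hfin : (Set.range fun i => Module.finrank F (A i)).Finite :=
    (Set.finite_Iic (Module.finrank F V)).subset (by
      rintro _ ⟨i, rfl⟩
      exact Submodule.finrank_le _)
  obtain ⟨_, ⟨⟨b, rfl⟩, hmin⟩⟩ := hfin.exists_minimal ⟨_, 0, rfl⟩
  refine ⟨b, ?_⟩
  rw [eq_bot_iff, ← h, le_iInf_iff]
  intro i
  have h1 : A (max i b) ≤ A b := hA (le_max_right _ _)
  have h2 := Submodule.eq_of_le_of_finrank_le h1 (hmin ⟨_, rfl⟩ (Submodule.finrank_mono h1))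
  rw [← h2]
  exact hA (le_max_left _ _)

end Gr

/-! ## Evaluation at embeddings -/

section TensorEmbeddings

variable {k M K : Type*} [Field k] [Field M] [Field K] [Algebra k M] [Algebra k K]

/-- The homomorphism `M ⊗ K → K`, `m ⊗ x ↦ σ m * x`. -/
def evTensor (σ : M →ₐ[k] K) : M ⊗[k] K →ₐ[k] K :=
  Algebra.TensorProduct.lift σ (AlgHom.id k K) fun _ _ => Commute.all _ _

@[simp]
theorem evTensor_tmul (σ : M →ₐ[k] K) (m : M) (x : K) : evTensor σ (m ⊗ₜ x) = σ m * x := rfl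

variable [FiniteDimensional k M] [FiniteDimensional k K]

/-- A functional vanishing on the image is a linear relation between the embeddings, and these are
linearly independent by Dedekind. -/
theorem surjective_evTensor :
    Function.Surjective fun (y : M ⊗[k] K) (σ : M →ₐ[k] K) => evTensor σ y := by
  classical
  let R : Submodule K ((M →ₐ[k] K) → K) :=
    { carrier := Set.range fun (y : M ⊗[k] K) (σ : M →ₐ[k] K) => evTensor σ y
      add_mem' := by
        rintro _ _ ⟨y, rfl⟩ ⟨z, rfl⟩
        exact ⟨y + z, funext fun σ => map_add _ _ _⟩
      zero_mem' := ⟨0, funext fun σ => map_zero _⟩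
      smul_mem' := by
        rintro c _ ⟨y, rfl⟩
        exact ⟨(1 ⊗ₜ c) * y, funext fun σ => by simp⟩ }
  suffices h : R = ⊤ by
    intro z
    have : z ∈ R := h ▸ Submodule.mem_top
    exact this
  by_contra hne
  obtain ⟨f, hf, hle⟩ := Submodule.exists_le_ker_of_lt_top _ (lt_top_iff_ne_top.2 hne)
  apply hf
  have hli := linearIndependent_algHom_toLinearMap k M K
  rw [Fintype.linearIndependent_iff] at hli
  have h0 := hli (fun σ => f (Pi.single σ 1)) (by
    ext m
    have hm : (fun σ : M →ₐ[k] K => evTensor σ (m ⊗ₜ 1)) ∈ R := ⟨_, rfl⟩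
    have := hle hm
    rw [LinearMap.mem_ker, ← Finset.univ_sum_single (fun σ : M →ₐ[k] K => evTensor σ (m ⊗ₜ 1)),
      map_sum] at this
    rw [LinearMap.zero_apply, ← this, LinearMap.sum_apply]
    refine Finset.sum_congr rfl fun σ _ => ?_
    rw [evTensor_tmul, mul_one, LinearMap.smul_apply, AlgHom.toLinearMap_apply, smul_eq_mul,
      mul_comm, ← smul_eq_mul, ← map_smul]
    congr 1
    rw [← Pi.single_smul, smul_eq_mul, mul_one])
  apply LinearMap.pi_ext'
  intro σ
  ext
  exact h0 σ

theorem bijective_evTensor (h : Nat.card (M →ₐ[k] K) = Module.finrank k M) :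
    Function.Bijective fun (y : M ⊗[k] K) (σ : M →ₐ[k] K) => evTensor σ y := by
  let f : M ⊗[k] K →ₗ[k] ((M →ₐ[k] K) → K) := LinearMap.pi fun σ => (evTensor σ).toLinearMap
  have hs : Function.Surjective f := surjective_evTensor
  refine ⟨?_, hs⟩
  refine (LinearMap.injective_iff_surjective_of_finrank_eq_finrank (f := f) ?_).2 hs
  rw [Module.finrank_tensorProduct, Module.finrank_pi_fintype, Finset.sum_const, Finset.card_univ,
    ← h, Nat.card_eq_fintype_card, smul_eq_mul]

end TensorEmbeddings

/-! ### The decomposition of `D_L` over the embeddings and the components of `K`-stable subspaces -/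

section Evaluation

variable {p : ℕ} [Fact p.Prime] {L K : Type*} [Field L] [Algebra ℚ_[p] L]
  [Field K] [Algebra ℚ_[p] K] {n : ℕ}

/-- The restriction to `L₀` of an embedding of `L`. -/
def resL₀ (σ : L →ₐ[ℚ_[p]] K) : L₀ p L →ₐ[ℚ_[p]] K :=
  σ.comp (IsScalarTower.toAlgHom ℚ_[p] (L₀ p L) L)

theorem resL₀_apply (σ : L →ₐ[ℚ_[p]] K) (l : L₀ p L) :
    resL₀ σ l = σ (algebraMap (L₀ p L) L l) := rfl

/-- The evaluation `D → K ^ n` at an embedding of `L₀`. -/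
def evD (n : ℕ) (σ : L₀ p L →ₐ[ℚ_[p]] K) : PhiSpace p L K n →ₗ[ℚ_[p]] (Fin n → K) :=
  LinearMap.pi fun j => (evTensor σ).toLinearMap.comp (LinearMap.proj j)

theorem evD_apply (σ : L₀ p L →ₐ[ℚ_[p]] K) (x : PhiSpace p L K n) (j : Fin n) :
    evD n σ x j = evTensor σ (x j) := rfl

theorem evD_smul (σ : L₀ p L →ₐ[ℚ_[p]] K) (r : CoeffRing p L K) (x : PhiSpace p L K n) :
    evD n σ (r • x) = evTensor σ r • evD n σ x := by
  ext j
  simp [evD_apply]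

theorem smul_phiSpace (l : L₀ p L) (x : PhiSpace p L K n) :
    l • x = (l ⊗ₜ[ℚ_[p]] (1 : K) : CoeffRing p L K) • x := by
  funext j
  rw [Pi.smul_apply, Pi.smul_apply, smul_eq_mul, Algebra.smul_def]
  rfl

theorem evD_smul_L₀ (σ : L₀ p L →ₐ[ℚ_[p]] K) (l : L₀ p L) (x : PhiSpace p L K n) :
    evD n σ (l • x) = σ l • evD n σ x := by
  rw [smul_phiSpace, evD_smul, evTensor_tmul, mul_one]

theorem evD_smul_K (σ : L₀ p L →ₐ[ℚ_[p]] K) (k : K) (x : PhiSpace p L K n) :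
    evD n σ ((1 ⊗ₜ[ℚ_[p]] k : CoeffRing p L K) • x) = k • evD n σ x := by
  rw [evD_smul, evTensor_tmul, map_one, one_mul]

/-- The evaluation `D_L → K ^ n` at an embedding of `L`. -/
def ev (n : ℕ) (σ : L →ₐ[ℚ_[p]] K) : DL p L K n →+ (Fin n → K) :=
  TensorProduct.liftAddHom
    { toFun := fun l =>
        { toFun := fun x => σ l • evD n (resL₀ σ) x
          map_zero' := by rw [map_zero, smul_zero]
          map_add' := fun x y => by rw [map_add, smul_add] }
      map_zero' := by
        ext x
        simp
      map_add' := fun l m => by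
        ext x
        simp [add_mul] }
    fun r l x => by
      change σ (r • l) • evD n (resL₀ σ) x = σ l • evD n (resL₀ σ) (r • x)
      rw [evD_smul_L₀, resL₀_apply, smul_smul, Algebra.smul_def r l, map_mul, mul_comm]

@[simp]
theorem ev_tmul (σ : L →ₐ[ℚ_[p]] K) (l : L) (x : PhiSpace p L K n) :
    ev n σ (l ⊗ₜ x) = σ l • evD n (resL₀ σ) x := rfl

theorem ev_smul (σ : L →ₐ[ℚ_[p]] K) (l : L) (x : DL p L K n) :
    ev n σ (l • x) = σ l • ev n σ x := by
  induction x using TensorProduct.induction_on with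
  | zero => simp
  | tmul m x => rw [TensorProduct.smul_tmul', ev_tmul, ev_tmul, smul_smul, smul_eq_mul, map_mul]
  | add x y hx hy => rw [smul_add, map_add, hx, hy, map_add, smul_add]

theorem actK_tmul (k : K) (l : L) (x : PhiSpace p L K n) :
    actK p L n k (l ⊗ₜ x) = l ⊗ₜ ((1 ⊗ₜ[ℚ_[p]] k : CoeffRing p L K) • x) := rfl

theorem ev_actK (σ : L →ₐ[ℚ_[p]] K) (k : K) (x : DL p L K n) :
    ev n σ (actK p L n k x) = k • ev n σ x := by
  induction x using TensorProduct.induction_on with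
  | zero => simp
  | tmul m x => rw [actK_tmul, ev_tmul, ev_tmul, evD_smul_K, smul_comm]
  | add x y hx hy => rw [map_add, map_add, hx, hy, map_add, smul_add]

theorem ev_smul_padic (σ : L →ₐ[ℚ_[p]] K) (c : ℚ_[p]) (x : DL p L K n) :
    ev n σ (c • x) = c • ev n σ x := by
  rw [← algebraMap_smul L c x, ev_smul, AlgHom.commutes, algebraMap_smul]

variable [FiniteDimensional ℚ_[p] L] [FiniteDimensional ℚ_[p] K]

instance : Module.Finite (L₀ p L) (CoeffRing p L K) :=
  inferInstanceAs (Module.Finite (L₀ p L) (L₀ p L ⊗[ℚ_[p]] K))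

theorem finrank_phiSpace :
    Module.finrank (L₀ p L) (PhiSpace p L K n) = n * Module.finrank ℚ_[p] K := by
  rw [Module.finrank_pi_fintype, Finset.sum_const, Finset.card_univ, Fintype.card_fin,
    Module.finrank_baseChange, smul_eq_mul]

theorem finrank_DL : Module.finrank L (DL p L K n) = n * Module.finrank ℚ_[p] K := by
  rw [Module.finrank_baseChange, finrank_phiSpace]

theorem surjective_ev :
    Function.Surjective fun (x : DL p L K n) (σ : L →ₐ[ℚ_[p]] K) => ev n σ x := by
  have key : ∀ (y : L ⊗[ℚ_[p]] K) (j : Fin n), ∃ x : DL p L K n, ∀ σ : L →ₐ[ℚ_[p]] K,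
      ev n σ x = Pi.single j (evTensor σ y) := by
    intro y j
    induction y using TensorProduct.induction_on with
    | zero => exact ⟨0, fun σ => by simp⟩
    | tmul l k =>
      refine ⟨l ⊗ₜ Pi.single j (1 ⊗ₜ k), fun σ => ?_⟩
      ext i
      rw [ev_tmul, Pi.smul_apply, evD_apply]
      by_cases h : i = j
      · subst h
        simp
      · simp [h]
    | add y z hy hz =>
      obtain ⟨a, ha⟩ := hy
      obtain ⟨b, hb⟩ := hz
      exact ⟨a + b, fun σ => by rw [map_add, ha, hb, map_add, Pi.single_add]⟩
  intro z
  choose y hy using fun j => surjective_evTensor (k := ℚ_[p]) (M := L) (K := K) fun σ => z σ j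
  choose x hx using fun j => key (y j) j
  refine ⟨∑ j, x j, funext fun σ => ?_⟩
  simp only [map_sum, hx]
  have : ∀ j, evTensor σ (y j) = z σ j := fun j => congrFun (hy j) σ
  simp only [this]
  exact Finset.univ_sum_single (z σ)

variable (hLK : Fintype.card (L →ₐ[ℚ_[p]] K) = Module.finrank ℚ_[p] L)
include hLK

/-- Equality of dimensions over `ℚ_p`: both are `n * [K : ℚ_p] * [L : ℚ_p]`, the second one because
of the number of embeddings. Surjectivity therefore suffices. -/
theorem injective_ev :
    Function.Injective fun (x : DL p L K n) (σ : L →ₐ[ℚ_[p]] K) => ev n σ x := by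
  let f : DL p L K n →ₗ[ℚ_[p]] ((L →ₐ[ℚ_[p]] K) → Fin n → K) :=
    { toFun := fun x σ => ev n σ x
      map_add' := fun x y => funext fun σ => map_add _ _ _
      map_smul' := fun c x => funext fun σ => ev_smul_padic σ c x }
  have : Module.Finite ℚ_[p] (DL p L K n) := Module.Finite.trans L _
  refine (LinearMap.injective_iff_surjective_of_finrank_eq_finrank (f := f) ?_).2 surjective_ev
  rw [← Module.finrank_mul_finrank ℚ_[p] L, finrank_DL]
  simp [Module.finrank_pi_fintype, hLK]

theorem ext_ev {x y : DL p L K n} (h : ∀ σ : L →ₐ[ℚ_[p]] K, ev n σ x = ev n σ y) : x = y :=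
  injective_ev hLK (funext h)

omit hLK

/-- The `K`-span of the image of a subspace of `D` under the evaluation at an embedding. -/
def evSpanD (σ : L₀ p L →ₐ[ℚ_[p]] K) (W : Submodule (L₀ p L) (PhiSpace p L K n)) :
    Submodule K (Fin n → K) :=
  Submodule.span K (evD n σ '' W)

/-- The `K`-span of the image of a subspace of `D_L` under the evaluation at an embedding. -/
def evSpan (σ : L →ₐ[ℚ_[p]] K) (V : Submodule L (DL p L K n)) : Submodule K (Fin n → K) :=
  Submodule.span K (ev n σ '' V)

theorem mem_evSpan {V : Submodule L (DL p L K n)} (hV : ∀ (k : K), ∀ x ∈ V, actK p L n k x ∈ V)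
    {σ : L →ₐ[ℚ_[p]] K} {y : Fin n → K} : y ∈ evSpan σ V ↔ ∃ x ∈ V, ev n σ x = y := by
  constructor
  · intro hy
    induction hy using Submodule.span_induction with
    | mem y hy => exact hy
    | zero => exact ⟨0, V.zero_mem, map_zero _⟩
    | add y z _ _ hy hz =>
      obtain ⟨a, ha, rfl⟩ := hy
      obtain ⟨b, hb, rfl⟩ := hz
      exact ⟨a + b, V.add_mem ha hb, map_add _ _ _⟩
    | smul c y _ hy =>
      obtain ⟨a, ha, rfl⟩ := hy
      exact ⟨actK p L n c a, hV c a ha, ev_actK σ c a⟩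
  · rintro ⟨x, hx, rfl⟩
    exact Submodule.subset_span ⟨x, hx, rfl⟩

theorem mem_evSpanD {W : Submodule (L₀ p L) (PhiSpace p L K n)}
    (hW : ∀ (k : K), ∀ x ∈ W, (1 ⊗ₜ[ℚ_[p]] k : CoeffRing p L K) • x ∈ W)
    {σ : L₀ p L →ₐ[ℚ_[p]] K} {y : Fin n → K} : y ∈ evSpanD σ W ↔ ∃ x ∈ W, evD n σ x = y := by
  constructor
  · intro hy
    induction hy using Submodule.span_induction with
    | mem y hy => exact hy
    | zero => exact ⟨0, W.zero_mem, map_zero _⟩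
    | add y z _ _ hy hz =>
      obtain ⟨a, ha, rfl⟩ := hy
      obtain ⟨b, hb, rfl⟩ := hz
      exact ⟨a + b, W.add_mem ha hb, map_add _ _ _⟩
    | smul c y _ hy =>
      obtain ⟨a, ha, rfl⟩ := hy
      exact ⟨_, hW c a ha, evD_smul_K σ c a⟩
  · rintro ⟨x, hx, rfl⟩
    exact Submodule.subset_span ⟨x, hx, rfl⟩

theorem evSpan_mono (σ : L →ₐ[ℚ_[p]] K) : Monotone (evSpan (n := n) σ) := fun _ _ h =>
  Submodule.span_mono (Set.image_mono h)

theorem exists_mem_ev_eq_evTensor_smul {V : Submodule L (DL p L K n)}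
    (hV : ∀ (k : K), ∀ x ∈ V, actK p L n k x ∈ V) (y : L ⊗[ℚ_[p]] K) {x : DL p L K n}
    (hx : x ∈ V) : ∃ z ∈ V, ∀ σ : L →ₐ[ℚ_[p]] K, ev n σ z = evTensor σ y • ev n σ x := by
  induction y using TensorProduct.induction_on with
  | zero => exact ⟨0, V.zero_mem, fun σ => by simp⟩
  | tmul l k =>
    exact ⟨l • actK p L n k x, V.smul_mem l (hV k x hx), fun σ => by
      rw [ev_smul, ev_actK, smul_smul, evTensor_tmul]⟩
  | add y z hy hz =>
    obtain ⟨a, ha, ha'⟩ := hy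
    obtain ⟨b, hb, hb'⟩ := hz
    exact ⟨a + b, V.add_mem ha hb, fun σ => by rw [map_add, ha', hb', map_add, add_smul]⟩

/-- Multiply by an element of `L ⊗ K` that evaluates to `1` at `σ` and to `0` at the other
embeddings. Such a multiplication preserves every subspace stable under `L` and `K`, so these
subspaces contain the components of their elements. -/
theorem exists_mem_ev_eq_single [DecidableEq (L →ₐ[ℚ_[p]] K)] {V : Submodule L (DL p L K n)}
    (hV : ∀ (k : K), ∀ x ∈ V, actK p L n k x ∈ V) (σ : L →ₐ[ℚ_[p]] K) {x : DL p L K n}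
    (hx : x ∈ V) :
    ∃ z ∈ V, ∀ τ : L →ₐ[ℚ_[p]] K, ev n τ z = if τ = σ then ev n σ x else 0 := by
  obtain ⟨y, hy⟩ := surjective_evTensor (k := ℚ_[p]) (M := L) (K := K) (Pi.single σ 1)
  obtain ⟨z, hz, hz'⟩ := exists_mem_ev_eq_evTensor_smul hV y hx
  refine ⟨z, hz, fun τ => ?_⟩
  have : evTensor τ y = Pi.single (M := fun _ => K) σ 1 τ := congrFun hy τ
  rw [hz', this]
  split_ifs with h
  · subst h
    simp
  · simp [h]

include hLK

theorem mem_iff_forall_ev_mem {V : Submodule L (DL p L K n)}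
    (hV : ∀ (k : K), ∀ x ∈ V, actK p L n k x ∈ V) {x : DL p L K n} :
    x ∈ V ↔ ∀ σ : L →ₐ[ℚ_[p]] K, ev n σ x ∈ evSpan σ V := by
  classical
  refine ⟨fun hx σ => Submodule.subset_span ⟨x, hx, rfl⟩, fun h => ?_⟩
  have h1 : ∀ σ : L →ₐ[ℚ_[p]] K, ∃ z ∈ V, ∀ τ : L →ₐ[ℚ_[p]] K,
      ev n τ z = if τ = σ then ev n σ x else 0 := by
    intro σ
    obtain ⟨a, ha, ha'⟩ := (mem_evSpan hV).1 (h σ)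
    rw [← ha']
    exact exists_mem_ev_eq_single hV σ ha
  choose z hz hz' using h1
  have : x = ∑ σ, z σ := ext_ev hLK fun τ => by
    rw [map_sum]
    simp [hz']
  rw [this]
  exact V.sum_mem fun σ _ => hz σ

/-- Images do not commute with intersections in general. Here, elements of `A` and of `B` with the
same value at `σ` may be cut down to their `σ`-components, which coincide. -/
theorem evSpan_inf {A B : Submodule L (DL p L K n)}
    (hA : ∀ (k : K), ∀ x ∈ A, actK p L n k x ∈ A) (hB : ∀ (k : K), ∀ x ∈ B, actK p L n k x ∈ B)
    (σ : L →ₐ[ℚ_[p]] K) : evSpan σ (A ⊓ B) = evSpan σ A ⊓ evSpan σ B := by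
  classical
  refine le_antisymm (le_inf (evSpan_mono σ inf_le_left) (evSpan_mono σ inf_le_right)) ?_
  rintro y ⟨h1, h2⟩
  obtain ⟨a, ha, rfl⟩ := (mem_evSpan hA).1 h1
  obtain ⟨b, hb, hab⟩ := (mem_evSpan hB).1 h2
  obtain ⟨a', ha', hae⟩ := exists_mem_ev_eq_single hA σ ha
  obtain ⟨b', hb', hbe⟩ := exists_mem_ev_eq_single hB σ hb
  have : a' = b' := ext_ev hLK fun τ => by rw [hae, hbe, hab]
  refine Submodule.subset_span ⟨a', ⟨ha', this ▸ hb'⟩, ?_⟩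
  rw [hae, if_pos rfl]

/-- Both sides are the dimension over `ℚ_p` of `V`, which is the product of its images. -/
theorem finrank_mul_finrank_eq_sum_evSpan {V : Submodule L (DL p L K n)}
    (hV : ∀ (k : K), ∀ x ∈ V, actK p L n k x ∈ V) :
    Module.finrank ℚ_[p] L * Module.finrank L V =
      Module.finrank ℚ_[p] K * ∑ σ : L →ₐ[ℚ_[p]] K, Module.finrank K (evSpan σ V) := by
  classical
  let f : V →ₗ[ℚ_[p]] (∀ σ : L →ₐ[ℚ_[p]] K, evSpan σ V) :=
    { toFun := fun x σ => ⟨ev n σ x, Submodule.subset_span ⟨x, x.2, rfl⟩⟩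
      map_add' := fun x y => funext fun σ => Subtype.ext (map_add _ _ _)
      map_smul' := fun c x => funext fun σ => Subtype.ext (ev_smul_padic σ c (x : DL p L K n)) }
  have hf : Function.Bijective f := by
    constructor
    · intro x y h
      exact Subtype.ext (ext_ev hLK fun σ => congrArg Subtype.val (congrFun h σ))
    · intro y
      obtain ⟨x, hx⟩ := surjective_ev (p := p) (L := L) (K := K) (n := n) fun σ => (y σ : Fin n → K)
      have hx' : ∀ σ, ev n σ x = y σ := fun σ => congrFun hx σ
      refine ⟨⟨x, (mem_iff_forall_ev_mem hLK hV).2 fun σ => ?_⟩,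
        funext fun σ => Subtype.ext (hx' σ)⟩
      rw [hx']
      exact (y σ).2
  have : Module.Free L V := Module.Free.of_divisionRing L V
  have (σ : L →ₐ[ℚ_[p]] K) : Module.Finite ℚ_[p] (evSpan σ V) := Module.Finite.trans K _
  rw [Module.finrank_mul_finrank, (LinearEquiv.ofBijective f hf).finrank_eq,
    Module.finrank_pi_fintype, Finset.mul_sum]
  exact Finset.sum_congr rfl fun σ _ => (Module.finrank_mul_finrank _ _ _).symm

/-- If `τ l ≠ σ l`, evaluating `l • x = σ(l) x` at `τ` gives `(τ l - σ l) • ev n τ x = 0`. -/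
theorem mem_component_iff {σ : L →ₐ[ℚ_[p]] K} {x : DL p L K n} :
    x ∈ component p n σ ↔ ∀ τ : L →ₐ[ℚ_[p]] K, τ ≠ σ → ev n τ x = 0 := by
  constructor
  · intro hx τ hτ
    obtain ⟨l, hl⟩ : ∃ l, τ l ≠ σ l := by
      by_contra! h
      exact hτ (AlgHom.ext h)
    have h1 := congrArg (ev n τ) (hx l)
    rw [ev_smul, ev_actK, ← sub_eq_zero, ← sub_smul] at h1
    exact (smul_eq_zero.1 h1).resolve_left (sub_ne_zero.2 hl)
  · intro h l
    refine ext_ev hLK fun τ => ?_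
    rw [ev_smul, ev_actK]
    by_cases hτ : τ = σ
    · rw [hτ]
    · rw [h τ hτ, smul_zero, smul_zero]

theorem actK_mem_component (σ : L →ₐ[ℚ_[p]] K) (k : K) (x : DL p L K n)
    (hx : x ∈ component p n σ) : actK p L n k x ∈ component p n σ := by
  rw [mem_component_iff hLK] at hx ⊢
  intro τ hτ
  rw [ev_actK, hx τ hτ, smul_zero]

theorem evSpan_component [DecidableEq (L →ₐ[ℚ_[p]] K)] (σ τ : L →ₐ[ℚ_[p]] K) :
    evSpan τ (component (K := K) p n σ) = if τ = σ then ⊤ else ⊥ := by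
  split_ifs with h
  · subst h
    rw [eq_top_iff]
    intro y _
    obtain ⟨x, hx⟩ := surjective_ev (p := p) (L := L) (K := K) (n := n) (Pi.single τ y)
    have hx' : ∀ ρ, ev n ρ x = Pi.single (M := fun _ => Fin n → K) τ y ρ := fun ρ => congrFun hx ρ
    refine Submodule.subset_span ⟨x, (mem_component_iff hLK).2 fun ρ hρ => ?_, ?_⟩
    · rw [hx', Pi.single_eq_of_ne hρ]
    · rw [hx', Pi.single_eq_same]
  · rw [evSpan, Submodule.span_eq_bot]
    rintro _ ⟨x, hx, rfl⟩
    exact (mem_component_iff hLK).1 hx τ h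

theorem finrank_inf_component {V : Submodule L (DL p L K n)}
    (hV : ∀ (k : K), ∀ x ∈ V, actK p L n k x ∈ V) (σ : L →ₐ[ℚ_[p]] K) :
    Module.finrank ℚ_[p] L * Module.finrank L (V ⊓ component p n σ : Submodule L (DL p L K n)) =
      Module.finrank ℚ_[p] K * Module.finrank K (evSpan σ V) := by
  classical
  rw [finrank_mul_finrank_eq_sum_evSpan (V := V ⊓ component p n σ) hLK fun k x hx =>
    ⟨hV k x hx.1, actK_mem_component hLK σ k x hx.2⟩]
  congr 1
  rw [Finset.sum_eq_single σ]
  · rw [evSpan_inf hLK hV (actK_mem_component hLK σ), evSpan_component hLK, if_pos rfl, inf_top_eq]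
  · intro τ _ hτ
    rw [evSpan_inf hLK hV (actK_mem_component hLK σ), evSpan_component hLK, if_neg hτ, inf_bot_eq,
      finrank_bot]
  · simp

omit hLK

theorem baseChange_eq_span_image (W : Submodule (L₀ p L) (PhiSpace p L K n)) :
    W.baseChange L = Submodule.span L ((fun x => (1 : L) ⊗ₜ[L₀ p L] x) '' W) := by
  rw [Submodule.baseChange_eq_span]
  rfl

theorem actK_mem_baseChange {W : Submodule (L₀ p L) (PhiSpace p L K n)} {k : K}
    (hW : ∀ x ∈ W, (1 ⊗ₜ[ℚ_[p]] k : CoeffRing p L K) • x ∈ W) :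
    ∀ x ∈ W.baseChange L, actK p L n k x ∈ W.baseChange L := by
  have : W.baseChange L ≤ (W.baseChange L).comap (actK p L n k) := by
    conv_lhs => rw [baseChange_eq_span_image]
    rw [Submodule.span_le]
    rintro _ ⟨x, hx, rfl⟩
    change actK p L n k ((1 : L) ⊗ₜ x) ∈ W.baseChange L
    rw [actK_tmul]
    exact Submodule.tmul_mem_baseChange_of_mem _ (hW x hx)
  exact this

/-- The scalars from `L` act through `σ` as elements of `K`, so they are absorbed by the `K`-span.
Only the restriction of `σ` to `L₀` matters. -/
theorem evSpan_baseChange (σ : L →ₐ[ℚ_[p]] K) (W : Submodule (L₀ p L) (PhiSpace p L K n)) :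
    evSpan σ (W.baseChange L) = evSpanD (resL₀ σ) W := by
  apply le_antisymm
  · rw [evSpan, Submodule.span_le]
    rintro _ ⟨x, hx, rfl⟩
    rw [baseChange_eq_span_image] at hx
    change ev n σ x ∈ evSpanD (resL₀ σ) W
    induction hx using Submodule.span_induction with
    | mem y hy =>
      obtain ⟨x, hx, rfl⟩ := hy
      rw [ev_tmul, map_one, one_smul]
      exact Submodule.subset_span ⟨x, hx, rfl⟩
    | zero => rw [map_zero]; exact Submodule.zero_mem _
    | add y z _ _ hy hz => rw [map_add]; exact add_mem hy hz
    | smul c y _ hy => rw [ev_smul]; exact Submodule.smul_mem _ _ hy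
  · rw [evSpanD, Submodule.span_le]
    rintro _ ⟨x, hx, rfl⟩
    refine Submodule.subset_span ⟨1 ⊗ₜ x, Submodule.tmul_mem_baseChange_of_mem _ hx, ?_⟩
    rw [ev_tmul, map_one, one_smul]

end Evaluation

/-! ## Counting jumps -/

section Counting

variable {n : ℕ}

/-- The number of indices `j` with `i ≤ w j`. -/
def countGE (w : Fin n → ℤ) (i : ℤ) : ℕ := (Finset.univ.filter fun j => i ≤ w j).card

theorem countGE_le (w : Fin n → ℤ) (i : ℤ) : countGE w i ≤ n :=
  (Finset.card_le_univ _).trans_eq (Fintype.card_fin n)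

theorem countGE_eq_card {w : Fin n → ℤ} {i : ℤ} (h : ∀ j, i ≤ w j) : countGE w i = n := by
  rw [countGE, Finset.filter_true_of_mem fun j _ => h j, Finset.card_univ, Fintype.card_fin]

theorem countGE_eq_zero {w : Fin n → ℤ} {i : ℤ} (h : ∀ j, w j < i) : countGE w i = 0 := by
  rw [countGE, Finset.filter_false_of_mem fun j _ => not_le.2 (h j), Finset.card_empty]

theorem countGE_antitone (w : Fin n → ℤ) : Antitone (countGE w) := fun _ _ h =>
  Finset.card_le_card (Finset.monotone_filter_right _ fun _ _ h' => h.trans h')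

theorem countGE_eq_add (w : Fin n → ℤ) (i : ℤ) :
    countGE w i = countGE w (i + 1) + (Finset.univ.filter fun j => w j = i).card := by
  rw [countGE, countGE, ← Finset.card_union_of_disjoint]
  · congr 1
    ext j
    simp only [Finset.mem_filter, Finset.mem_univ, true_and, Finset.mem_union]
    omega
  · rw [Finset.disjoint_filter]
    intro j _ h
    omega

theorem exists_forall_le (w : Fin n → ℤ) : ∃ a, ∀ j, a ≤ w j := by
  obtain ⟨a, ha⟩ := (Set.finite_range w).bddBelow
  exact ⟨a, fun j => ha ⟨j, rfl⟩⟩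

theorem exists_forall_ge (w : Fin n → ℤ) : ∃ b, ∀ j, w j ≤ b := by
  obtain ⟨b, hb⟩ := (Set.finite_range w).bddAbove
  exact ⟨b, fun j => hb ⟨j, rfl⟩⟩

theorem card_filter_eq_of_injective {w : Fin n → ℤ} (hw : Function.Injective w) (i : ℤ)
    [Decidable (∃ j, i = w j)] :
    (Finset.univ.filter fun j => w j = i).card = if ∃ j, i = w j then 1 else 0 := by
  split_ifs with h
  · obtain ⟨j, rfl⟩ := h
    rw [Finset.card_eq_one]
    refine ⟨j, ?_⟩
    ext k
    simp [hw.eq_iff]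
  · rw [Finset.card_eq_zero, Finset.filter_eq_empty_iff]
    intro j _ hj
    exact h ⟨j, hj.symm⟩

/-- At each jump `countGE w` drops by exactly one and `h` by at least one, so the difference `h -
countGE w` is antitone. It vanishes far to the left and far to the right, hence everywhere. -/
theorem eq_countGE_of_jumps {w : Fin n → ℤ} (hw : Function.Injective w) {h : ℤ → ℕ}
    (hh : Antitone h) {a b : ℤ} (ha : h a = n) (hle : ∀ i, h i ≤ n) (hb : h b = 0)
    (hj : ∀ i, h (i + 1) < h i ↔ ∃ j, i = w j) (i : ℤ) : h i = countGE w i := by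
  classical
  have hanti : Antitone fun i => (h i : ℤ) - countGE w i := by
    refine antitone_int_of_succ_le fun i => ?_
    have h1 := countGE_eq_add w i
    rw [card_filter_eq_of_injective hw] at h1
    have h2 := hh (lt_add_one i).le
    have h3 := hj i
    split_ifs at h1 with hjj
    · have := h3.2 hjj
      omega
    · omega
  obtain ⟨a', ha'⟩ := exists_forall_le w
  obtain ⟨b', hb'⟩ := exists_forall_ge w
  have h1 : h (min i (min a a')) = n := by
    have := hh ((min_le_right i (min a a')).trans (min_le_left a a'))
    have := hle (min i (min a a'))
    omega
  have h2 : countGE w (min i (min a a')) = n := countGE_eq_card fun j => by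
    have := ha' j
    omega
  have h3 : h (max i (max b (b' + 1))) = 0 := by
    have := hh ((le_max_left b (b' + 1)).trans (le_max_right i _))
    omega
  have h4 : countGE w (max i (max b (b' + 1))) = 0 := countGE_eq_zero fun j => by
    have := hb' j
    omega
  have h5 := hanti (min_le_left i (min a a'))
  have h6 := hanti (le_max_left i (max b (b' + 1)))
  simp only [h1, h2, h3, h4] at h5 h6
  omega

/-- The indices with `i ≤ w j` form a final segment, to be intersected with the initial segment of
length `r`. Truncated subtraction accounts for the case of an empty intersection. -/
theorem card_filter_lt_le {w : Fin n → ℤ} (hw : Monotone w) {r : ℕ} (hr : r ≤ n) (i : ℤ) :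
    r + countGE w i - n = (Finset.univ.filter fun j : Fin n => j.val < r ∧ i ≤ w j).card := by
  have hsplit : countGE w i = (Finset.univ.filter fun j : Fin n => j.val < r ∧ i ≤ w j).card +
      (Finset.univ.filter fun j : Fin n => r ≤ j.val ∧ i ≤ w j).card := by
    rw [countGE, ← Finset.card_union_of_disjoint]
    · congr 1
      ext j
      simp only [Finset.mem_filter, Finset.mem_univ, true_and, Finset.mem_union]
      omega
    · rw [Finset.disjoint_filter]
      intro j _ h
      omega
  have hcard : (Finset.univ.filter fun j : Fin n => r ≤ j.val).card = n - r := by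
    have h1 := Finset.card_filter_add_card_filter_not (s := (Finset.univ : Finset (Fin n)))
      (fun j => j.val < r)
    rw [Fin.card_filter_val_lt, Finset.card_univ, Fintype.card_fin, min_eq_right hr] at h1
    simp only [not_lt] at h1
    omega
  have hle : (Finset.univ.filter fun j : Fin n => r ≤ j.val ∧ i ≤ w j).card ≤ n - r := by
    rw [← hcard]
    exact Finset.card_le_card (Finset.monotone_filter_right _ fun _ _ h => h.1)
  rcases (Finset.univ.filter fun j : Fin n => j.val < r ∧ i ≤ w j).eq_empty_or_nonempty with h | h
  · rw [h, Finset.card_empty] at hsplit ⊢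
    omega
  · obtain ⟨j, hj⟩ := h
    rw [Finset.mem_filter] at hj
    have : (Finset.univ.filter fun j : Fin n => r ≤ j.val ∧ i ≤ w j).card = n - r := by
      rw [← hcard]
      congr 1
      ext k
      simp only [Finset.mem_filter, Finset.mem_univ, true_and, and_iff_left_iff_imp]
      intro hk
      exact hj.2.2.trans (hw (Fin.le_def.2 (by omega)))
    omega

/-- The left side is the formula of `finsum_mul_finrank_gr` with the dimensions of a subspace in
general position. Exchanging the sums, each of the first `r` indices is counted `w j - a` times. -/
theorem sum_Ioc_countGE {w : Fin n → ℤ} (hw : Monotone w) {r : ℕ} (hr : r ≤ n) {a b : ℤ}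
    (ha : ∀ j, a ≤ w j) (hb : ∀ j, w j ≤ b) :
    a * r + ∑ i ∈ Finset.Ioc a b, ((r + countGE w i - n : ℕ) : ℤ) =
      ∑ j : Fin n with j.val < r, w j := by
  simp only [card_filter_lt_le hw hr]
  have h1 : ∀ i : ℤ, ((Finset.univ.filter fun j : Fin n => j.val < r ∧ i ≤ w j).card : ℤ) =
      ∑ j : Fin n with j.val < r, if i ≤ w j then 1 else 0 := by
    intro i
    rw [Finset.sum_boole, Finset.filter_filter]
  simp only [h1]
  rw [Finset.sum_comm]
  have h2 : ∀ j : Fin n, ∑ i ∈ Finset.Ioc a b, (if i ≤ w j then 1 else 0 : ℤ) = w j - a := by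
    intro j
    rw [Finset.sum_boole]
    have : (Finset.Ioc a b).filter (fun i => i ≤ w j) = Finset.Ioc a (w j) := by
      ext i
      have := hb j
      simp only [Finset.mem_filter, Finset.mem_Ioc]
      omega
    rw [this, Int.card_Ioc]
    have := ha j
    simp [this]
  simp only [h2, Finset.sum_sub_distrib, Finset.sum_const, Fin.card_filter_val_lt, min_eq_right hr]
  simp [mul_comm]

end Counting

/-! ### Hodge numbers: `t_H` in terms of the weights -/

section Hodge

variable {p : ℕ} [Fact p.Prime] {L K : Type*} [Field L] [Algebra ℚ_[p] L]
  [Field K] [Algebra ℚ_[p] K] {n : ℕ} [FiniteDimensional ℚ_[p] L] [FiniteDimensional ℚ_[p] K]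

theorem Filtration.exists_bounds (𝓕 : Filtration p L K n) :
    ∃ a b : ℤ, (∀ i ≤ a, 𝓕.Fil i = ⊤) ∧ ∀ i, b ≤ i → 𝓕.Fil i = ⊥ := by
  obtain ⟨a, ha⟩ := exists_eq_top_of_iSup_eq_top 𝓕.antitone 𝓕.exhaustive
  obtain ⟨b, hb⟩ := exists_eq_bot_of_iInf_eq_bot 𝓕.antitone 𝓕.separated
  exact ⟨a, b, fun i hi => eq_top_iff.2 (ha ▸ 𝓕.antitone hi),
    fun i hi => eq_bot_iff.2 (hb ▸ 𝓕.antitone hi)⟩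

theorem Filtration.antitone_induced (𝓕 : Filtration p L K n) (V : Submodule L (DL p L K n)) :
    Antitone (𝓕.induced V) := fun _ _ h => inf_le_inf_right V (𝓕.antitone h)

theorem Filtration.tH_eq (𝓕 : Filtration p L K n) {a b : ℤ} (hab : a ≤ b)
    (ha : ∀ i ≤ a, 𝓕.Fil i = ⊤) (hb : ∀ i, b ≤ i → 𝓕.Fil i = ⊥)
    (V : Submodule L (DL p L K n)) :
    𝓕.tH V = a * Module.finrank L V +
      ∑ i ∈ Finset.Ioc a b, (Module.finrank L (𝓕.Fil i ⊓ V : Submodule L (DL p L K n)) : ℤ) := by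
  have h := finsum_mul_finrank_gr (𝓕.antitone_induced V) hab
    (fun i hi => by rw [induced, induced, ha i hi, ha a le_rfl])
    (fun i hi => by rw [induced, hb i hi, bot_inf_eq])
  rw [induced, ha a le_rfl, top_inf_eq] at h
  exact h

/-- Supermodularity: `(Fil^i ⊓ A) ⊔ (Fil^i ⊓ B)` lies in `Fil^i ⊓ (A ⊔ B)`, possibly strictly,
whereas the intersections agree. -/
theorem Filtration.tH_add_tH_le (𝓕 : Filtration p L K n) (A B : Submodule L (DL p L K n)) :
    𝓕.tH A + 𝓕.tH B ≤ 𝓕.tH (A ⊔ B) + 𝓕.tH (A ⊓ B) := by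
  obtain ⟨a, b, ha, hb⟩ := 𝓕.exists_bounds
  have hb' : ∀ i, max a b ≤ i → 𝓕.Fil i = ⊥ := fun i hi => hb i ((le_max_right a b).trans hi)
  simp only [𝓕.tH_eq (le_max_left a b) ha hb']
  have h1 : (Module.finrank L (A ⊔ B : Submodule L (DL p L K n)) : ℤ) +
      Module.finrank L (A ⊓ B : Submodule L (DL p L K n)) =
      Module.finrank L A + Module.finrank L B := by
    exact_mod_cast Submodule.finrank_sup_add_finrank_inf_eq A B
  have h2 : ∀ i, (Module.finrank L (𝓕.Fil i ⊓ A : Submodule L (DL p L K n)) : ℤ) +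
      Module.finrank L (𝓕.Fil i ⊓ B : Submodule L (DL p L K n)) ≤
      Module.finrank L (𝓕.Fil i ⊓ (A ⊔ B) : Submodule L (DL p L K n)) +
      Module.finrank L (𝓕.Fil i ⊓ (A ⊓ B) : Submodule L (DL p L K n)) := by
    intro i
    have h3 := Submodule.finrank_sup_add_finrank_inf_eq (𝓕.Fil i ⊓ A) (𝓕.Fil i ⊓ B)
    have h4 : Module.finrank L ((𝓕.Fil i ⊓ A) ⊔ (𝓕.Fil i ⊓ B) : Submodule L (DL p L K n)) ≤
        Module.finrank L (𝓕.Fil i ⊓ (A ⊔ B) : Submodule L (DL p L K n)) :=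
      Submodule.finrank_mono le_inf_sup
    have h5 : (𝓕.Fil i ⊓ A) ⊓ (𝓕.Fil i ⊓ B) = 𝓕.Fil i ⊓ (A ⊓ B) := by
      rw [inf_inf_inf_comm, inf_idem]
    rw [h5] at h3
    exact_mod_cast (by omega)
  have h6 := Finset.sum_le_sum fun i (_ : i ∈ Finset.Ioc a (max a b)) => h2 i
  rw [Finset.sum_add_distrib, Finset.sum_add_distrib] at h6
  linear_combination h6 - a * h1

theorem Filtration.tH_map_actK (𝓕 : Filtration p L K n) (V : Submodule L (DL p L K n)) {k : K}
    (hk : k ≠ 0) : 𝓕.tH (V.map (actK p L n k)) = 𝓕.tH V := by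
  obtain ⟨a, b, ha, hb⟩ := 𝓕.exists_bounds
  have hb' : ∀ i, max a b ≤ i → 𝓕.Fil i = ⊥ := fun i hi => hb i ((le_max_right a b).trans hi)
  have hinv : ∀ {k l : K}, k * l = 1 → ∀ x : DL p L K n, actK p L n k (actK p L n l x) = x := by
    intro k l hkl x
    induction x using TensorProduct.induction_on with
    | zero => simp
    | tmul m x =>
      rw [actK_tmul, actK_tmul, smul_smul, Algebra.TensorProduct.tmul_mul_tmul, one_mul, hkl,
        ← Algebra.TensorProduct.one_def, one_smul]
    | add x y hx hy => rw [map_add, map_add, hx, hy]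
  have hinj : Function.Injective (actK p L n k) :=
    Function.LeftInverse.injective (g := actK p L n k⁻¹) (hinv (inv_mul_cancel₀ hk))
  have hmap : ∀ U : Submodule L (DL p L K n),
      Module.finrank L (U.map (actK p L n k)) = Module.finrank L U := fun U =>
    (Submodule.equivMapOfInjective _ hinj U).finrank_eq.symm
  have hFil : ∀ i, 𝓕.Fil i ⊓ V.map (actK p L n k) = (𝓕.Fil i ⊓ V).map (actK p L n k) := by
    intro i
    apply le_antisymm
    · rintro _ ⟨h1, x, hx, rfl⟩
      refine ⟨x, ⟨?_, hx⟩, rfl⟩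
      have := 𝓕.actK_mem i k⁻¹ _ h1
      rwa [hinv (inv_mul_cancel₀ hk)] at this
    · rintro _ ⟨x, ⟨h1, h2⟩, rfl⟩
      exact ⟨𝓕.actK_mem i k x h1, x, h2, rfl⟩
  have hFil' : ∀ i, Module.finrank L (𝓕.Fil i ⊓ V.map (actK p L n k) : Submodule L (DL p L K n)) =
      Module.finrank L (𝓕.Fil i ⊓ V : Submodule L (DL p L K n)) := fun i => by
    rw [hFil, hmap]
  simp only [𝓕.tH_eq (le_max_left a b) ha hb', hFil', hmap]

variable (hLK : Fintype.card (L →ₐ[ℚ_[p]] K) = Module.finrank ℚ_[p] L)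
include hLK

theorem finrank_evSpan_top (σ : L →ₐ[ℚ_[p]] K) :
    Module.finrank K (evSpan σ (⊤ : Submodule L (DL p L K n))) = n := by
  have : evSpan σ (⊤ : Submodule L (DL p L K n)) = ⊤ := by
    classical
    rw [eq_top_iff, ← (by rw [evSpan_component hLK, if_pos rfl] :
      evSpan σ (component (K := K) p n σ) = ⊤)]
    exact evSpan_mono σ le_top
  rw [this, finrank_top, Module.finrank_fin_fun]

/-- Having `n` distinct jumps in dimension `n` forces multiplicity one, so the set of jumps
determines every dimension. -/
theorem hasJumps_iff {w : (L →ₐ[ℚ_[p]] K) → Fin n → ℤ} (hw : ∀ σ, Function.Injective (w σ))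
    (𝓕 : Filtration p L K n) :
    HasJumps 𝓕 w ↔ ∀ σ i, Module.finrank K (evSpan σ (𝓕.Fil i)) = countGE (w σ) i := by
  classical
  have hpos : 0 < Module.finrank ℚ_[p] L := Module.finrank_pos
  have hposK : 0 < Module.finrank ℚ_[p] K := Module.finrank_pos
  have hgr : ∀ (σ : L →ₐ[ℚ_[p]] K) (i : ℤ), Nontrivial (gr (𝓕.induced (component p n σ)) i) ↔
      Module.finrank K (evSpan σ (𝓕.Fil (i + 1))) < Module.finrank K (evSpan σ (𝓕.Fil i)) := by
    intro σ i
    have h1 := finrank_gr (𝓕.antitone_induced (component p n σ)) i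
    have h2 := finrank_inf_component hLK (𝓕.actK_mem i) σ
    have h3 := finrank_inf_component hLK (𝓕.actK_mem (i + 1)) σ
    have h4 : Module.finrank K (evSpan σ (𝓕.Fil (i + 1))) < Module.finrank K (evSpan σ (𝓕.Fil i)) ↔
        Module.finrank L (𝓕.induced (component p n σ) (i + 1)) <
          Module.finrank L (𝓕.induced (component p n σ) i) := by
      rw [← mul_lt_mul_iff_right₀ hposK, ← h2, ← h3, mul_lt_mul_iff_right₀ hpos]
      rfl
    rw [h4, ← Module.finrank_pos_iff (R := L)]
    omega
  simp only [HasJumps, hgr]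
  constructor
  · intro h σ
    obtain ⟨a, b, ha, hb⟩ := 𝓕.exists_bounds
    refine eq_countGE_of_jumps (hw σ) (a := a) (b := b)
      (fun i j hij => Submodule.finrank_mono (evSpan_mono σ (𝓕.antitone hij))) ?_ ?_ ?_ (h σ)
    · rw [ha a le_rfl, finrank_evSpan_top hLK]
    · intro i
      exact (Submodule.finrank_le _).trans_eq (Module.finrank_fin_fun K)
    · rw [hb b le_rfl]
      have : evSpan σ (⊥ : Submodule L (DL p L K n)) = ⊥ := by
        rw [evSpan, Submodule.span_eq_bot]
        rintro _ ⟨x, hx, rfl⟩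
        rw [(Submodule.mem_bot L).1 hx, map_zero]
      rw [this, finrank_bot]
  · intro h σ i
    rw [h, h, countGE_eq_add (w σ) i, card_filter_eq_of_injective (hw σ)]
    split_ifs with hj <;> simp [hj]

theorem Filtration.finrank_mul_tH (𝓕 : Filtration p L K n) {V : Submodule L (DL p L K n)}
    (hV : ∀ (k : K), ∀ x ∈ V, actK p L n k x ∈ V) {a b : ℤ} (hab : a ≤ b)
    (ha : ∀ i ≤ a, 𝓕.Fil i = ⊤) (hb : ∀ i, b ≤ i → 𝓕.Fil i = ⊥) :
    (Module.finrank ℚ_[p] L : ℤ) * 𝓕.tH V = Module.finrank ℚ_[p] K *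
      ∑ σ : L →ₐ[ℚ_[p]] K, (a * (Module.finrank K (evSpan σ V) : ℤ) + ∑ i ∈ Finset.Ioc a b,
        (Module.finrank K (evSpan σ (𝓕.Fil i) ⊓ evSpan σ V : Submodule K (Fin n → K)) : ℤ)) := by
  have h1 : (Module.finrank ℚ_[p] L : ℤ) * Module.finrank L V =
      Module.finrank ℚ_[p] K * ∑ σ : L →ₐ[ℚ_[p]] K, (Module.finrank K (evSpan σ V) : ℤ) := by
    exact_mod_cast finrank_mul_finrank_eq_sum_evSpan hLK hV
  have h2 : ∀ i, (Module.finrank ℚ_[p] L : ℤ) *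
      Module.finrank L (𝓕.Fil i ⊓ V : Submodule L (DL p L K n)) =
      Module.finrank ℚ_[p] K * ∑ σ : L →ₐ[ℚ_[p]] K, (Module.finrank K
        (evSpan σ (𝓕.Fil i) ⊓ evSpan σ V : Submodule K (Fin n → K)) : ℤ) := by
    intro i
    have := finrank_mul_finrank_eq_sum_evSpan hLK (V := 𝓕.Fil i ⊓ V)
      fun k x hx => ⟨𝓕.actK_mem i k x hx.1, hV k x hx.2⟩
    have h3 : ∀ σ : L →ₐ[ℚ_[p]] K, Module.finrank K (evSpan σ (𝓕.Fil i ⊓ V)) = Module.finrank K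
        (evSpan σ (𝓕.Fil i) ⊓ evSpan σ V : Submodule K (Fin n → K)) := fun σ => by
      rw [evSpan_inf hLK (𝓕.actK_mem i) hV]
    simp only [h3] at this
    exact_mod_cast this
  have h3 : (Module.finrank ℚ_[p] L : ℤ) * ∑ i ∈ Finset.Ioc a b,
      (Module.finrank L (𝓕.Fil i ⊓ V : Submodule L (DL p L K n)) : ℤ) =
      Module.finrank ℚ_[p] K * ∑ σ : L →ₐ[ℚ_[p]] K, ∑ i ∈ Finset.Ioc a b, (Module.finrank K
        (evSpan σ (𝓕.Fil i) ⊓ evSpan σ V : Submodule K (Fin n → K)) : ℤ) := by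
    rw [Finset.mul_sum, Finset.sum_congr rfl fun i _ => h2 i, ← Finset.mul_sum, Finset.sum_comm]
  rw [𝓕.tH_eq hab ha hb, mul_add, mul_left_comm, h1, h3, Finset.sum_add_distrib, mul_add,
    ← Finset.mul_sum, mul_left_comm]

theorem Filtration.exists_common_bounds (w : (L →ₐ[ℚ_[p]] K) → Fin n → ℤ)
    (𝓕 : Filtration p L K n) : ∃ a b : ℤ, a ≤ b ∧ (∀ i ≤ a, 𝓕.Fil i = ⊤) ∧
      (∀ i, b ≤ i → 𝓕.Fil i = ⊥) ∧ (∀ σ j, a ≤ w σ j) ∧ ∀ σ j, w σ j ≤ b := by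
  obtain ⟨a, b, ha, hb⟩ := 𝓕.exists_bounds
  obtain ⟨a', ha'⟩ := (Set.finite_range fun q : (L →ₐ[ℚ_[p]] K) × Fin n => w q.1 q.2).bddBelow
  obtain ⟨b', hb'⟩ := (Set.finite_range fun q : (L →ₐ[ℚ_[p]] K) × Fin n => w q.1 q.2).bddAbove
  refine ⟨min a a', max (min a a') (max b b'), le_max_left _ _, fun i hi => ha i (by omega),
    fun i hi => hb i (by omega), fun σ j => ?_, fun σ j => ?_⟩
  · have : a' ≤ w σ j := ha' ⟨(σ, j), rfl⟩
    omega
  · have : w σ j ≤ b' := hb' ⟨(σ, j), rfl⟩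
    omega

variable {w : (L →ₐ[ℚ_[p]] K) → Fin n → ℤ} (hw : ∀ σ, StrictMono (w σ))
  {𝓕 : Filtration p L K n} (hJ : HasJumps 𝓕 w) {V : Submodule L (DL p L K n)}
  (hV : ∀ (k : K), ∀ x ∈ V, actK p L n k x ∈ V) {r : ℕ} (hr : r ≤ n)
  (hVr : ∀ σ : L →ₐ[ℚ_[p]] K, Module.finrank K (evSpan σ V) = r)
include hw hJ hV hr hVr

/-- In each component, `Fil^i` and `V` meet in dimension at least `r + countGE (w σ) i - n`, and
`sum_Ioc_countGE` adds these bounds up to the `r` smallest weights. -/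
theorem sum_le_tH : (Module.finrank ℚ_[p] K : ℤ) * ∑ σ : L →ₐ[ℚ_[p]] K,
      ∑ j : Fin n with j.val < r, w σ j ≤ Module.finrank ℚ_[p] L * 𝓕.tH V := by
  rw [hasJumps_iff hLK fun σ => (hw σ).injective] at hJ
  obtain ⟨a, b, hab, ha, hb, haw, hbw⟩ := 𝓕.exists_common_bounds hLK w
  rw [𝓕.finrank_mul_tH hLK hV hab ha hb]
  refine mul_le_mul_of_nonneg_left (Finset.sum_le_sum fun σ _ => ?_) (Nat.cast_nonneg _)
  rw [← sum_Ioc_countGE (hw σ).monotone hr (haw σ) (hbw σ), hVr]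
  gcongr with i
  have h1 := Submodule.finrank_sup_add_finrank_inf_eq (evSpan σ (𝓕.Fil i)) (evSpan σ V)
  have h2 := (Submodule.finrank_le (evSpan σ (𝓕.Fil i) ⊔ evSpan σ V)).trans_eq
    (Module.finrank_fin_fun K)
  rw [hJ, hVr] at h1
  omega

theorem tH_eq_sum (hgen : ∀ (σ : L →ₐ[ℚ_[p]] K) (i : ℤ), Module.finrank K
      (evSpan σ (𝓕.Fil i) ⊓ evSpan σ V : Submodule K (Fin n → K)) ≤ r + countGE (w σ) i - n) :
    (Module.finrank ℚ_[p] L : ℤ) * 𝓕.tH V = (Module.finrank ℚ_[p] K : ℤ) *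
      ∑ σ : L →ₐ[ℚ_[p]] K, ∑ j : Fin n with j.val < r, w σ j := by
  refine le_antisymm ?_ (sum_le_tH hLK hw hJ hV hr hVr)
  obtain ⟨a, b, hab, ha, hb, haw, hbw⟩ := 𝓕.exists_common_bounds hLK w
  rw [𝓕.finrank_mul_tH hLK hV hab ha hb]
  refine mul_le_mul_of_nonneg_left (Finset.sum_le_sum fun σ _ => ?_) (Nat.cast_nonneg _)
  rw [← sum_Ioc_countGE (hw σ).monotone hr (haw σ) (hbw σ), hVr]
  gcongr with i
  exact hgen σ i

omit hV hr hVr in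
theorem tH_top : (Module.finrank ℚ_[p] L : ℤ) * 𝓕.tH ⊤ = (Module.finrank ℚ_[p] K : ℤ) *
      ∑ σ : L →ₐ[ℚ_[p]] K, ∑ j : Fin n, w σ j := by
  -- The case `r = n`, where general position is automatic.
  rw [tH_eq_sum hLK hw hJ (fun _ _ _ => Submodule.mem_top) le_rfl (finrank_evSpan_top hLK)]
  · simp
  · intro σ i
    rw [Nat.add_sub_cancel_left, ← (hasJumps_iff hLK fun σ => (hw σ).injective) 𝓕 |>.1 hJ σ i]
    exact Submodule.finrank_mono inf_le_left

end Hodge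

/-! ## The semisimple part -/

theorem exists_squarefree_aeval_eq_zero {F K ι : Type*} [Field F] [Field K] [Algebra F K]
    [Finite ι] (a : ι → K) (ha : ∀ j, IsIntegral F (a j)) :
    ∃ P : Polynomial F, Squarefree P ∧ ∀ j, Polynomial.aeval (a j) P = 0 := by
  classical
  have := Fintype.ofFinite ι
  have hne : ∏ j, minpoly F (a j) ≠ 0 := Finset.prod_ne_zero_iff.2 fun j _ => minpoly.ne_zero (ha j)
  refine ⟨UniqueFactorizationMonoid.radical (∏ j, minpoly F (a j)),
    UniqueFactorizationMonoid.squarefree_radical, fun j => ?_⟩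
  have hdvd : minpoly F (a j) ∣ UniqueFactorizationMonoid.radical (∏ j, minpoly F (a j)) :=
    (UniqueFactorizationMonoid.dvd_radical_iff_of_irreducible (minpoly.irreducible (ha j)) hne).2
      (Finset.dvd_prod_of_mem _ (Finset.mem_univ j))
  exact Polynomial.aeval_eq_zero_of_dvd_aeval_eq_zero hdvd (minpoly.aeval F (a j))

section SemisimplePart

variable {p : ℕ} [Fact p.Prime] {L K : Type*} [Field L] [Algebra ℚ_[p] L]
  [Field K] [Algebra ℚ_[p] K] {n : ℕ} [FiniteDimensional ℚ_[p] L] [FiniteDimensional ℚ_[p] K]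

theorem aeval_apply_of_diagonal {R : Type*} [CommRing R] [Algebra ℚ_[p] R]
    [Module R (PhiSpace p L K n)] [IsScalarTower ℚ_[p] R (PhiSpace p L K n)]
    {a : Fin n → K} {G : Module.End R (PhiSpace p L K n)}
    (hG : ∀ x j, G x j = (1 ⊗ₜ[ℚ_[p]] a j : CoeffRing p L K) * x j) (P : Polynomial ℚ_[p])
    (x : PhiSpace p L K n) (j : Fin n) :
    Polynomial.aeval G P x j =
      (1 ⊗ₜ[ℚ_[p]] (Polynomial.aeval (a j) P) : CoeffRing p L K) * x j := by
  induction P using Polynomial.induction_on' generalizing x with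
  | add P Q hP hQ =>
    rw [map_add, LinearMap.add_apply, Pi.add_apply, hP, hQ, map_add, TensorProduct.tmul_add, add_mul]
  | monomial m c =>
    rw [Polynomial.aeval_monomial, Polynomial.aeval_monomial, Module.End.mul_apply,
      Module.algebraMap_end_apply, Pi.smul_apply]
    have hpow : ∀ m : ℕ, (G ^ m) x j = (1 ⊗ₜ[ℚ_[p]] (a j ^ m) : CoeffRing p L K) * x j := by
      intro m
      induction m with
      | zero => rw [pow_zero, pow_zero, Module.End.one_apply, ← Algebra.TensorProduct.one_def,
          one_mul]
      | succ m ih =>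
        rw [pow_succ', Module.End.mul_apply, hG, ih, ← mul_assoc,
          Algebra.TensorProduct.tmul_mul_tmul, one_mul, pow_succ']
    rw [hpow, ← Algebra.smul_def, TensorProduct.tmul_smul, smul_mul_assoc]

theorem diagFrob_apply (ζ : Fin n → Kˣ) (x : PhiSpace p L K n) (j : Fin n) :
    diagFrob p L ζ x j = (1 ⊗ₜ[ℚ_[p]] ((ζ j)⁻¹ : K) : CoeffRing p L K) * x j := rfl

theorem isSemisimple_of_diagonal {R : Type*} [Field R] [Algebra ℚ_[p] R]
    [Module R (PhiSpace p L K n)] [IsScalarTower ℚ_[p] R (PhiSpace p L K n)]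
    {a : Fin n → K} {G : Module.End R (PhiSpace p L K n)}
    (hG : ∀ x j, G x j = (1 ⊗ₜ[ℚ_[p]] a j : CoeffRing p L K) * x j) : G.IsSemisimple := by
  obtain ⟨P, hP, h0⟩ := exists_squarefree_aeval_eq_zero (F := ℚ_[p]) a
    fun j => Algebra.IsIntegral.isIntegral _
  -- Separability, unlike squarefreeness in general, survives the extension of scalars from `ℚ_p` to
  -- `R`.
  rw [← PerfectField.separable_iff_squarefree] at hP
  refine Module.End.isSemisimple_of_squarefree_aeval_eq_zero
    (p := P.map (algebraMap ℚ_[p] R)) hP.map.squarefree ?_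
  rw [Polynomial.aeval_map_algebraMap]
  refine LinearMap.ext fun x => funext fun j => ?_
  rw [aeval_apply_of_diagonal hG, h0]
  simp

/-- The linear map over `ℚ_p` underlying a Frobenius. -/
def Frobenius.toLin (φ : Frobenius p L K n) : Module.End ℚ_[p] (PhiSpace p L K n) where
  toFun := φ.toFun
  map_add' := φ.map_add
  map_smul' c x := by
    have h := φ.map_smul (algebraMap ℚ_[p] (L₀ p L) c) 1 x
    rw [AlgEquiv.commutes] at h
    rw [RingHom.id_apply]
    rwa [show (algebraMap ℚ_[p] (L₀ p L) c ⊗ₜ[ℚ_[p]] (1 : K) : CoeffRing p L K) =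
      algebraMap ℚ_[p] (CoeffRing p L K) c from rfl, algebraMap_smul, algebraMap_smul] at h

theorem Frobenius.linPowL₀_apply (φ : Frobenius p L K n) (x : PhiSpace p L K n) :
    φ.linPowL₀ x = φ.toFun^[resDeg p L] x := rfl

theorem Frobenius.linPowL₀_injective (φ : Frobenius p L K n) :
    Function.Injective φ.linPowL₀ := φ.bijective.injective.iterate _

theorem Frobenius.commute_toLin (φ : Frobenius p L K n) :
    Commute φ.toLin (φ.linPowL₀.restrictScalars ℚ_[p]) := by
  refine LinearMap.ext fun x => ?_
  change φ.toFun (φ.toFun^[resDeg p L] x) = φ.toFun^[resDeg p L] (φ.toFun x)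
  exact (Function.iterate_succ_apply' φ.toFun (resDeg p L) x).symm.trans
    (Function.iterate_succ_apply φ.toFun (resDeg p L) x)

variable {φ : Frobenius p L K n} {ζ : Fin n → Kˣ}
  (hss : IsSemisimplePart φ.linPowL₀ ((diagFrob p L ζ).restrictScalars (L₀ p L)))
include hss

/-- By uniqueness of the Jordan decomposition, the semisimple part is a polynomial in `φ ^ f`. The
argument is made over `ℚ_p` because `φ` is not `L₀`-linear: with coefficients in `ℚ_p` the
polynomial commutes with `φ`. -/
theorem diagFrob_mem_adjoin : (diagFrob p L ζ).restrictScalars ℚ_[p] ∈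
    Algebra.adjoin ℚ_[p] {(φ.linPowL₀.restrictScalars ℚ_[p] :
      Module.End ℚ_[p] (PhiSpace p L K n))} := by
  set e : Module.End ℚ_[p] (PhiSpace p L K n) := φ.linPowL₀.restrictScalars ℚ_[p] with he
  set s : Module.End ℚ_[p] (PhiSpace p L K n) := (diagFrob p L ζ).restrictScalars ℚ_[p] with hs
  obtain ⟨m, hm, t, ht, hmn, hts, hmt⟩ := Module.End.exists_isNilpotent_isSemisimple (f := e)
  have hsem : s.IsSemisimple := isSemisimple_of_diagonal (diagFrob_apply ζ)
  have hcomm : Commute s e := LinearMap.ext fun x => LinearMap.congr_fun hss.2.2 x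
  have hnil : IsNilpotent (e - s) := by
    obtain ⟨k, hk⟩ := hss.2.1
    refine ⟨k, LinearMap.ext fun x => ?_⟩
    have hpow : ∀ k : ℕ, ((e - s) ^ k) x = ((φ.linPowL₀ -
        (diagFrob p L ζ).restrictScalars (L₀ p L)) ^ k : Module.End (L₀ p L) _) x := by
      intro k
      induction k with
      | zero => rfl
      | succ k ih => rw [pow_succ', pow_succ', Module.End.mul_apply, Module.End.mul_apply, ih]; rfl
    rw [hpow, hk]
    rfl
  have hcomm' : Commute m t := Algebra.commute_of_mem_adjoin_singleton_of_commute ht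
    (Algebra.commute_of_mem_adjoin_self hm).symm
  have := (Module.End.isNilpotent_isSemisimple_unique hnil hsem hmn hts
    (hcomm.symm.sub_left (Commute.refl s)) hcomm' (by rw [sub_add_cancel, hmt])).2
  rw [this]
  exact ht

theorem diagFrob_mem {W : Submodule (L₀ p L) (PhiSpace p L K n)}
    (hW : ∀ x ∈ W, φ.toFun x ∈ W) {x : PhiSpace p L K n} (hx : x ∈ W) :
    diagFrob p L ζ x ∈ W := by
  have key : ∀ e ∈ Algebra.adjoin ℚ_[p] {(φ.linPowL₀.restrictScalars ℚ_[p] :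
      Module.End ℚ_[p] (PhiSpace p L K n))}, ∀ x ∈ W, e x ∈ W := by
    intro e he
    induction he using Algebra.adjoin_induction with
    | mem e he =>
      rw [Set.mem_singleton_iff] at he
      subst he
      exact φ.linPowL₀_mem hW
    | algebraMap c =>
      intro x hx
      rw [Module.algebraMap_end_apply]
      exact W.smul_of_tower_mem c hx
    | add a b _ _ ha hb => exact fun x hx => W.add_mem (ha x hx) (hb x hx)
    | mul a b _ _ ha hb => exact fun x hx => ha _ (hb x hx)
  exact key _ (diagFrob_mem_adjoin hss) x hx

theorem toFun_diagFrob (x : PhiSpace p L K n) :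
    φ.toFun (diagFrob p L ζ x) = diagFrob p L ζ (φ.toFun x) :=
  LinearMap.congr_fun (Algebra.commute_of_mem_adjoin_singleton_of_commute (diagFrob_mem_adjoin hss)
    φ.commute_toLin) x

end SemisimplePart

/-! ## The Newton number -/

section Newton

variable {p : ℕ} [Fact p.Prime] {L K : Type*} [Field L] [Algebra ℚ_[p] L]
  [Field K] [Algebra ℚ_[p] K] {n : ℕ} [FiniteDimensional ℚ_[p] L] [FiniteDimensional ℚ_[p] K]

theorem resDeg_pos : 0 < resDeg p L := Module.finrank_pos

/-- The degree `[L : ℚ_p]` cancels. One factor `1 / f` comes from `e`, the other from normalizing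
the valuation on `L₀` by the norm. -/
theorem tN_eq (φ : Frobenius p L K n) (W : Submodule (L₀ p L) (PhiSpace p L K n))
    (hW : ∀ x ∈ W, φ.toFun x ∈ W) :
    tN φ W hW = (Padic.valuation (Algebra.norm ℚ_[p]
      (LinearMap.det (φ.linPowL₀.restrict (φ.linPowL₀_mem hW)))) : ℚ) / resDeg p L ^ 2 := by
  have h1 : (Module.finrank ℚ_[p] L : ℚ) ≠ 0 := by
    exact_mod_cast (Module.finrank_pos (R := ℚ_[p]) (M := L)).ne'
  have h2 : (resDeg p L : ℚ) ≠ 0 := by exact_mod_cast resDeg_pos.ne'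
  have h3 : Module.finrank ℚ_[p] (L₀ p L) = resDeg p L := rfl
  rw [tN, valL, valP, h3]
  field_simp

theorem det_restrict_ne_zero (φ : Frobenius p L K n)
    {W : Submodule (L₀ p L) (PhiSpace p L K n)} (hW : ∀ x ∈ W, φ.toFun x ∈ W) :
    LinearMap.det (φ.linPowL₀.restrict (φ.linPowL₀_mem hW)) ≠ 0 := by
  intro h
  have h2 := LinearMap.bot_lt_ker_of_det_eq_zero h
  rw [LinearMap.ker_eq_bot_of_injective] at h2
  · exact lt_irrefl _ h2
  · intro x y hxy
    exact Subtype.ext (φ.linPowL₀_injective (congrArg Subtype.val hxy))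

theorem tN_sup_add_tN_inf (φ : Frobenius p L K n)
    {A B : Submodule (L₀ p L) (PhiSpace p L K n)} (hA : ∀ x ∈ A, φ.toFun x ∈ A)
    (hB : ∀ x ∈ B, φ.toFun x ∈ B) (hs : ∀ x ∈ A ⊔ B, φ.toFun x ∈ A ⊔ B)
    (hi : ∀ x ∈ A ⊓ B, φ.toFun x ∈ A ⊓ B) :
    tN φ (A ⊔ B) hs + tN φ (A ⊓ B) hi = tN φ A hA + tN φ B hB := by
  have hn : ∀ {x : L₀ p L}, x ≠ 0 → Algebra.norm ℚ_[p] x ≠ 0 := fun h =>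
    Algebra.norm_ne_zero_iff.2 h
  have h := congrArg (fun x => Padic.valuation (Algebra.norm ℚ_[p] x))
    (det_restrict_sup_mul_det_restrict_inf φ.linPowL₀ (φ.linPowL₀_mem hA) (φ.linPowL₀_mem hB)
      (φ.linPowL₀_mem hs) (φ.linPowL₀_mem hi))
  simp only [map_mul] at h
  rw [Padic.valuation_mul (hn (det_restrict_ne_zero φ hs)) (hn (det_restrict_ne_zero φ hi)),
    Padic.valuation_mul (hn (det_restrict_ne_zero φ hA)) (hn (det_restrict_ne_zero φ hB))] at h
  simp only [tN_eq]
  rw [← add_div, ← add_div]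
  congr 1
  exact_mod_cast h

/-- The action of `k ∈ K` on `D`. -/
def actKD (p : ℕ) [Fact p.Prime] (L : Type*) {K : Type*} [Field L] [Algebra ℚ_[p] L]
    [Field K] [Algebra ℚ_[p] K] (n : ℕ) (k : K) : Module.End (L₀ p L) (PhiSpace p L K n) :=
  Algebra.lsmul (L₀ p L) (L₀ p L) (PhiSpace p L K n)
      ((1 : L₀ p L) ⊗ₜ[ℚ_[p]] k : CoeffRing p L K)

theorem actKD_apply (k : K) (x : PhiSpace p L K n) :
    actKD p L n k x = (1 ⊗ₜ[ℚ_[p]] k : CoeffRing p L K) • x := rfl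

theorem actKD_actKD {k l : K} (h : k * l = 1) (x : PhiSpace p L K n) :
    actKD p L n k (actKD p L n l x) = x := by
  rw [actKD_apply, actKD_apply, smul_smul, Algebra.TensorProduct.tmul_mul_tmul, one_mul, h,
    ← Algebra.TensorProduct.one_def, one_smul]

theorem actKD_injective {k : K} (hk : k ≠ 0) :
    Function.Injective (actKD (p := p) (L := L) n k) :=
  Function.LeftInverse.injective (g := actKD p L n k⁻¹) (actKD_actKD (inv_mul_cancel₀ hk))

theorem Frobenius.toFun_actKD (φ : Frobenius p L K n) (k : K) (x : PhiSpace p L K n) :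
    φ.toFun (actKD p L n k x) = actKD p L n k (φ.toFun x) := by
  rw [actKD_apply, φ.map_smul, map_one]
  rfl

theorem toFun_mem_map_actKD (φ : Frobenius p L K n)
    {W : Submodule (L₀ p L) (PhiSpace p L K n)} (hW : ∀ x ∈ W, φ.toFun x ∈ W) (k : K) :
    ∀ x ∈ W.map (actKD p L n k), φ.toFun x ∈ W.map (actKD p L n k) := by
  rintro _ ⟨x, hx, rfl⟩
  exact ⟨φ.toFun x, hW x hx, (φ.toFun_actKD k x).symm⟩

theorem tN_map_actKD (φ : Frobenius p L K n)
    {W : Submodule (L₀ p L) (PhiSpace p L K n)} (hW : ∀ x ∈ W, φ.toFun x ∈ W) {k : K} (hk : k ≠ 0) :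
    tN φ (W.map (actKD p L n k)) (toFun_mem_map_actKD φ hW k) = tN φ W hW := by
  rw [tN_eq, tN_eq]
  congr 4
  let e := Submodule.equivMapOfInjective (actKD p L n k) (actKD_injective hk) W
  rw [← LinearMap.det_conj _ e]
  congr 1
  refine LinearMap.ext fun x => ?_
  obtain ⟨y, rfl⟩ := e.surjective x
  refine Subtype.ext ?_
  simp only [LinearMap.comp_apply, LinearEquiv.coe_coe, LinearEquiv.symm_apply_apply]
  exact φ.linPow.map_smul ((1 : L₀ p L) ⊗ₜ[ℚ_[p]] k : CoeffRing p L K) y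

/-! ### Determinants over `K` instead of `L₀` -/

section RightModule

attribute [local instance] Algebra.TensorProduct.rightAlgebra

theorem smul_right_phiSpace (k : K) (x : PhiSpace p L K n) :
    k • x = (1 ⊗ₜ[ℚ_[p]] k : CoeffRing p L K) • x := by
  funext j
  rw [Pi.smul_apply, Pi.smul_apply, smul_eq_mul, Algebra.smul_def]
  rfl

instance : Module.Finite K (CoeffRing p L K) :=
  Module.Finite.right ℚ_[p] K (CoeffRing p L K)

theorem finrank_right_coeffRing : Module.finrank K (CoeffRing p L K) = resDeg p L := by
  have h := Module.finrank_mul_finrank ℚ_[p] K (CoeffRing p L K)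
  rw [Module.finrank_tensorProduct, mul_comm] at h
  exact Nat.eq_of_mul_eq_mul_right Module.finrank_pos h

/-- The norm to `ℚ_p` of either determinant, over `L₀` or over `K`, is the determinant over `ℚ_p`.
Over `K`, the coordinates filter `W` into pieces on which `F_ζ` is a scalar, and `y k` is the
dimension of such a piece. -/
theorem exists_norm_det_diagFrob (ζ : Fin n → Kˣ) (τ : Equiv.Perm (Fin n))
    {W : Submodule (L₀ p L) (PhiSpace p L K n)}
    (hWK : ∀ (k : K), ∀ x ∈ W, (1 ⊗ₜ[ℚ_[p]] k : CoeffRing p L K) • x ∈ W)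
    (hWF : ∀ x ∈ W, (diagFrob p L ζ).restrictScalars (L₀ p L) x ∈ W) :
    ∃ y : Fin n → ℕ,
      Algebra.norm ℚ_[p] (LinearMap.det
        (((diagFrob p L ζ).restrictScalars (L₀ p L)).restrict hWF)) =
        Algebra.norm ℚ_[p] (∏ k, ((ζ (τ k))⁻¹ : K) ^ y k) ∧
      (∑ k, y k) * Module.finrank ℚ_[p] K = resDeg p L * Module.finrank (L₀ p L) W ∧
      (∀ k, y k ≤ resDeg p L) ∧ ∀ k, (∀ x ∈ W, x (τ k) = 0) → y k = 0 := by
  let WK : Submodule K (PhiSpace p L K n) :=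
    { W.toAddSubmonoid with
      smul_mem' := fun k x hx => by
        rw [smul_right_phiSpace]
        exact hWK k x hx }
  let F : Module.End K WK :=
    { toFun := fun x => ⟨diagFrob p L ζ x, hWF x x.2⟩
      map_add' := fun x y => Subtype.ext (map_add (diagFrob p L ζ) (x : PhiSpace p L K n) y)
      map_smul' := fun k x => Subtype.ext (by
        change diagFrob p L ζ (k • (x : PhiSpace p L K n)) = k • diagFrob p L ζ x
        rw [smul_right_phiSpace, map_smul, smul_right_phiSpace]) }
  -- The target has dimension `f` over `K`, whence the bound on `y k`.
  let c : ∀ _ : Fin n, WK →ₗ[K] CoeffRing p L K := fun k => (LinearMap.proj (τ k)).comp WK.subtype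
  obtain ⟨y, hdet, hsum, hle, h0⟩ := exists_det_eq_prod_pow F c (fun k => ((ζ (τ k))⁻¹ : K))
    (fun k x => by
      change diagFrob p L ζ x (τ k) = ((ζ (τ k))⁻¹ : K) • (x : PhiSpace p L K n) (τ k)
      rw [diagFrob_apply, Algebra.smul_def]
      rfl)
    (fun x hx => Subtype.ext (funext fun j => by
      have := hx (τ.symm j)
      change (x : PhiSpace p L K n) (τ (τ.symm j)) = 0 at this
      rwa [Equiv.apply_symm_apply] at this))
  let e : W ≃ₗ[ℚ_[p]] WK :=
    { toFun := fun x => ⟨x, x.2⟩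
      invFun := fun x => ⟨x, x.2⟩
      map_add' := fun _ _ => rfl
      map_smul' := fun _ _ => rfl
      left_inv := fun _ => rfl
      right_inv := fun _ => rfl }
  have : Module.Free K WK := Module.Free.of_divisionRing K WK
  have : Module.Free (L₀ p L) W := Module.Free.of_divisionRing (L₀ p L) W
  refine ⟨y, ?_, ?_, fun k => (hle k).trans_eq finrank_right_coeffRing, fun k hk => h0 k ?_⟩
  · rw [← hdet, ← LinearMap.det_restrictScalars, ← LinearMap.det_restrictScalars,
      ← LinearMap.det_conj _ e]
    rfl
  · have h1 := Module.finrank_mul_finrank ℚ_[p] K WK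
    have h2 := Module.finrank_mul_finrank ℚ_[p] (L₀ p L) W
    rw [hsum, mul_comm, h1, ← e.finrank_eq, ← h2]
    rfl
  · exact LinearMap.ext fun x => hk x x.2

end RightModule

theorem valuation_norm_eq (x : K) : (Padic.valuation (Algebra.norm ℚ_[p] x) : ℚ) =
    Module.finrank ℚ_[p] K * resDeg p L / Module.finrank ℚ_[p] L * valL p L K x := by
  have h1 : (Module.finrank ℚ_[p] L : ℚ) ≠ 0 := by
    exact_mod_cast (Module.finrank_pos (R := ℚ_[p]) (M := L)).ne'
  have h2 : (resDeg p L : ℚ) ≠ 0 := by exact_mod_cast resDeg_pos.ne'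
  have h3 : (Module.finrank ℚ_[p] K : ℚ) ≠ 0 := by
    exact_mod_cast (Module.finrank_pos (R := ℚ_[p]) (M := K)).ne'
  rw [valL, valP]
  field_simp

theorem valuation_norm_prod_inv_pow (ζ : Fin n → Kˣ) (y : Fin n → ℕ) :
    Padic.valuation (Algebra.norm ℚ_[p] (∏ k, ((ζ k)⁻¹ : K) ^ y k)) =
      -∑ k, (y k : ℤ) * Padic.valuation (Algebra.norm ℚ_[p] (ζ k : K)) := by
  have hn : ∀ k, Algebra.norm ℚ_[p] (ζ k : K) ≠ 0 := fun k =>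
    Algebra.norm_ne_zero_iff.2 (ζ k).ne_zero
  have key : ∀ s : Finset (Fin n),
      Algebra.norm ℚ_[p] (∏ k ∈ s, ((ζ k)⁻¹ : K) ^ y k) ≠ 0 ∧
      Padic.valuation (Algebra.norm ℚ_[p] (∏ k ∈ s, ((ζ k)⁻¹ : K) ^ y k)) =
      -∑ k ∈ s, (y k : ℤ) * Padic.valuation (Algebra.norm ℚ_[p] (ζ k : K)) := by
    classical
    intro s
    induction s using Finset.induction_on with
    | empty => simp
    | insert k s hk ih =>
      rw [Finset.prod_insert hk, Finset.sum_insert hk, map_mul]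
      have h1 : Algebra.norm ℚ_[p] (((ζ k)⁻¹ : K) ^ y k) =
          (Algebra.norm ℚ_[p] (ζ k : K))⁻¹ ^ y k := by
        have h0 : Algebra.norm ℚ_[p] ((ζ k)⁻¹ : K) * Algebra.norm ℚ_[p] (ζ k : K) = 1 := by
          rw [← map_mul, inv_mul_cancel₀ (ζ k).ne_zero, map_one]
        rw [map_pow, eq_inv_of_mul_eq_one_left h0]
      have h2 : (Algebra.norm ℚ_[p] (ζ k : K))⁻¹ ^ y k ≠ 0 := pow_ne_zero _ (inv_ne_zero (hn k))
      rw [h1]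
      refine ⟨mul_ne_zero h2 ih.1, ?_⟩
      rw [Padic.valuation_mul h2 ih.1, ih.2, Padic.valuation_pow, Padic.valuation_inv]
      ring
  exact (key Finset.univ).2

/-- The maps `φ ^ f` and `F_ζ` have the same determinant on `W`, because they differ by a commuting
nilpotent there. The sum of the `y k` encodes the rank of `W`. -/
theorem exists_tN_eq_sum {φ : Frobenius p L K n} {ζ : Fin n → Kˣ}
    (hss : IsSemisimplePart φ.linPowL₀ ((diagFrob p L ζ).restrictScalars (L₀ p L)))
    (τ : Equiv.Perm (Fin n)) {W : Submodule (L₀ p L) (PhiSpace p L K n)}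
    (hW : ∀ x ∈ W, φ.toFun x ∈ W)
    (hWK : ∀ (k : K), ∀ x ∈ W, (1 ⊗ₜ[ℚ_[p]] k : CoeffRing p L K) • x ∈ W) :
    ∃ y : Fin n → ℕ,
      (Module.finrank ℚ_[p] L : ℚ) * resDeg p L * tN φ W hW =
        -(Module.finrank ℚ_[p] K * ∑ k, y k * valL p L K (ζ (τ k) : K)) ∧
      (∑ k, y k) * Module.finrank ℚ_[p] K = resDeg p L * Module.finrank (L₀ p L) W ∧
      (∀ k, y k ≤ resDeg p L) ∧ ∀ k, (∀ x ∈ W, x (τ k) = 0) → y k = 0 := by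
  have hWF : ∀ x ∈ W, (diagFrob p L ζ).restrictScalars (L₀ p L) x ∈ W := fun x hx =>
    diagFrob_mem hss hW hx
  obtain ⟨y, hdet, hsum, hle, h0⟩ := exists_norm_det_diagFrob ζ τ hWK hWF
  refine ⟨y, ?_, hsum, hle, h0⟩
  have hinjF : Function.Injective (((diagFrob p L ζ).restrictScalars (L₀ p L)).restrict hWF) := by
    intro x x' h
    refine Subtype.ext (funext fun j => ?_)
    have h1 : (1 ⊗ₜ[ℚ_[p]] ((ζ j)⁻¹ : K) : CoeffRing p L K) * (x : PhiSpace p L K n) j =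
        (1 ⊗ₜ[ℚ_[p]] ((ζ j)⁻¹ : K) : CoeffRing p L K) * (x' : PhiSpace p L K n) j :=
      congrFun (congrArg Subtype.val h) j
    have h2 := congrArg ((1 ⊗ₜ[ℚ_[p]] (ζ j : K) : CoeffRing p L K) * ·) h1
    simpa only [← mul_assoc, Algebra.TensorProduct.tmul_mul_tmul, one_mul,
      mul_inv_cancel₀ (ζ j).ne_zero, ← Algebra.TensorProduct.one_def] using h2
  have hdetE : LinearMap.det (φ.linPowL₀.restrict (φ.linPowL₀_mem hW)) =
      LinearMap.det (((diagFrob p L ζ).restrictScalars (L₀ p L)).restrict hWF) := by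
    apply det_eq_det_of_isNilpotent_sub
    · exact (Module.End.isUnit_iff _).2 ⟨hinjF, LinearMap.surjective_of_injective hinjF⟩
    · exact LinearMap.ext fun x => Subtype.ext (LinearMap.congr_fun hss.2.2 (x : PhiSpace p L K n))
    · obtain ⟨m, hm⟩ := hss.2.1
      refine ⟨m, LinearMap.ext fun x => Subtype.ext ?_⟩
      have hpow : ∀ m : ℕ, (((φ.linPowL₀.restrict (φ.linPowL₀_mem hW) -
          ((diagFrob p L ζ).restrictScalars (L₀ p L)).restrict hWF) ^ m) x : PhiSpace p L K n) =
          ((φ.linPowL₀ - (diagFrob p L ζ).restrictScalars (L₀ p L)) ^ m :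
            Module.End (L₀ p L) _) x := by
        intro m
        induction m with
        | zero => rfl
        | succ m ih =>
          rw [pow_succ', pow_succ', Module.End.mul_apply, Module.End.mul_apply, ← ih]
          rfl
      rw [hpow, hm]
      rfl
  rw [tN_eq, hdetE, hdet, valuation_norm_prod_inv_pow (fun k => ζ (τ k)) y]
  have h1 : (Module.finrank ℚ_[p] L : ℚ) ≠ 0 := by
    exact_mod_cast (Module.finrank_pos (R := ℚ_[p]) (M := L)).ne'
  have h2 : (resDeg p L : ℚ) ≠ 0 := by exact_mod_cast resDeg_pos.ne'
  push_cast
  simp only [valuation_norm_eq (L := L)]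
  have h4 : ∑ k, (y k : ℚ) * ((Module.finrank ℚ_[p] K : ℚ) * resDeg p L /
      Module.finrank ℚ_[p] L * valL p L K (ζ (τ k) : K)) = (Module.finrank ℚ_[p] K : ℚ) *
      resDeg p L / Module.finrank ℚ_[p] L * ∑ k, y k * valL p L K (ζ (τ k) : K) := by
    rw [Finset.mul_sum]
    exact Finset.sum_congr rfl fun k _ => by ring
  rw [h4]
  field_simp

end Newton

/-! ### Elementary inequalities between partial sums -/

section Sums

variable {n : ℕ}

theorem sum_filter_lt_succ (f : Fin n → ℚ) {i : ℕ} (hi : i < n) :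
    ∑ j : Fin n with j.val < i + 1, f j = ∑ j : Fin n with j.val < i, f j + f ⟨i, hi⟩ := by
  have : (Finset.univ.filter fun j : Fin n => j.val < i + 1) =
      insert ⟨i, hi⟩ (Finset.univ.filter fun j : Fin n => j.val < i) := by
    ext j
    simp only [Finset.mem_filter, Finset.mem_univ, true_and, Finset.mem_insert, Fin.ext_iff]
    omega
  rw [this, Finset.sum_insert (by simp), add_comm]

theorem sum_filter_sub_le_succ (v : Fin n → ℚ) {i : ℕ} (hi : i < n) :
    ∑ j : Fin n with n - (i + 1) ≤ j.val, v j =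
      ∑ j : Fin n with n - i ≤ j.val, v j + v ⟨n - (i + 1), by omega⟩ := by
  have : (Finset.univ.filter fun j : Fin n => n - (i + 1) ≤ j.val) =
      insert ⟨n - (i + 1), by omega⟩ (Finset.univ.filter fun j : Fin n => n - i ≤ j.val) := by
    ext j
    simp only [Finset.mem_filter, Finset.mem_univ, true_and, Finset.mem_insert, Fin.ext_iff]
    omega
  rw [this, Finset.sum_insert (by simp; omega), add_comm]

/-- An inequality between two convex polygons with strictly increasing slopes on the left only
has to be checked at the vertices where the slope of the right one jumps. -/
theorem sum_le_neg_sum_of_breaks {f v : Fin n → ℚ} (hf : StrictMono f) (hv : Monotone v)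
    (hbreak : ∀ r ≤ n, (∀ k l : Fin n, k.val < n - r → n - r ≤ l.val → v k < v l) →
      ∑ j : Fin n with j.val < r, f j ≤ -∑ j : Fin n with n - r ≤ j.val, v j) (i : ℕ)
    (hi : i ≤ n) : ∑ j : Fin n with j.val < i, f j ≤ -∑ j : Fin n with n - i ≤ j.val, v j := by
  by_contra! hlt
  -- The gap between the two polygons. At an abscissa `m` where it is smallest, and negative, there
  -- is no break by `hbreak`.
  let D : ℕ → ℚ := fun i =>
    -∑ j : Fin n with n - i ≤ j.val, v j - ∑ j : Fin n with j.val < i, f j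
  obtain ⟨m, hm, hmin⟩ := Finset.exists_min_image (Finset.range (n + 1)) D ⟨0, by simp⟩
  have hm' : m ≤ n := by
    rw [Finset.mem_range] at hm
    omega
  have hneg : D m < 0 := by
    refine (hmin i (by rw [Finset.mem_range]; omega)).trans_lt ?_
    simp only [D]
    linarith
  have hnb : ¬ ∀ k l : Fin n, k.val < n - m → n - m ≤ l.val → v k < v l := by
    intro h
    have := hbreak m hm' h
    simp only [D] at hneg
    linarith
  push Not at hnb
  obtain ⟨k, l, hk, hl, hkl⟩ := hnb
  have hm0 : 0 < m := by
    have := l.2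
    omega
  obtain ⟨m, rfl⟩ : ∃ m', m = m' + 1 := ⟨m - 1, by omega⟩
  -- The index `m` has been shifted by one, so the minimum is at `m + 1`, and `k`, `l` show that
  -- both neighbours exist. Comparing with them, the strict increase of `f` forces `v` to increase
  -- strictly at `n - (m + 1)`, against `v l ≤ v k`.
  have h1 := hmin m (by rw [Finset.mem_range]; omega)
  have h2 := hmin (m + 2) (by rw [Finset.mem_range]; omega)
  simp only [D] at h1 h2
  rw [sum_filter_lt_succ f (i := m) (by omega), sum_filter_sub_le_succ v (i := m) (by omega)] at h1
  rw [sum_filter_lt_succ f (i := m + 1) (by omega),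
    sum_filter_sub_le_succ v (i := m + 1) (by omega)] at h2
  have h3 : f ⟨m, by omega⟩ < f ⟨m + 1, by omega⟩ := hf (Fin.lt_def.2 (Nat.lt_succ_self m))
  have h4 : v ⟨n - (m + 1), by omega⟩ ≤ v l := hv (Fin.le_def.2 hl)
  have h5 : v k ≤ v ⟨n - (m + 1 + 1), by omega⟩ := hv (Fin.le_def.2 (by simp only; omega))
  linarith

/-- With coefficients between `0` and `c` and total weight `c * r`, the best choice is to put weight
`c` on the `r` largest values. -/
theorem sum_mul_le_of_sum_eq {v : Fin n → ℚ} (hv : Monotone v) {r c : ℕ} (hr : r ≤ n)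
    {y : Fin n → ℕ} (hy : ∀ k, y k ≤ c) (hsum : ∑ k, y k = c * r) :
    ∑ k, (y k : ℚ) * v k ≤ c * ∑ j : Fin n with n - r ≤ j.val, v j := by
  rcases Nat.eq_zero_or_pos r with rfl | hr0
  · rw [mul_zero, Finset.sum_eq_zero_iff] at hsum
    rw [Finset.sum_eq_zero fun k hk => by rw [hsum k hk, Nat.cast_zero, zero_mul],
      Finset.sum_eq_zero, mul_zero]
    intro j hj
    rw [Finset.mem_filter] at hj
    have := j.2
    omega
  · have hn : n - r < n := by omega
    -- After subtracting the threshold `u` from `v`, the inequality holds term by term. The terms in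
    -- `u` cancel because the total weights agree.
    let u := v ⟨n - r, hn⟩
    have hcard : ∑ k : Fin n, (if n - r ≤ k.val then (1 : ℚ) else 0) = r := by
      rw [Finset.sum_boole]
      have h1 := Finset.card_filter_add_card_filter_not (s := (Finset.univ : Finset (Fin n)))
        (fun j => j.val < n - r)
      rw [Fin.card_filter_val_lt, Finset.card_univ, Fintype.card_fin, min_eq_right hn.le] at h1
      simp only [not_lt] at h1
      exact_mod_cast (by omega)
    have hsum' : ∑ k, (y k : ℚ) = c * r := by exact_mod_cast hsum
    have key : ∀ k : Fin n, (y k : ℚ) * (v k - u) ≤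
        c * (if n - r ≤ k.val then (1 : ℚ) else 0) * (v k - u) := by
      intro k
      have h1 : (y k : ℚ) ≤ c := by exact_mod_cast hy k
      have h2 : (0 : ℚ) ≤ y k := Nat.cast_nonneg _
      split_ifs with h
      · have : u ≤ v k := hv (Fin.le_def.2 h)
        nlinarith
      · have : v k ≤ u := hv (Fin.le_def.2 (by simp only; omega))
        nlinarith
    have h1 := Finset.sum_le_sum fun k (_ : k ∈ Finset.univ) => key k
    simp only [mul_sub, Finset.sum_sub_distrib] at h1
    rw [← Finset.sum_mul, ← Finset.sum_mul, ← Finset.mul_sum, hcard, hsum'] at h1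
    rw [Finset.sum_filter, Finset.mul_sum]
    have h2 : ∀ k : Fin n, (c : ℚ) * (if n - r ≤ k.val then (1 : ℚ) else 0) * v k =
        c * if n - r ≤ k.val then v k else 0 := by
      intro k
      split_ifs <;> simp
    simp only [h2] at h1
    linarith

theorem eq_of_sum_eq_mul {r c : ℕ} (hr : r ≤ n) {y : Fin n → ℕ} (hy : ∀ k, y k ≤ c)
    (hsum : ∑ k, y k = c * r) (h0 : ∀ k : Fin n, k.val < n - r → y k = 0) (k : Fin n)
    (hk : n - r ≤ k.val) : y k = c := by
  have hcard : (Finset.univ.filter fun j : Fin n => n - r ≤ j.val).card = r := by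
    have h1 := Finset.card_filter_add_card_filter_not (s := (Finset.univ : Finset (Fin n)))
      (fun j => j.val < n - r)
    rw [Fin.card_filter_val_lt, Finset.card_univ, Fintype.card_fin,
      min_eq_right (Nat.sub_le n r)] at h1
    simp only [not_lt] at h1
    omega
  have h1 : ∑ j : Fin n with n - r ≤ j.val, y j = ∑ j : Fin n with n - r ≤ j.val, c := by
    rw [Finset.sum_const, hcard, smul_eq_mul, mul_comm, ← hsum]
    refine Finset.sum_subset (Finset.subset_univ _) fun j _ hj => h0 j ?_
    rw [Finset.mem_filter, not_and] at hj
    exact not_le.1 (hj (Finset.mem_univ _))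
  exact (Finset.sum_eq_sum_iff_of_le fun j _ => hy j).1 h1 k (by simpa using hk)

end Sums

/-! ### Necessity: the coordinate subobjects at the breaks of the Newton polygon -/

section Necessity

variable {p : ℕ} [Fact p.Prime] {L K : Type*} [Field L] [Algebra ℚ_[p] L]
  [Field K] [Algebra ℚ_[p] K] {n : ℕ} [FiniteDimensional ℚ_[p] L] [FiniteDimensional ℚ_[p] K]

theorem finrank_baseChange_submodule (W : Submodule (L₀ p L) (PhiSpace p L K n)) :
    Module.finrank L (W.baseChange L) = Module.finrank (L₀ p L) W := by
  have hinj : Function.Injective (W.subtype.baseChange L) :=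
    Module.Flat.lTensor_preserves_injective_linearMap W.subtype W.injective_subtype
  have : Module.Free (L₀ p L) W := Module.Free.of_divisionRing (L₀ p L) W
  have h := LinearMap.finrank_range_of_inj hinj
  rw [Module.finrank_baseChange] at h
  exact h

theorem finrank_of_evSpanD (hLK : Fintype.card (L →ₐ[ℚ_[p]] K) = Module.finrank ℚ_[p] L)
    {W : Submodule (L₀ p L) (PhiSpace p L K n)}
    (hWK : ∀ (k : K), ∀ x ∈ W, (1 ⊗ₜ[ℚ_[p]] k : CoeffRing p L K) • x ∈ W) {r : ℕ}
    (hr : ∀ σ : L →ₐ[ℚ_[p]] K, Module.finrank K (evSpanD (resL₀ σ) W) = r) :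
    Module.finrank (L₀ p L) W = r * Module.finrank ℚ_[p] K := by
  have h := finrank_mul_finrank_eq_sum_evSpan hLK (V := W.baseChange L)
    fun k => actK_mem_baseChange (hWK k)
  have h1 : ∀ σ : L →ₐ[ℚ_[p]] K, Module.finrank K (evSpan σ (W.baseChange L)) = r := fun σ => by
    rw [evSpan_baseChange, hr]
  simp only [h1, finrank_baseChange_submodule] at h
  rw [Finset.sum_const, Finset.card_univ, hLK, smul_eq_mul, mul_left_comm] at h
  rw [Nat.eq_of_mul_eq_mul_left Module.finrank_pos h, mul_comm]

variable (p L K) in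
/-- The subspace of `D` spanned over `L₀ ⊗ K` by the last `r` vectors of a permuted basis. -/
def coordSubspace (τ : Equiv.Perm (Fin n)) (r : ℕ) : Submodule (L₀ p L) (PhiSpace p L K n) where
  carrier := {x | ∀ k : Fin n, k.val < n - r → x (τ k) = 0}
  add_mem' {x y} hx hy k hk := by rw [Pi.add_apply, hx k hk, hy k hk, add_zero]
  zero_mem' _ _ := rfl
  smul_mem' c x hx k hk := by rw [Pi.smul_apply, hx k hk, smul_zero]

theorem smul_mem_coordSubspace (τ : Equiv.Perm (Fin n)) (r : ℕ) (k : K) (x : PhiSpace p L K n)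
    (hx : x ∈ coordSubspace p L K τ r) :
    (1 ⊗ₜ[ℚ_[p]] k : CoeffRing p L K) • x ∈ coordSubspace p L K τ r := fun j hj => by
  rw [Pi.smul_apply, hx j hj, smul_zero]

theorem finrank_evSpanD_coordSubspace (τ : Equiv.Perm (Fin n)) {r : ℕ} (hr : r ≤ n)
    (σ : L₀ p L →ₐ[ℚ_[p]] K) : Module.finrank K (evSpanD σ (coordSubspace p L K τ r)) = r := by
  classical
  let ι : Fin r → Fin n := fun i => τ ⟨n - r + i, by omega⟩
  have hι : Function.Injective ι := fun i j h => by
    have := congrArg Fin.val (τ.injective h)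
    simp only at this
    exact Fin.ext (by omega)
  let g : (Fin r → K) →ₗ[K] (Fin n → K) := Function.ExtendByZero.linearMap K ι
  have hg : ∀ y j, g y j = Function.extend ι y 0 j := fun _ _ => rfl
  have hinj : Function.Injective g := fun y z h => by
    ext i
    have := congrFun h (ι i)
    rwa [hg, hg, hι.extend_apply, hι.extend_apply] at this
  have hrange : evSpanD σ (coordSubspace p L K τ r) = LinearMap.range g := by
    ext y
    rw [mem_evSpanD (smul_mem_coordSubspace τ r)]
    constructor
    · rintro ⟨x, hx, rfl⟩
      refine ⟨fun i => evD n σ x (ι i), funext fun j => ?_⟩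
      obtain ⟨k, rfl⟩ := τ.surjective j
      by_cases hk : k.val < n - r
      · rw [evD_apply, hx k hk, map_zero, hg, Function.extend_apply']
        · rfl
        · rintro ⟨i, hi⟩
          have := congrArg Fin.val (τ.injective hi)
          simp only at this
          omega
      · have : τ k = ι ⟨k.val - (n - r), by omega⟩ := by
          congr 1
          exact Fin.ext (by simp only; omega)
        rw [this, hg, hι.extend_apply]
    · rintro ⟨y, rfl⟩
      refine ⟨fun j => 1 ⊗ₜ g y j, fun k hk => ?_, funext fun j => ?_⟩
      · change (1 : L₀ p L) ⊗ₜ[ℚ_[p]] g y (τ k) = 0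
        rw [hg, Function.extend_apply', Pi.zero_apply, TensorProduct.tmul_zero]
        rintro ⟨i, hi⟩
        have := congrArg Fin.val (τ.injective hi)
        simp only at this
        omega
      · rw [evD_apply, evTensor_tmul, map_one, one_mul]
  rw [hrange, LinearMap.finrank_range_of_inj hinj, Module.finrank_fin_fun]

variable {φ : Frobenius p L K n} {ζ : Fin n → Kˣ}
  (hss : IsSemisimplePart φ.linPowL₀ ((diagFrob p L ζ).restrictScalars (L₀ p L)))
include hss

/-- Since `φ` commutes with `F_ζ`, the `i`-th coordinate of the image is killed by `1 ⊗ (ζ_j⁻¹ -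
ζ_i⁻¹)`. This is a unit, although `L₀ ⊗ K` may have zero divisors. -/
theorem toFun_single_apply_eq_zero {i j : Fin n} (hij : ζ i ≠ ζ j) (c : CoeffRing p L K) :
    φ.toFun (Pi.single j c) i = 0 := by
  have h1 : diagFrob p L ζ (Pi.single j c) =
      ((1 : L₀ p L) ⊗ₜ[ℚ_[p]] ((ζ j)⁻¹ : K) : CoeffRing p L K) • Pi.single j c := by
    ext k
    rw [diagFrob_apply, Pi.smul_apply, smul_eq_mul]
    by_cases hk : k = j
    · rw [hk]
    · rw [Pi.single_eq_of_ne hk, mul_zero, mul_zero]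
  have h2 := toFun_diagFrob hss (Pi.single j c)
  rw [h1, φ.map_smul, map_one] at h2
  have h3 := congrFun h2 i
  rw [diagFrob_apply, Pi.smul_apply, smul_eq_mul, ← sub_eq_zero, ← sub_mul,
    ← TensorProduct.tmul_sub] at h3
  have hne : ((ζ j)⁻¹ : K) - ((ζ i)⁻¹ : K) ≠ 0 := by
    rw [sub_ne_zero]
    intro h
    exact hij (Units.ext (inv_injective h).symm)
  have h4 := congrArg ((1 ⊗ₜ[ℚ_[p]] (((ζ j)⁻¹ : K) - ((ζ i)⁻¹ : K))⁻¹ : CoeffRing p L K) * ·) h3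
  simpa only [← mul_assoc, Algebra.TensorProduct.tmul_mul_tmul, one_mul, inv_mul_cancel₀ hne,
    ← Algebra.TensorProduct.one_def, mul_zero] using h4

theorem toFun_mem_coordSubspace (τ : Equiv.Perm (Fin n)) (r : ℕ)
    (hbreak : ∀ k l : Fin n, k.val < n - r → n - r ≤ l.val → ζ (τ k) ≠ ζ (τ l)) :
    ∀ x ∈ coordSubspace p L K τ r, φ.toFun x ∈ coordSubspace p L K τ r := by
  classical
  intro x hx k hk
  have h : φ.toFun x = ∑ j, φ.toFun (Pi.single j (x j)) := by
    conv_lhs => rw [← Finset.univ_sum_single x]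
    exact map_sum φ.toLin _ _
  rw [h, Finset.sum_apply]
  refine Finset.sum_eq_zero fun j _ => ?_
  obtain ⟨l, rfl⟩ := τ.surjective j
  by_cases hl : l.val < n - r
  · rw [hx l hl, Pi.single_zero]
    exact congrFun (map_zero φ.toLin) _
  · exact toFun_single_apply_eq_zero hss (hbreak k l hk (not_lt.1 hl)) _

/-- The exponents of `exists_tN_eq_sum` vanish on the first `n - r` indices, are at most `f` and sum
to `f * r`. So the last `r` are all equal to `f`. -/
theorem tN_coordSubspace (hLK : Fintype.card (L →ₐ[ℚ_[p]] K) = Module.finrank ℚ_[p] L)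
    (τ : Equiv.Perm (Fin n)) {r : ℕ} (hr : r ≤ n)
    (hW : ∀ x ∈ coordSubspace p L K τ r, φ.toFun x ∈ coordSubspace p L K τ r) :
    (Module.finrank ℚ_[p] L : ℚ) * tN φ (coordSubspace p L K τ r) hW =
      Module.finrank ℚ_[p] K * -∑ k : Fin n with n - r ≤ k.val, valL p L K (ζ (τ k) : K) := by
  obtain ⟨y, htN, hsum, hle, h0⟩ := exists_tN_eq_sum hss τ hW (smul_mem_coordSubspace τ r)
  rw [finrank_of_evSpanD hLK (smul_mem_coordSubspace τ r)
    fun σ => finrank_evSpanD_coordSubspace τ hr _, ← mul_assoc] at hsum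
  have hsum' := Nat.eq_of_mul_eq_mul_right Module.finrank_pos hsum
  have hy0 : ∀ k : Fin n, k.val < n - r → y k = 0 := fun k hk => h0 k fun x hx => hx k hk
  have hy1 := eq_of_sum_eq_mul hr hle hsum' hy0
  have h1 : ∑ k, (y k : ℚ) * valL p L K (ζ (τ k) : K) =
      resDeg p L * ∑ k : Fin n with n - r ≤ k.val, valL p L K (ζ (τ k) : K) := by
    rw [Finset.sum_filter, Finset.mul_sum]
    refine Finset.sum_congr rfl fun k _ => ?_
    split_ifs with h
    · rw [hy1 k h]
    · rw [hy0 k (not_le.1 h), Nat.cast_zero, zero_mul, mul_zero]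
  rw [h1] at htN
  have h2 : (resDeg p L : ℚ) ≠ 0 := by exact_mod_cast resDeg_pos.ne'
  apply mul_left_cancel₀ h2
  linear_combination htN

theorem tN_top (hLK : Fintype.card (L →ₐ[ℚ_[p]] K) = Module.finrank ℚ_[p] L)
    (τ : Equiv.Perm (Fin n)) (hW : ∀ x ∈ (⊤ : Submodule (L₀ p L) (PhiSpace p L K n)),
      φ.toFun x ∈ (⊤ : Submodule (L₀ p L) (PhiSpace p L K n))) :
    (Module.finrank ℚ_[p] L : ℚ) * tN φ ⊤ hW =
      Module.finrank ℚ_[p] K * -∑ k, valL p L K (ζ (τ k) : K) := by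
  have htop : coordSubspace p L K τ n = ⊤ := by
    rw [eq_top_iff]
    intro x _ k hk
    omega
  have h := tN_coordSubspace (r := n) hss hLK τ le_rfl
    (by rw [htop]; exact fun _ _ => Submodule.mem_top)
  simp only [htop, Nat.sub_self, Nat.zero_le, Finset.filter_true] at h
  exact h

theorem sum_le_of_isAdmissible (hLK : Fintype.card (L →ₐ[ℚ_[p]] K) = Module.finrank ℚ_[p] L)
    {τ : Equiv.Perm (Fin n)} (hτ : Monotone fun j => valL p L K (ζ (τ j) : K))
    {w : (L →ₐ[ℚ_[p]] K) → Fin n → ℤ} (hw : ∀ σ, StrictMono (w σ))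
    {𝓕 : Filtration p L K n} (hadm : IsAdmissible φ 𝓕) (hJ : HasJumps 𝓕 w) :
    (∀ i ≤ n, ∑ j : Fin n with j.val < i, ∑ σ, (w σ j : ℚ) ≤
        -∑ j : Fin n with n - i ≤ j.val, valL p L K (ζ (τ j) : K)) ∧
      ∑ j, ∑ σ, (w σ j : ℚ) = -∑ j, valL p L K (ζ (τ j) : K) := by
  have hKpos : (0 : ℚ) < Module.finrank ℚ_[p] K := by
    exact_mod_cast Module.finrank_pos (R := ℚ_[p]) (M := K)
  have hLpos : (0 : ℚ) < Module.finrank ℚ_[p] L := by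
    exact_mod_cast Module.finrank_pos (R := ℚ_[p]) (M := L)
  have hne : (Finset.univ : Finset (L →ₐ[ℚ_[p]] K)).Nonempty := by
    rw [← Finset.card_pos, Finset.card_univ, hLK]
    exact Module.finrank_pos
  constructor
  · refine sum_le_neg_sum_of_breaks (f := fun j => ∑ σ, (w σ j : ℚ)) (fun j k hjk =>
      Finset.sum_lt_sum_of_nonempty hne fun σ _ => by exact_mod_cast hw σ hjk) hτ ?_
    intro r hr hbreak
    -- At a break the valuations on the two sides differ, hence so do the eigenvalues, and the
    -- coordinate subspace is a subobject.
    have hW := toFun_mem_coordSubspace hss τ r fun k l hk hl h =>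
      (hbreak k l hk hl).ne (by simp only [h])
    have h1 := sum_le_tH hLK hw hJ (V := (coordSubspace p L K τ r).baseChange L)
      (fun k => actK_mem_baseChange (smul_mem_coordSubspace τ r k)) hr
      (fun σ => by rw [evSpan_baseChange, finrank_evSpanD_coordSubspace τ hr])
    have h2 := hadm.2 _ hW
    have h3 := tN_coordSubspace hss hLK τ hr hW
    have h4 := mul_le_mul_of_nonneg_left h2 hLpos.le
    rw [h3] at h4
    have h5 : (Module.finrank ℚ_[p] K : ℚ) * ∑ σ : L →ₐ[ℚ_[p]] K,
      ∑ j : Fin n with j.val < r, (w σ j : ℚ) ≤ Module.finrank ℚ_[p] L *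
        𝓕.tH ((coordSubspace p L K τ r).baseChange L) := by exact_mod_cast h1
    rw [Finset.sum_comm] at h5
    exact le_of_mul_le_mul_left (h5.trans h4) hKpos
  · have h1 : (Module.finrank ℚ_[p] L : ℚ) * 𝓕.tH ⊤ = (Module.finrank ℚ_[p] K : ℚ) *
      ∑ σ : L →ₐ[ℚ_[p]] K, ∑ j : Fin n, (w σ j : ℚ) := by exact_mod_cast tH_top hLK hw hJ
    rw [hadm.1, tN_top hss hLK τ, Finset.sum_comm] at h1
    exact (mul_left_cancel₀ hKpos.ne' h1).symm

end Necessity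

/-! ## Reduction of admissibility to `K`-stable subobjects -/

section Reduction

variable {p : ℕ} [Fact p.Prime] {L K : Type*} [Field L] [Algebra ℚ_[p] L]
  [Field K] [Algebra ℚ_[p] K] {n : ℕ} [FiniteDimensional ℚ_[p] L] [FiniteDimensional ℚ_[p] K]

theorem baseChange_le_baseChange {A B : Submodule (L₀ p L) (PhiSpace p L K n)} (h : A ≤ B) :
    A.baseChange L ≤ B.baseChange L := by
  rw [baseChange_eq_span_image, baseChange_eq_span_image]
  exact Submodule.span_mono (Set.image_mono h)

theorem baseChange_sup (A B : Submodule (L₀ p L) (PhiSpace p L K n)) :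
    (A ⊔ B).baseChange L = A.baseChange L ⊔ B.baseChange L := by
  apply le_antisymm
  · rw [baseChange_eq_span_image, Submodule.span_le]
    rintro _ ⟨x, hx, rfl⟩
    obtain ⟨a, ha, b, hb, rfl⟩ := Submodule.mem_sup.1 hx
    change (1 : L) ⊗ₜ[L₀ p L] (a + b) ∈ A.baseChange L ⊔ B.baseChange L
    rw [TensorProduct.tmul_add]
    exact Submodule.add_mem_sup (Submodule.tmul_mem_baseChange_of_mem _ ha)
      (Submodule.tmul_mem_baseChange_of_mem _ hb)
  · exact sup_le (baseChange_le_baseChange le_sup_left) (baseChange_le_baseChange le_sup_right)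

theorem baseChange_inf (A B : Submodule (L₀ p L) (PhiSpace p L K n)) :
    (A ⊓ B).baseChange L = A.baseChange L ⊓ B.baseChange L := by
  refine Submodule.eq_of_le_of_finrank_le (le_inf (baseChange_le_baseChange inf_le_left)
    (baseChange_le_baseChange inf_le_right)) ?_
  have h1 := Submodule.finrank_sup_add_finrank_inf_eq A B
  have h2 := Submodule.finrank_sup_add_finrank_inf_eq (A.baseChange L) (B.baseChange L)
  rw [← baseChange_sup] at h2
  simp only [finrank_baseChange_submodule] at h2 ⊢
  omega

theorem baseChange_map_actKD (W : Submodule (L₀ p L) (PhiSpace p L K n)) (k : K) :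
    (W.map (actKD p L n k)).baseChange L = (W.baseChange L).map (actK p L n k) := by
  rw [baseChange_eq_span_image, baseChange_eq_span_image, Submodule.map_span]
  congr 1
  ext x
  constructor
  · rintro ⟨_, ⟨y, hy, rfl⟩, rfl⟩
    exact ⟨_, ⟨y, hy, rfl⟩, rfl⟩
  · rintro ⟨_, ⟨y, hy, rfl⟩, rfl⟩
    exact ⟨_, ⟨y, hy, rfl⟩, rfl⟩

/-- The inequality in the definition of admissibility only has to be checked on subobjects that
are stable under `K`. -/
theorem isAdmissible_of_forall_stable {φ : Frobenius p L K n} {𝓕 : Filtration p L K n}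
    (htop : (𝓕.tH ⊤ : ℚ) = tN φ ⊤ (fun _ _ => Submodule.mem_top))
    (h : ∀ (W : Submodule (L₀ p L) (PhiSpace p L K n)) (hW : ∀ x ∈ W, φ.toFun x ∈ W),
      (∀ (k : K), ∀ x ∈ W, (1 ⊗ₜ[ℚ_[p]] k : CoeffRing p L K) • x ∈ W) →
      (𝓕.tH (W.baseChange L) : ℚ) ≤ tN φ W hW) : IsAdmissible φ 𝓕 := by
  refine ⟨htop, ?_⟩
  by_contra! hbad
  let bad : Set (Submodule (L₀ p L) (PhiSpace p L K n)) :=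
    {W | ∃ hW : ∀ x ∈ W, φ.toFun x ∈ W, tN φ W hW < 𝓕.tH (W.baseChange L)}
  have hne : bad.Nonempty := hbad
  -- A violating subobject `W` of least dimension. Below, `U` is a maximal violating subobject of
  -- the `K`-span `hull` of `W`; it is shown to be all of `hull`, which is `K`-stable.
  obtain ⟨W, ⟨hW, hlt⟩, hmin⟩ :=
    (measure fun W : Submodule (L₀ p L) (PhiSpace p L K n) => Module.finrank (L₀ p L) W).wf.has_min
      bad hne
  have hsmall : ∀ V : Submodule (L₀ p L) (PhiSpace p L K n), ∀ hV : ∀ x ∈ V, φ.toFun x ∈ V,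
      Module.finrank (L₀ p L) V < Module.finrank (L₀ p L) W →
      (𝓕.tH (V.baseChange L) : ℚ) ≤ tN φ V hV := by
    intro V hV hVW
    by_contra! hVbad
    exact hmin V ⟨hV, hVbad⟩ hVW
  let hull : Submodule (L₀ p L) (PhiSpace p L K n) := ⨆ k : K, W.map (actKD p L n k)
  have hone : W.map (actKD p L n (1 : K)) = W := by
    have : actKD p L n (1 : K) = LinearMap.id := LinearMap.ext fun x => by
      rw [actKD_apply, ← Algebra.TensorProduct.one_def, one_smul]
      rfl
    rw [this, Submodule.map_id]
  obtain ⟨U, ⟨⟨hU, hUlt⟩, hUle⟩, hmax⟩ :=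
    (wellFounded_gt (α := Submodule (L₀ p L) (PhiSpace p L K n))).has_min
      {U | U ∈ bad ∧ U ≤ hull} ⟨W, ⟨hW, hlt⟩, by
        conv_lhs => rw [← hone]
        exact le_iSup (fun k : K => W.map (actKD p L n k)) 1⟩
  have hkU : ∀ k : K, W.map (actKD p L n k) ≤ U := by
    intro k
    by_cases hk : k = 0
    · rintro _ ⟨x, -, rfl⟩
      rw [hk, actKD_apply, TensorProduct.tmul_zero, zero_smul]
      exact U.zero_mem
    by_contra hnot
    set V := W.map (actKD p L n k) with hVdef
    have hV : ∀ x ∈ V, φ.toFun x ∈ V := toFun_mem_map_actKD φ hW k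
    have hs : ∀ x ∈ U ⊔ V, φ.toFun x ∈ U ⊔ V := by
      intro x hx
      obtain ⟨a, ha, b, hb, rfl⟩ := Submodule.mem_sup.1 hx
      rw [φ.map_add]
      exact Submodule.add_mem_sup (hU a ha) (hV b hb)
    have hi : ∀ x ∈ U ⊓ V, φ.toFun x ∈ U ⊓ V := fun x hx => ⟨hU x hx.1, hV x hx.2⟩
    -- The intersection is strictly smaller than `V`, which has the dimension of `W`, so it does not
    -- violate the inequality.
    have h1 : (𝓕.tH ((U ⊓ V).baseChange L) : ℚ) ≤ tN φ (U ⊓ V) hi := by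
      refine hsmall _ hi ?_
      rw [(Submodule.equivMapOfInjective _ (actKD_injective hk) W).finrank_eq, ← hVdef]
      refine Submodule.finrank_lt_finrank_of_lt (lt_of_le_of_ne inf_le_right fun heq => hnot ?_)
      exact inf_eq_right.1 heq
    have h2 : (𝓕.tH (U.baseChange L) : ℚ) + 𝓕.tH (V.baseChange L) ≤
        𝓕.tH ((U ⊔ V).baseChange L) + 𝓕.tH ((U ⊓ V).baseChange L) := by
      rw [baseChange_sup, baseChange_inf]
      exact_mod_cast 𝓕.tH_add_tH_le (U.baseChange L) (V.baseChange L)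
    have h3 := tN_sup_add_tN_inf φ hU hV hs hi
    have h4 : 𝓕.tH (V.baseChange L) = 𝓕.tH (W.baseChange L) := by
      rw [hVdef, baseChange_map_actKD, 𝓕.tH_map_actK _ hk]
    have h5 : tN φ V hV = tN φ W hW := tN_map_actKD φ hW hk
    rw [h4] at h2
    rw [h5] at h3
    -- Both `U` and `V` violate the inequality and `U ⊓ V` does not. As `t_H` is supermodular and
    -- `t_N` modular, `U ⊔ V` violates it too, against the maximality of `U`.
    refine hmax (U ⊔ V) ⟨⟨hs, by linarith⟩,
      sup_le hUle (le_iSup (fun k : K => W.map (actKD p L n k)) k)⟩ ?_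
    exact left_lt_sup.2 hnot
  have hUeq : U = hull := le_antisymm hUle (iSup_le hkU)
  refine absurd (h U hU fun k x hx => ?_) (not_le.2 hUlt)
  have hstab : hull.map (actKD p L n k) ≤ hull := by
    rw [Submodule.map_iSup]
    refine iSup_le fun l => ?_
    rw [← Submodule.map_comp]
    have : actKD p L n k ∘ₗ actKD p L n l = actKD p L n (k * l) := LinearMap.ext fun x => by
      rw [LinearMap.comp_apply, actKD_apply, actKD_apply, actKD_apply, smul_smul,
        Algebra.TensorProduct.tmul_mul_tmul, one_mul]
    rw [this]
    exact le_iSup (fun k : K => W.map (actKD p L n k)) (k * l)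
  rw [hUeq] at hx ⊢
  exact hstab ⟨x, hx, rfl⟩

end Reduction

/-! ## The embeddings of `L₀` -/

section EmbeddingsL₀

variable {p : ℕ} [Fact p.Prime] {L K : Type*} [Field L] [Algebra ℚ_[p] L]
  [Field K] [Algebra ℚ_[p] K] {n : ℕ} [FiniteDimensional ℚ_[p] L] [FiniteDimensional ℚ_[p] K]

/-- The embedding `σ ∘ φ₀ ^ m` of `L₀`. -/
def compFrob (σ : L₀ p L →ₐ[ℚ_[p]] K) (m : ℕ) : L₀ p L →ₐ[ℚ_[p]] K :=
  σ.comp (absFrob p L ^ m : L₀ p L ≃ₐ[ℚ_[p]] L₀ p L).toAlgHom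

theorem compFrob_apply (σ : L₀ p L →ₐ[ℚ_[p]] K) (m : ℕ) (l : L₀ p L) :
    compFrob σ m l = σ ((absFrob p L ^ m) l) := rfl

theorem compFrob_one_apply (σ : L₀ p L →ₐ[ℚ_[p]] K) (l : L₀ p L) :
    compFrob σ 1 l = σ (absFrob p L l) := by
  rw [compFrob_apply, pow_one]

theorem compFrob_succ (σ : L₀ p L →ₐ[ℚ_[p]] K) (m : ℕ) :
    compFrob σ (m + 1) = compFrob (compFrob σ m) 1 := by
  ext l
  rw [compFrob_one_apply, compFrob_apply, compFrob_apply, pow_succ]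
  rfl

theorem compFrob_resDeg (σ : L₀ p L →ₐ[ℚ_[p]] K) : compFrob σ (resDeg p L) = σ := by
  ext l
  rw [compFrob_apply, absFrob_pow_resDeg]
  rfl

/-- The `f` powers of `φ₀` are distinct and there are at most `f` embeddings, so `φ₀` permutes the
embeddings in a single cycle. -/
theorem bijective_compFrob (σ : L₀ p L →ₐ[ℚ_[p]] K) :
    Function.Bijective fun i : Fin (resDeg p L) => compFrob σ i := by
  refine Function.Injective.bijective_of_nat_card_le (fun i j h => ?_) ?_
  · have h1 : absFrob p L ^ (i : ℕ) = absFrob p L ^ (j : ℕ) :=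
      AlgEquiv.ext fun l => σ.injective (AlgHom.congr_fun h l)
    have hi : (i : ℕ) < orderOf (absFrob p L) := (orderOf_absFrob p L).symm ▸ i.2
    have hj : (j : ℕ) < orderOf (absFrob p L) := (orderOf_absFrob p L).symm ▸ j.2
    exact Fin.ext (pow_injOn_Iio_orderOf hi hj h1)
  · rw [Nat.card_eq_fintype_card (α := Fin _), Fintype.card_fin]
    exact card_algHom_le_finrank ℚ_[p] (L₀ p L) K

theorem card_algHom_L₀ (σ : L₀ p L →ₐ[ℚ_[p]] K) :
    Nat.card (L₀ p L →ₐ[ℚ_[p]] K) = Module.finrank ℚ_[p] (L₀ p L) := by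
  rw [← Nat.card_eq_of_bijective _ (bijective_compFrob σ), Nat.card_eq_fintype_card,
    Fintype.card_fin]
  rfl

theorem bijective_evD (σ : L₀ p L →ₐ[ℚ_[p]] K) :
    Function.Bijective fun (x : PhiSpace p L K n) (τ : L₀ p L →ₐ[ℚ_[p]] K) => evD n τ x := by
  have h := bijective_evTensor (K := K) (card_algHom_L₀ σ)
  refine ⟨fun x y hxy => funext fun j => h.1 (funext fun τ => ?_), fun y => ?_⟩
  · exact congrFun (congrFun hxy τ) j
  · choose x hx using fun j => h.2 fun τ => y τ j
    exact ⟨x, funext fun τ => funext fun j => congrFun (hx j) τ⟩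

theorem ext_evD (σ : L₀ p L →ₐ[ℚ_[p]] K) {x y : PhiSpace p L K n}
    (h : ∀ τ : L₀ p L →ₐ[ℚ_[p]] K, evD n τ x = evD n τ y) : x = y :=
  (bijective_evD σ).1 (funext h)

theorem bijective_compFrob_one :
    Function.Bijective fun σ : L₀ p L →ₐ[ℚ_[p]] K => compFrob σ 1 := by
  refine Finite.injective_iff_bijective.1 fun σ τ h => AlgHom.ext fun l => ?_
  have h1 := AlgHom.congr_fun h ((absFrob p L).symm l)
  simpa only [compFrob_one_apply, AlgEquiv.apply_symm_apply] using h1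

theorem sum_ite_compFrob (σ σ₀ : L₀ p L →ₐ[ℚ_[p]] K) [DecidableEq (L₀ p L →ₐ[ℚ_[p]] K)] :
    ∑ i ∈ Finset.range (resDeg p L), (if compFrob σ i = σ₀ then 1 else 0) = 1 := by
  obtain ⟨i, hi⟩ := (bijective_compFrob σ).2 σ₀
  rw [Finset.sum_range, Finset.sum_eq_single i]
  · exact if_pos hi
  · intro j _ hj
    exact if_neg fun h => hj ((bijective_compFrob σ).1 (h.trans hi.symm))
  · exact fun h => absurd (Finset.mem_univ i) h

end EmbeddingsL₀

/-! ## Frobenius maps with a prescribed `f`-th power -/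

section CyclicFrobenius

open Matrix

variable {p : ℕ} [Fact p.Prime] {L K : Type*} [Field L] [Algebra ℚ_[p] L]
  [Field K] [Algebra ℚ_[p] K] {n : ℕ} [FiniteDimensional ℚ_[p] L] [FiniteDimensional ℚ_[p] K]
  (σ₀ : L₀ p L →ₐ[ℚ_[p]] K) (G : (Fin n → K) ≃ₗ[K] (Fin n → K))

/-- The component at `σ` of the Frobenius `twistFrob`. -/
def twistAt (σ : L₀ p L →ₐ[ℚ_[p]] K) : (Fin n → K) ≃ₗ[K] (Fin n → K) := by
  classical exact if σ = σ₀ then G else LinearEquiv.refl K _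

/-- The identification `D ≃ ∏_σ K ^ n`. -/
def evDEquiv : PhiSpace p L K n ≃ ((L₀ p L →ₐ[ℚ_[p]] K) → Fin n → K) :=
  Equiv.ofBijective _ (bijective_evD σ₀)

/-- The Frobenius on `D ≃ ∏_σ K ^ n` that permutes the factors, and is given by `G` into the
factor at `σ₀` and by the identity into the other factors. -/
def twistFrob : Frobenius p L K n where
  toFun x := (evDEquiv σ₀).symm fun σ => twistAt σ₀ G σ (evD n (compFrob σ 1) x)
  map_add x y := ext_evD σ₀ fun σ => by
    have h : ∀ z, evD n σ ((evDEquiv σ₀).symm z) = z σ := fun z =>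
      congrFun ((evDEquiv σ₀).apply_symm_apply z) σ
    rw [map_add, h, h, h, map_add, map_add]
  map_smul l k x := ext_evD σ₀ fun σ => by
    have h : ∀ z, evD n σ ((evDEquiv σ₀).symm z) = z σ := fun z =>
      congrFun ((evDEquiv σ₀).apply_symm_apply z) σ
    rw [evD_smul, h, h, evD_smul, evTensor_tmul, evTensor_tmul, compFrob_one_apply, LinearEquiv.map_smul]
  bijective := by
    refine (evDEquiv σ₀).symm.bijective.comp ?_
    have h1 := (Equiv.arrowCongr (Equiv.ofBijective _ (bijective_compFrob_one (p := p) (L := L)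
      (K := K))).symm (Equiv.refl (Fin n → K))).bijective
    have h2 := (Equiv.piCongrRight fun σ : L₀ p L →ₐ[ℚ_[p]] K =>
      (twistAt σ₀ G σ).toEquiv).bijective
    exact (h2.comp h1).comp (evDEquiv σ₀).bijective

theorem evD_twistFrob (σ : L₀ p L →ₐ[ℚ_[p]] K) (x : PhiSpace p L K n) :
    evD n σ ((twistFrob σ₀ G).toFun x) = twistAt σ₀ G σ (evD n (compFrob σ 1) x) :=
  congrFun ((evDEquiv σ₀).apply_symm_apply _) σ

/-- Each application moves one step along the cycle of embeddings and picks up a factor `G` exactly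
when it enters the factor at `σ₀`. A full turn meets `σ₀` once, so the `f`-th power is `G` at every
embedding. -/
theorem evD_twistFrob_iterate [DecidableEq (L₀ p L →ₐ[ℚ_[p]] K)] (σ : L₀ p L →ₐ[ℚ_[p]] K) (m : ℕ)
    (x : PhiSpace p L K n) :
    evD n σ ((twistFrob σ₀ G).toFun^[m] x) =
      ((G : Module.End K (Fin n → K)) ^
        ∑ i ∈ Finset.range m, (if compFrob σ i = σ₀ then 1 else 0)) (evD n (compFrob σ m) x) := by
  induction m generalizing x with
  | zero => rfl
  | succ m ih =>
    rw [Function.iterate_succ_apply, ih, evD_twistFrob, ← compFrob_succ, Finset.sum_range_succ,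
      pow_add, Module.End.mul_apply, twistAt]
    congr 1
    split_ifs
    · rw [pow_one]
      rfl
    · rfl

theorem evD_linPowL₀_twistFrob (σ : L₀ p L →ₐ[ℚ_[p]] K) (x : PhiSpace p L K n) :
    evD n σ ((twistFrob σ₀ G).linPowL₀ x) = G (evD n σ x) := by
  classical
  rw [Frobenius.linPowL₀_apply, evD_twistFrob_iterate, sum_ite_compFrob, pow_one, compFrob_resDeg]
  rfl

theorem evD_diagFrob (ζ : Fin n → Kˣ) (σ : L₀ p L →ₐ[ℚ_[p]] K) (x : PhiSpace p L K n) :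
    evD n σ (diagFrob p L ζ x) = Matrix.diagonal (fun j => ((ζ j)⁻¹ : K)) *ᵥ evD n σ x := by
  ext j
  rw [evD_apply, diagFrob_apply, map_mul, evTensor_tmul, map_one, one_mul, Matrix.mulVec_diagonal]
  rfl

theorem isSemisimplePart_twistFrob (ζ : Fin n → Kˣ)
    (hG : ∀ y, G y = cyclicMatrix (fun j => ((ζ j)⁻¹ : K)) *ᵥ y) :
    IsSemisimplePart (twistFrob σ₀ G).linPowL₀ ((diagFrob p L ζ).restrictScalars (L₀ p L)) := by
  set a : Fin n → K := fun j => ((ζ j)⁻¹ : K) with ha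
  refine ⟨isSemisimple_of_diagonal (diagFrob_apply ζ), ?_, ?_⟩
  · obtain ⟨m, hm⟩ := isNilpotent_nilpPart a
    have key : ∀ (m : ℕ) (σ : L₀ p L →ₐ[ℚ_[p]] K) (x : PhiSpace p L K n), evD n σ
        ((((twistFrob σ₀ G).linPowL₀ - (diagFrob p L ζ).restrictScalars (L₀ p L) :
          Module.End (L₀ p L) (PhiSpace p L K n)) ^ m) x) = (nilpPart a ^ m) *ᵥ evD n σ x := by
      intro m σ x
      induction m generalizing x with
      | zero => rw [pow_zero, pow_zero, Module.End.one_apply, Matrix.one_mulVec]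
      | succ m ih =>
        rw [pow_succ, pow_succ, Module.End.mul_apply, ih, ← Matrix.mulVec_mulVec,
          LinearMap.sub_apply, map_sub, evD_linPowL₀_twistFrob, LinearMap.restrictScalars_apply,
          evD_diagFrob, hG, ← ha, cyclicMatrix, Matrix.add_mulVec, add_sub_cancel_left]
    refine ⟨m, LinearMap.ext fun x => ext_evD σ₀ fun σ => ?_⟩
    rw [key, hm, Matrix.zero_mulVec, LinearMap.zero_apply, map_zero]
  · refine LinearMap.ext fun x => ext_evD σ₀ fun σ => ?_
    have hc : Commute (Matrix.diagonal a) (cyclicMatrix a) :=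
      (Commute.refl _).add_right (commute_diagonal_nilpPart a)
    rw [Module.End.mul_apply, Module.End.mul_apply, LinearMap.restrictScalars_apply,
      LinearMap.restrictScalars_apply, evD_diagFrob, evD_linPowL₀_twistFrob, evD_linPowL₀_twistFrob,
      evD_diagFrob, hG, hG, Matrix.mulVec_mulVec, Matrix.mulVec_mulVec, hc.eq]

variable {W : Submodule (L₀ p L) (PhiSpace p L K n)}
  (hWK : ∀ (k : K), ∀ x ∈ W, (1 ⊗ₜ[ℚ_[p]] k : CoeffRing p L K) • x ∈ W)
include hWK

theorem apply_mem_evSpanD (hW : ∀ x ∈ W, (twistFrob σ₀ G).toFun x ∈ W)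
    (σ : L₀ p L →ₐ[ℚ_[p]] K) {y : Fin n → K} (hy : y ∈ evSpanD σ W) : G y ∈ evSpanD σ W := by
  obtain ⟨x, hx, rfl⟩ := (mem_evSpanD hWK).1 hy
  rw [← evD_linPowL₀_twistFrob σ₀]
  exact (mem_evSpanD hWK).2 ⟨_, (twistFrob σ₀ G).linPowL₀_mem hW x hx, rfl⟩

/-- The Frobenius carries the component at `σ ∘ φ₀` injectively into the one at `σ`. Dimensions can
only grow in this direction along the cycle, so they are constant. -/
theorem finrank_evSpanD_eq (hW : ∀ x ∈ W, (twistFrob σ₀ G).toFun x ∈ W)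
    (σ τ : L₀ p L →ₐ[ℚ_[p]] K) :
    Module.finrank K (evSpanD σ W) = Module.finrank K (evSpanD τ W) := by
  have h1 : ∀ σ : L₀ p L →ₐ[ℚ_[p]] K,
      Module.finrank K (evSpanD (compFrob σ 1) W) ≤ Module.finrank K (evSpanD σ W) := by
    intro σ
    rw [((twistAt σ₀ G σ).submoduleMap (evSpanD (compFrob σ 1) W)).finrank_eq]
    refine Submodule.finrank_mono ?_
    rintro _ ⟨y, hy, rfl⟩
    obtain ⟨x, hx, rfl⟩ := (mem_evSpanD hWK).1 hy
    exact (mem_evSpanD hWK).2 ⟨_, hW x hx, evD_twistFrob σ₀ G σ x⟩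
  have h2 : ∀ (σ : L₀ p L →ₐ[ℚ_[p]] K) (m : ℕ),
      Module.finrank K (evSpanD (compFrob σ m) W) ≤ Module.finrank K (evSpanD σ W) := by
    intro σ m
    induction m with
    | zero => exact le_rfl
    | succ m ih =>
      rw [compFrob_succ]
      exact (h1 _).trans ih
  have h3 : ∀ σ τ : L₀ p L →ₐ[ℚ_[p]] K,
      Module.finrank K (evSpanD τ W) ≤ Module.finrank K (evSpanD σ W) := by
    intro σ τ
    obtain ⟨i, rfl⟩ := (bijective_compFrob σ).2 τ
    exact h2 σ i
  exact le_antisymm (h3 τ σ) (h3 σ τ)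

end CyclicFrobenius

/-! ## Filtrations given by flags -/

section Flags

variable {p : ℕ} [Fact p.Prime] {L K : Type*} [Field L] [Algebra ℚ_[p] L]
  [Field K] [Algebra ℚ_[p] K] {n : ℕ} [FiniteDimensional ℚ_[p] L] [FiniteDimensional ℚ_[p] K]
  (hLK : Fintype.card (L →ₐ[ℚ_[p]] K) = Module.finrank ℚ_[p] L)
  (U : (L →ₐ[ℚ_[p]] K) → ℤ → Submodule K (Fin n → K))

/-- The filtration of `D_L ≃ ∏_σ K ^ n` whose components are given filtrations of `K ^ n`. -/
def Filtration.ofFlags (hU : ∀ σ, Antitone (U σ)) (htop : ∃ a, ∀ σ, U σ a = ⊤)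
    (hbot : ∃ b, ∀ σ, U σ b = ⊥) : Filtration p L K n where
  Fil i :=
    { carrier := {x | ∀ σ : L →ₐ[ℚ_[p]] K, ev n σ x ∈ U σ i}
      add_mem' := fun {x y} hx hy σ => by
        rw [map_add]
        exact (U σ i).add_mem (hx σ) (hy σ)
      zero_mem' := fun σ => by
        rw [map_zero]
        exact (U σ i).zero_mem
      smul_mem' := fun l x hx σ => by
        rw [ev_smul]
        exact (U σ i).smul_mem _ (hx σ) }
  actK_mem i k x hx σ := by
    rw [ev_actK]
    exact (U σ i).smul_mem k (hx σ)
  antitone _ _ h x hx σ := hU σ h (hx σ)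
  exhaustive := by
    obtain ⟨a, ha⟩ := htop
    rw [eq_top_iff]
    refine fun x _ => Submodule.mem_iSup_of_mem a fun σ => ?_
    rw [ha σ]
    exact Submodule.mem_top
  separated := by
    obtain ⟨b, hb⟩ := hbot
    rw [eq_bot_iff]
    refine (iInf_le _ b).trans fun x hx => (Submodule.mem_bot L).2 (ext_ev hLK fun σ => ?_)
    have h := hx σ
    rw [hb σ, Submodule.mem_bot] at h
    rw [h, map_zero]

theorem evSpan_ofFlags (hU : ∀ σ, Antitone (U σ)) (htop : ∃ a, ∀ σ, U σ a = ⊤)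
    (hbot : ∃ b, ∀ σ, U σ b = ⊥) (σ : L →ₐ[ℚ_[p]] K) (i : ℤ) :
    evSpan σ ((Filtration.ofFlags hLK U hU htop hbot).Fil i) = U σ i := by
  classical
  apply le_antisymm
  · rw [evSpan, Submodule.span_le]
    rintro _ ⟨x, hx, rfl⟩
    exact hx σ
  · intro y hy
    obtain ⟨x, hx⟩ := surjective_ev (p := p) (L := L) (K := K) (n := n) (Pi.single σ y)
    have hx' : ∀ ρ, ev n ρ x = Pi.single (M := fun _ => Fin n → K) σ y ρ := fun ρ => congrFun hx ρ
    refine Submodule.subset_span ⟨x, fun ρ => ?_, by rw [hx', Pi.single_eq_same]⟩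
    rw [hx']
    by_cases h : ρ = σ
    · subst h
      rwa [Pi.single_eq_same]
    · rw [Pi.single_eq_of_ne h]
      exact Submodule.zero_mem _

end Flags

/-! ## Existence of admissible filtrations -/

section Sufficiency

variable {p : ℕ} [Fact p.Prime] {L K : Type*} [Field L] [Algebra ℚ_[p] L]
  [Field K] [Algebra ℚ_[p] K] {n : ℕ} [FiniteDimensional ℚ_[p] L] [FiniteDimensional ℚ_[p] K]

theorem isUnit_cyclicMatrix {F : Type*} [Field F] {a : Fin n → F} (ha : ∀ j, a j ≠ 0) :
    IsUnit (cyclicMatrix a) := by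
  refine (isNilpotent_nilpPart a).isUnit_add_left_of_commute ?_ (commute_diagonal_nilpPart a).symm
  rw [Matrix.isUnit_iff_isUnit_det, Matrix.det_diagonal]
  exact (Finset.prod_ne_zero_iff.2 fun j _ => ha j).isUnit

/-- The automorphism of `F ^ n` defined by `cyclicMatrix a`. -/
def cyclicEquiv {F : Type*} [Field F] (a : Fin n → F) (ha : ∀ j, a j ≠ 0) :
    (Fin n → F) ≃ₗ[F] (Fin n → F) :=
  LinearEquiv.ofInjectiveEndo (Matrix.mulVecLin (cyclicMatrix a))
    (Matrix.mulVec_injective_of_isUnit (isUnit_cyclicMatrix ha))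

/-- One cyclic flag is used at all embeddings. At each of them `φ ^ f` is the same matrix, so a
subobject has stable components there and the flag is in general position to each of them. -/
theorem exists_isAdmissible (hLK : Fintype.card (L →ₐ[ℚ_[p]] K) = Module.finrank ℚ_[p] L)
    {ζ : Fin n → Kˣ} {τ : Equiv.Perm (Fin n)}
    (hτ : Monotone fun j => valL p L K (ζ (τ j) : K))
    {w : (L →ₐ[ℚ_[p]] K) → Fin n → ℤ} (hw : ∀ σ, StrictMono (w σ))
    (hle : ∀ i ≤ n, ∑ j : Fin n with j.val < i, ∑ σ, (w σ j : ℚ) ≤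
      -∑ j : Fin n with n - i ≤ j.val, valL p L K (ζ (τ j) : K))
    (heq : ∑ j, ∑ σ, (w σ j : ℚ) = -∑ j, valL p L K (ζ (τ j) : K)) :
    ∃ (φ : Frobenius p L K n) (𝓕 : Filtration p L K n),
      IsSemisimplePart φ.linPowL₀ ((diagFrob p L ζ).restrictScalars (L₀ p L)) ∧
      IsAdmissible φ 𝓕 ∧ HasJumps 𝓕 w := by
  have hLpos : 0 < Module.finrank ℚ_[p] L := Module.finrank_pos
  have hKpos : 0 < Module.finrank ℚ_[p] K := Module.finrank_pos
  obtain ⟨σ₁⟩ : Nonempty (L →ₐ[ℚ_[p]] K) := Fintype.card_pos_iff.1 (hLK ▸ hLpos)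
  let a : Fin n → K := fun j => ((ζ j)⁻¹ : K)
  have ha : ∀ j, a j ≠ 0 := fun j => inv_ne_zero (ζ j).ne_zero
  let g : Module.End K (Fin n → K) := Matrix.mulVecLin (cyclicMatrix a)
  have hcyc : Submodule.span K (Set.range fun i : ℕ => (g ^ i) 1) = ⊤ := span_pow_cyclicMatrix a
  let φ : Frobenius p L K n := twistFrob (resL₀ σ₁) (cyclicEquiv a ha)
  have hss : IsSemisimplePart φ.linPowL₀ ((diagFrob p L ζ).restrictScalars (L₀ p L)) :=
    isSemisimplePart_twistFrob _ _ ζ fun y => rfl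
  have hrank : ∀ m ≤ n, Module.finrank K (krylov g 1 m) = m := fun m hm =>
    finrank_krylov hcyc (by rwa [Module.finrank_fin_fun])
  obtain ⟨A, hA⟩ := (Set.finite_range fun q : (L →ₐ[ℚ_[p]] K) × Fin n => w q.1 q.2).bddBelow
  obtain ⟨B, hB⟩ := (Set.finite_range fun q : (L →ₐ[ℚ_[p]] K) × Fin n => w q.1 q.2).bddAbove
  let 𝓕 : Filtration p L K n := Filtration.ofFlags hLK
    (fun σ i => krylov g 1 (countGE (w σ) i))
    (fun σ _ _ h => krylov_mono g 1 (countGE_antitone (w σ) h))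
    ⟨A, fun σ => by
      rw [countGE_eq_card fun j => hA ⟨(σ, j), rfl⟩]
      apply Submodule.eq_top_of_finrank_eq
      rw [hrank n le_rfl, Module.finrank_fin_fun]⟩
    -- The step at `B` itself may still be nonzero, when `B` is a weight.
    ⟨B + 1, fun σ => by
      rw [countGE_eq_zero fun j => Int.lt_add_one_iff.2 (hB ⟨(σ, j), rfl⟩), krylov_zero]⟩
  have hspan : ∀ σ i, evSpan σ (𝓕.Fil i) = krylov g 1 (countGE (w σ) i) :=
    evSpan_ofFlags hLK _ _ _ _
  have hJ : HasJumps 𝓕 w := (hasJumps_iff hLK (fun σ => (hw σ).injective) 𝓕).2 fun σ i => by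
    rw [hspan, hrank _ (countGE_le _ _)]
  refine ⟨φ, 𝓕, hss, isAdmissible_of_forall_stable ?_ ?_, hJ⟩
  · have h1 : (Module.finrank ℚ_[p] L : ℚ) * 𝓕.tH ⊤ =
        Module.finrank ℚ_[p] K * ∑ σ, ∑ j, (w σ j : ℚ) := by
      exact_mod_cast tH_top hLK hw hJ
    have h2 := tN_top hss hLK τ fun _ _ => Submodule.mem_top
    rw [Finset.sum_comm, heq, ← h2] at h1
    exact mul_left_cancel₀ (by exact_mod_cast hLpos.ne') h1
  · intro W hW hWK
    set r := Module.finrank K (evSpanD (resL₀ σ₁) W) with hr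
    have hrW : ∀ σ : L₀ p L →ₐ[ℚ_[p]] K, Module.finrank K (evSpanD σ W) = r := fun σ =>
      finrank_evSpanD_eq _ _ hWK hW σ _
    have hrn : r ≤ n := (Submodule.finrank_le _).trans_eq (Module.finrank_fin_fun K)
    have h1 : (Module.finrank ℚ_[p] L : ℚ) * 𝓕.tH (W.baseChange L) =
        Module.finrank ℚ_[p] K * ∑ σ, ∑ j : Fin n with j.val < r, (w σ j : ℚ) := by
      exact_mod_cast tH_eq_sum hLK hw hJ (fun k => actK_mem_baseChange (hWK k)) hrn
        (fun σ => by rw [evSpan_baseChange, hrW]) fun σ i => by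
          rw [hspan, evSpan_baseChange]
          refine (finrank_krylov_inf_le hcyc (fun x hx => ?_) _).trans_eq ?_
          · exact apply_mem_evSpanD _ (cyclicEquiv a ha) hWK hW _ hx
          · rw [hrW, Module.finrank_fin_fun]
    obtain ⟨y, htN, hsum, hy, -⟩ := exists_tN_eq_sum hss τ hW hWK
    rw [finrank_of_evSpanD hLK hWK fun σ => hrW _, ← mul_assoc] at hsum
    have hsum' := Nat.eq_of_mul_eq_mul_right hKpos hsum
    -- This bounds `t_N` below by the `r` largest valuations; `h1` computes `t_H` from the `r`
    -- smallest weights, and `hle r` compares the two.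
    have h2 := sum_mul_le_of_sum_eq hτ hrn hy hsum'
    have h3 := hle r hrn
    rw [Finset.sum_comm] at h1
    have hL' : (0 : ℚ) < Module.finrank ℚ_[p] L := by exact_mod_cast hLpos
    have hK' : (0 : ℚ) < Module.finrank ℚ_[p] K := by exact_mod_cast hKpos
    have hf' : (0 : ℚ) < resDeg p L := by exact_mod_cast resDeg_pos (p := p) (L := L)
    refine le_of_mul_le_mul_left ?_ (mul_pos hL' hf')
    rw [htN, mul_right_comm, h1, ← mul_neg, mul_assoc]
    refine mul_le_mul_of_nonneg_left ?_ hK'.le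
    rw [mul_comm]
    refine (mul_le_mul_of_nonneg_left h3 hf'.le).trans ?_
    rw [mul_neg]
    exact neg_le_neg h2

end Sufficiency

/-! ## Polygons of partial sums -/

section Polygons

variable {n : ℕ}

theorem polygon_natCast (y : Fin n → ℚ) (m : ℕ) : polygon y m = vertex y m := by
  rw [polygon, Nat.floor_natCast, sub_self, zero_mul, add_zero]

/-- Between consecutive integers, a value of a polygon is a convex combination of the two
neighbouring ordinates, with the same weights for both polygons. -/
theorem polygon_le_polygon_iff {y z : Fin n → ℚ} :
    (∀ x ∈ Set.Icc (0 : ℝ) n, polygon y x ≤ polygon z x) ↔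
      ∀ m ≤ n, vertex y m ≤ vertex z m := by
  constructor
  · intro h m hm
    have h1 := h m ⟨Nat.cast_nonneg m, Nat.cast_le.2 hm⟩
    rw [polygon_natCast, polygon_natCast] at h1
    exact_mod_cast h1
  · intro h x hx
    -- At `x = n` the formula involves the default value of `vertex` at `n + 1`, with coefficient
    -- zero, so this point is treated apart.
    rcases hx.2.eq_or_lt with rfl | hlt
    · rw [polygon_natCast, polygon_natCast]
      exact_mod_cast h n le_rfl
    · have hfl : ⌊x⌋₊ < n := (Nat.floor_lt hx.1).2 hlt
      have h1 : (vertex y ⌊x⌋₊ : ℝ) ≤ vertex z ⌊x⌋₊ := by exact_mod_cast h _ hfl.le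
      have h2 : (vertex y (⌊x⌋₊ + 1) : ℝ) ≤ vertex z (⌊x⌋₊ + 1) := by exact_mod_cast h _ hfl
      have h3 := Nat.floor_le hx.1
      have h4 := Nat.lt_floor_add_one x
      rw [polygon, polygon]
      linarith [mul_le_mul_of_nonneg_left h1 (by linarith : 0 ≤ 1 - (x - ⌊x⌋₊)),
        mul_le_mul_of_nonneg_left h2 (by linarith : 0 ≤ x - ⌊x⌋₊)]

theorem vertex_sum_Iic (f : Fin n → ℚ) {m : ℕ} (hm : m ≤ n) :
    vertex (fun i => ∑ j ∈ Finset.Iic i, f j) m = ∑ j : Fin n with j.val < m, f j := by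
  rcases m with - | m
  · simp [vertex]
  · rw [vertex, dif_pos (Nat.lt_of_succ_le hm)]
    refine Finset.sum_congr ?_ fun _ _ => rfl
    ext j
    simp only [Finset.mem_Iic, Finset.mem_filter, Finset.mem_univ, true_and, Fin.le_def]
    omega

theorem vertex_neg_sum_Iic_rev (v : Fin n → ℚ) {m : ℕ} (hm : m ≤ n) :
    vertex (fun i => -∑ j ∈ Finset.Iic i, v j.rev) m = -∑ j : Fin n with n - m ≤ j.val, v j := by
  simp only [← Finset.sum_neg_distrib]
  rw [vertex_sum_Iic (fun j => -v j.rev) hm]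
  refine Finset.sum_equiv Fin.revPerm (fun j => ?_) fun _ _ => rfl
  simp only [Finset.mem_filter, Finset.mem_univ, true_and, Fin.revPerm_apply, Fin.val_rev]
  omega

/-- A polygon of partial sums lies under another one with the same end point if and only if the
partial sums satisfy the corresponding inequalities. -/
theorem polygon_sum_le_iff (f v : Fin n → ℚ) :
    ((∀ x ∈ Set.Icc (0 : ℝ) n, polygon (fun i => ∑ j ∈ Finset.Iic i, f j) x ≤
        polygon (fun i => -∑ j ∈ Finset.Iic i, v j.rev) x) ∧
      polygon (fun i => ∑ j ∈ Finset.Iic i, f j) 0 =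
        polygon (fun i => -∑ j ∈ Finset.Iic i, v j.rev) 0 ∧
      polygon (fun i => ∑ j ∈ Finset.Iic i, f j) n =
        polygon (fun i => -∑ j ∈ Finset.Iic i, v j.rev) n) ↔
    (∀ m ≤ n, ∑ j : Fin n with j.val < m, f j ≤ -∑ j : Fin n with n - m ≤ j.val, v j) ∧
      ∑ j, f j = -∑ j, v j := by
  have h0 : polygon (fun i => ∑ j ∈ Finset.Iic i, f j) 0 =
      polygon (fun i => -∑ j ∈ Finset.Iic i, v j.rev) 0 := by
    rw [← Nat.cast_zero, polygon_natCast, polygon_natCast]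
    rfl
  rw [polygon_le_polygon_iff, polygon_natCast, polygon_natCast, Rat.cast_inj,
    vertex_sum_Iic f le_rfl, vertex_neg_sum_Iic_rev v le_rfl]
  simp only [h0, true_and, Nat.sub_self, Nat.zero_le, Finset.filter_true, Fin.is_lt]
  refine and_congr_left' (forall₂_congr fun m hm => ?_)
  rw [vertex_sum_Iic f hm, vertex_neg_sum_Iic_rev v hm]

/-- The inequalities between partial sums at both ends are automatic. -/
theorem forall_sum_le_iff {d : ℕ} {f v : Fin (d + 1) → ℚ} (heq : ∑ j, f j = -∑ j, v j) :
    (∀ m ≤ d + 1, ∑ j : Fin (d + 1) with j.val < m, f j ≤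
      -∑ j : Fin (d + 1) with d + 1 - m ≤ j.val, v j) ↔
    ∀ m : ℕ, 1 ≤ m → m ≤ d → ∑ j : Fin (d + 1) with j.val < m, f j ≤
      -∑ j : Fin (d + 1) with d + 1 - m ≤ j.val, v j := by
  refine ⟨fun h m _ hm => h m (hm.trans d.le_succ), fun h m hm => ?_⟩
  rcases Nat.eq_zero_or_pos m with rfl | hm0
  · have : (Finset.univ.filter fun j : Fin (d + 1) => d + 1 - 0 ≤ j.val) = ∅ :=
      Finset.filter_eq_empty_iff.2 fun j _ => by omega
    rw [this]
    simp
  · rcases hm.eq_or_lt with rfl | hlt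
    · simpa only [Nat.sub_self, Nat.zero_le, Finset.filter_true, Fin.is_lt] using heq.le
    · exact h m hm0 (Nat.le_of_lt_succ hlt)

end Polygons

end

end FilteredPhi

/-! ### The equivalence of the three conditions -/

theorem proposition3p2 (p : ℕ) [Fact p.Prime]
    (L K : Type*) [Field L] [Field K] [Algebra ℚ_[p] L] [Algebra ℚ_[p] K]
    [FiniteDimensional ℚ_[p] L] [FiniteDimensional ℚ_[p] K]
    (hLK : Fintype.card (L →ₐ[ℚ_[p]] K) = Module.finrank ℚ_[p] L)
    (d : ℕ) (hd : 1 ≤ d)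
    (ζ : Fin (d + 1) → Kˣ)
    (τ : Equiv.Perm (Fin (d + 1)))
    (hτ : Monotone fun j => FilteredPhi.valL p L K (ζ (τ j) : K))
    (w : (L →ₐ[ℚ_[p]] K) → Fin (d + 1) → ℤ) (hw : ∀ σ, StrictMono (w σ)) :
    List.TFAE [
      -- (i)
      ∃ (φ : FilteredPhi.Frobenius p L K (d + 1)) (𝓕 : FilteredPhi.Filtration p L K (d + 1)),
        FilteredPhi.IsSemisimplePart φ.linPowL₀
          ((FilteredPhi.diagFrob p L ζ).restrictScalars (FilteredPhi.L₀ p L)) ∧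
        FilteredPhi.IsAdmissible φ 𝓕 ∧ FilteredPhi.HasJumps 𝓕 w,
      -- (ii), the indices being shifted so that they start at 0
      (∀ i : ℕ, 1 ≤ i → i ≤ d →
        ∑ j : Fin (d + 1) with j.val < i, ∑ σ, (w σ j : ℚ) ≤
          -∑ j : Fin (d + 1) with d + 1 - i ≤ j.val, FilteredPhi.valL p L K (ζ (τ j) : K)) ∧
      ∑ j, ∑ σ, (w σ j : ℚ) = -∑ j, FilteredPhi.valL p L K (ζ (τ j) : K),
      -- (iii)
      (∀ x ∈ Set.Icc (0 : ℝ) (d + 1),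
        FilteredPhi.polygon (fun i : Fin (d + 1) => ∑ j ∈ Finset.Iic i, ∑ σ, (w σ j : ℚ)) x ≤
          FilteredPhi.polygon (fun i : Fin (d + 1) =>
            -∑ j ∈ Finset.Iic i, FilteredPhi.valL p L K (ζ (τ j.rev) : K)) x) ∧
      FilteredPhi.polygon (fun i : Fin (d + 1) => ∑ j ∈ Finset.Iic i, ∑ σ, (w σ j : ℚ)) 0 =
        FilteredPhi.polygon (fun i : Fin (d + 1) =>
          -∑ j ∈ Finset.Iic i, FilteredPhi.valL p L K (ζ (τ j.rev) : K)) 0 ∧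
      FilteredPhi.polygon (fun i : Fin (d + 1) => ∑ j ∈ Finset.Iic i, ∑ σ, (w σ j : ℚ)) (d + 1) =
        FilteredPhi.polygon (fun i : Fin (d + 1) =>
          -∑ j ∈ Finset.Iic i, FilteredPhi.valL p L K (ζ (τ j.rev) : K)) (d + 1)] := by
  have hiff := FilteredPhi.polygon_sum_le_iff (fun j => ∑ σ, (w σ j : ℚ))
    fun j => FilteredPhi.valL p L K (ζ (τ j) : K)
  rw [Nat.cast_succ] at hiff
  tfae_have 1 → 2 := by
    rintro ⟨φ, 𝓕, hss, hadm, hJ⟩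
    obtain ⟨hle, heq⟩ := FilteredPhi.sum_le_of_isAdmissible hss hLK hτ hw hadm hJ
    exact ⟨(FilteredPhi.forall_sum_le_iff heq).1 hle, heq⟩
  tfae_have 2 → 1 := fun ⟨hle, heq⟩ =>
    FilteredPhi.exists_isAdmissible hLK hτ hw ((FilteredPhi.forall_sum_le_iff heq).2 hle) heq
  tfae_have 2 ↔ 3 := by
    refine Iff.trans ?_ hiff.symm
    exact and_congr_left fun heq => (FilteredPhi.forall_sum_le_iff heq).symm
  tfae_finish
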